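/- Let $\mathcal F(a;c;w,\partial_w)=w\partial_w^2+(c-w)\partial_w-a$ be Kummer's confluent operator, $a,c\in\mathbb C$. Contours are continuous, piecewise $C^1$ curves $]0,1[\,\ni\tau\mapsto t(\tau)$ (the ends may be singular points or $\infty$), powers along a contour are given by continuous branches of the logarithms, integrals converge absolutely, and $B\big|_{t(0)}^{t(1)}=0$ means that $B$ has equal limits at the two ends of the contour. **(a)** Let $U\subset\mathbb C$ be open, let $\gamma_w:\ t_w(\tau)=p(\tau)+w\,q(\tau)$, $w\in U$, with $p,q$ continuous and piecewise $C^1$ on $]0,1[$ (a fixed contour is the case $q=0$), avoid $0$ and $w$, with branches of $\log t_w(\tau)$, $\log(t_w(\tau)-w)$ continuous in $(\tau,w)\in{]0,1[}\times U$, and let $\int_{\gamma_w}t^{a-c}e^t(t-w)^{-a}dt$ converge absolutely for all $w\in U$. Let $w\in U$, and at each end of $]0,1[$ suppose that either $q=0$ near this end (the end of the contour is fixed), or $q=1$ near this end, $p\to0$ and $t^{a-c+1}e^t(t-w)^{-a-1}\to0$ there (the end of the contour is $w$). If $t^{a-c+1}e^t(t-w)^{-a-1}\big|_{t(0)}^{t(1)}=0$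 at this $w$, then $\int_{\gamma_w}t^{a-c}e^t(t-w)^{-a}dt$ is holomorphic near $w$ and, at $w$, $$\mathcal F(a;c;w,\partial_w)\int_{\gamma_w}t^{a-c}e^t(t-w)^{-a}\,dt=0 .$$ **(b)** Let $\gamma$ avoid $0$ and $1$, and let $\int_\gamma e^{w/t}t^{-c}(1-t)^{c-a-1}dt$ converge absolutely for all $w$ in an open set $U$. If $w\in U$ and $e^{w/t}t^{-c}(1-t)^{c-a}\big|_{t(0)}^{t(1)}=0$, then this integral is holomorphic near $w$ and, at $w$, $$\mathcal F(a;c;w,\partial_w)\int_\gamma e^{w/t}t^{-c}(1-t)^{c-a-1}\,dt=0 .$$ **Standard solutions.** For $\theta,\alpha\in\mathbb C$ put $$\mathbf F_{\theta,\alpha}(w)=\sum_{n\ge0}\frac{\big(\frac{1+\alpha+\theta}2\big)_n}{\Gamma(1+\alpha+n)}\frac{w^n}{n!},\qquad \mathbf F^{\rm I}_{\theta,\alpha}=\Gamma\big(\tfrac{1+\alpha+\theta}2\big)\Gamma\big(\tfrac{1+\alpha-\theta}2\big)\mathbf F_{\theta,\alpha},$$ and, for $w\notin[0,\infty[$, ${}_2F_0(a,b;-;w)=\lim_{c\to+\infty}{}_2F_1(a,b;c;cw)$,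 where ${}_2F_1$ is the analytic continuation of the Gauss series to $\mathbb C\setminus[1,\infty[$ (this limit exists for all $a,b$), and $$\tilde F_{\theta,\alpha}(w)={}_2F_0\big(\tfrac{1+\alpha+\theta}2,\tfrac{1-\alpha+\theta}2;-;w\big),\qquad \tilde F^{\rm I}_{\theta,\alpha}=\Gamma\big(\tfrac{1-\alpha+\theta}2\big)\tilde F_{\theta,\alpha}.$$ Powers are principal unless stated otherwise. The functions $\mathbf F_{\theta,\alpha}(w)$ on $\mathbb C$; $w^{-\alpha}\mathbf F_{\theta,-\alpha}(w)$ and $w^{\frac{-1-\theta-\alpha}2}\tilde F_{\theta,\alpha}(-w^{-1})$ on $\mathbb C\setminus{]-\infty,0]}$; and $e^w(-w)^{\frac{-1+\theta-\alpha}2}\tilde F_{-\theta,\alpha}(w^{-1})$ on $\mathbb C\setminus[0,\infty[$ solve Kummer's equation with $a=\frac{1+\alpha+\theta}2$, $c=1+\alpha$. They have the following absolutely convergent integral representations. Type (a): 1. For all $\theta,\alpha,w$: $\frac1{2\pi i}\int t^{\frac{-1+\theta-\alpha}2}e^t(t-w)^{\frac{-1-\theta-\alpha}2}dt=\mathbf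 F_{\theta,\alpha}(w)$, over the loop which comes from $-\infty$ along the lower side of $]-\infty,-R]$, encircles $0$ and $w$ counterclockwise along $|t|=R$ (any $R>|w|$) and returns to $-\infty$ along the upper side. Here $\arg t$ runs from $-\pi$ to $\pi$ and $\log(t-w)=\log t+\operatorname{Log}(1-w/t)$. 2. If $\Re(1-\alpha)>|\Re\theta|$: $\int_0^w t^{\frac{-1+\theta-\alpha}2}e^t(w-t)^{\frac{-1-\theta-\alpha}2}dt=w^{-\alpha}\mathbf F^{\rm I}_{\theta,-\alpha}(w)$ for $w\notin{]-\infty,0]}$, and $\int_w^0(-t)^{\frac{-1+\theta-\alpha}2}e^t(t-w)^{\frac{-1-\theta-\alpha}2}dt=(-w)^{-\alpha}\mathbf F^{\rm I}_{\theta,-\alpha}(w)$ for $w\notin[0,\infty[$ (over segments). 3. If $\Re(1+\theta-\alpha)>0$, $w\notin{]-\infty,0]}$: $\int_{-\infty}^0(-t)^{\frac{-1+\theta-\alpha}2}e^t(w-t)^{\frac{-1-\theta-\alpha}2}dt=w^{\frac{-1-\theta-\alpha}2}\tilde F^{\rm I}_{\theta,\alpha}(-w^{-1})$. 4. If $\Re(1-\theta-\alpha)>0$,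 $w\notin[0,\infty[$: $\int_{-\infty}^w(-t)^{\frac{-1+\theta-\alpha}2}e^t(w-t)^{\frac{-1-\theta-\alpha}2}dt=e^w(-w)^{\frac{-1+\theta-\alpha}2}\tilde F^{\rm I}_{-\theta,\alpha}(w^{-1})$ (over the horizontal half-line ending at $w$). Type (b): 1. If $\Re(1+\alpha)>|\Re\theta|$, all $w$: $\int_1^\infty e^{w/t}t^{-1-\alpha}(t-1)^{\frac{-1-\theta+\alpha}2}dt=\mathbf F^{\rm I}_{\theta,\alpha}(w)$. 2. For all $\theta,\alpha$ and $\Re w>0$: $\frac1{2\pi i}\int e^{w/t}t^{-1-\alpha}(1-t)^{\frac{-1-\theta+\alpha}2}dt=w^{-\alpha}\mathbf F_{\theta,-\alpha}(w)$, over the loop which departs from $0$ along the lower side of $[-r,0]$, runs counterclockwise along $|t|=r$ (any $0<r<1$) and returns to $0$ along the upper side, $\arg t$ running from $-\pi$ to $\pi$. 3. If $\Re(1+\theta+\alpha)>0$, $\Re w>0$: $\int_{-\infty}^0e^{w/t}(-t)^{-1-\alpha}(1-t)^{\frac{-1-\theta+\alpha}2}dt=w^{\frac{-1-\theta-\alpha}2}\tilde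 F^{\rm I}_{\theta,-\alpha}(-w^{-1})$. 4. If $\Re(1-\theta+\alpha)>0$, $\Re w<0$: $\int_0^1e^{w/t}t^{-1-\alpha}(1-t)^{\frac{-1-\theta+\alpha}2}dt=e^w(-w)^{\frac{-1+\theta-\alpha}2}\tilde F^{\rm I}_{-\theta,-\alpha}(w^{-1})$. **Connection formulas.** Let $\theta\in\mathbb C$ and $\alpha\in\mathbb C\setminus\mathbb Z$. For both choices of the sign $\pm$, $$w^{\frac{-1-\theta-\alpha}2}\tilde F_{\theta,\pm\alpha}(-w^{-1})=\frac{\pi\,\mathbf F_{\theta,\alpha}(w)}{\sin(\pi(-\alpha))\,\Gamma\big(\frac{1+\theta-\alpha}2\big)}+\frac{\pi\,w^{-\alpha}\mathbf F_{\theta,-\alpha}(w)}{\sin(\pi\alpha)\,\Gamma\big(\frac{1+\theta+\alpha}2\big)},\quad w\notin{]-\infty,0]},$$ $$e^w(-w)^{\frac{-1+\theta-\alpha}2}\tilde F_{-\theta,\pm\alpha}(w^{-1})=\frac{\pi\,\mathbf F_{\theta,\alpha}(w)}{\sin(\pi(-\alpha))\,\Gamma\big(\frac{1-\theta-\alpha}2\big)}+\frac{\pi\,(-w)^{-\alpha}\mathbf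 F_{\theta,-\alpha}(w)}{\sin(\pi\alpha)\,\Gamma\big(\frac{1-\theta+\alpha}2\big)},\quad w\notin[0,\infty[,$$ where $1/\Gamma=0$ at the poles of $\Gamma$. -/

import Mathlib

open Complex Set Filter Topology MeasureTheory

noncomputable section

/-! Kummer's confluent operator. -/

/-- Kummer's confluent operator `w ∂² + (c - w) ∂ - a` applied to `f` at the point `w`. -/
def kummerOp (a c : ℂ) (f : ℂ → ℂ) (w : ℂ) : ℂ :=
  w * deriv (deriv f) w + (c - w) * deriv f w - a * f w

/-- `f` is holomorphic near `w` and satisfies Kummer's confluent equation at `w`. -/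
def SolvesKummerAt (a c : ℂ) (f : ℂ → ℂ) (w : ℂ) : Prop :=
  AnalyticAt ℂ f w ∧ kummerOp a c f w = 0

/-! The functions `₁F₁` and `₂F₀`. -/

/-- The normalized confluent function `∑ (a)ₙ / Γ(c+n) * wⁿ / n!`, for all complex `a`, `c`
(at the poles of `Γ` Mathlib has `Γ = 0`, so that `Γ⁻¹` is the entire function `1/Γ`). -/
def kummerBold (a c w : ℂ) : ℂ :=
  ∑' n : ℕ, (ascPochhammer ℂ n).eval a * (Gamma (c + n))⁻¹ * (w ^ n / (n.factorial : ℂ))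

/-- `f` is holomorphic on `ℂ \ [1, ∞[` and is there the analytic continuation of the Gauss series
`∑ (a)ₙ (b)ₙ / (c)ₙ * zⁿ / n!`. -/
def IsGaussFunction (a b c : ℂ) (f : ℂ → ℂ) : Prop :=
  AnalyticOnNhd ℂ f {z | 1 - z ∈ slitPlane} ∧
    ∀ z : ℂ, ‖z‖ < 1 → f z = ordinaryHypergeometric a b c z

/-- The Gauss hypergeometric function on `ℂ \ [1, ∞[` (on this set it is unique by the identity
theorem). -/
def gaussF (a b c : ℂ) : ℂ → ℂ :=
  Classical.epsilon (IsGaussFunction a b c)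

/-- The function `₂F₀(a, b; -; w) = lim_{c → +∞} ₂F₁(a, b; c; c w)` for `w ∉ [0, ∞[`. -/
def twoFZero (a b w : ℂ) : ℂ :=
  limUnder atTop (fun c : ℝ => gaussF a b (c : ℂ) ((c : ℂ) * w))

/-! The same functions in the Lie-algebraic parameters `θ = 2 a - c`, `α = c - 1`. -/

/-- `𝐅_{θ,α}`. -/
def FBold (θ α w : ℂ) : ℂ := kummerBold ((1 + α + θ) / 2) (1 + α) w

/-- `𝐅ᴵ_{θ,α}`, the type I normalization `Γ(a) Γ(c - a) 𝐅_{θ,α}`. -/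
def FTypeI (θ α w : ℂ) : ℂ :=
  Gamma ((1 + α + θ) / 2) * Gamma ((1 + α - θ) / 2) * FBold θ α w

/-- `F̃_{θ,α}`. -/
def FTilde (θ α w : ℂ) : ℂ := twoFZero ((1 + α + θ) / 2) ((1 - α + θ) / 2) w

/-- `F̃ᴵ_{θ,α}`. -/
def FTildeI (θ α w : ℂ) : ℂ := Gamma ((1 - α + θ) / 2) * FTilde θ α w

/-! Contours and branches. -/

/-- `t` is continuous and piecewise `C¹` on `]0,1[`. -/
def IsPiecewiseC1 (t : ℝ → ℂ) : Prop :=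
  ContinuousOn t (Ioo 0 1) ∧
    ∃ S : Finset ℝ, ∀ τ ∈ Ioo (0 : ℝ) 1, τ ∉ S → ContDiffAt ℝ 1 t τ

/-- `L` is a continuous branch of `log g` on `s`. -/
def IsLogBranchOn {X : Type*} [TopologicalSpace X] (L g : X → ℂ) (s : Set X) : Prop :=
  ContinuousOn L s ∧ ∀ x ∈ s, exp (L x) = g x

/-- The variation `B |₀¹` of `B` along `]0,1[` vanishes: `B` has equal limits at both ends. -/
def EndpointVariationZero (B : ℝ → ℂ) : Prop :=
  ∃ l : ℂ, Tendsto B (𝓝[>] 0) (𝓝 l) ∧ Tendsto B (𝓝[<] 1) (𝓝 l)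

/-- The end `l` (`l = 𝓝[>] 0` or `l = 𝓝[<] 1`) of the contours `τ ↦ p τ + w * q τ` either does
not depend on `w` or is the point `w`. In the second case the contours are translates of each
other near this end and the boundary term `B` vanishes there. -/
def AdmissibleEnd (p q B : ℝ → ℂ) (l : Filter ℝ) : Prop :=
  (∀ᶠ τ in l, q τ = 0) ∨
    ((∀ᶠ τ in l, q τ = 1) ∧ Tendsto p l (𝓝 0) ∧ Tendsto B l (𝓝 0))

/-- The integral of `f` over `s` converges absolutely and equals `v`. -/
def HasIntegralOn (f : ℝ → ℂ) (s : Set ℝ) (v : ℂ) : Prop :=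
  IntegrableOn f s ∧ ∫ x in s, f x = v

/-- Integral over the loop that comes from `-∞` along the lower side of `]-∞, -R]`, runs
counterclockwise once around the circle `|t| = R` and returns to `-∞` along the upper side.
The integrand is a function of `ℓ = log t`, and `arg t` runs from `-π` to `π`. -/
def HasLoopIntegralFromInfinity (g : ℂ → ℂ) (R : ℝ) (v : ℂ) : Prop :=
  ∃ v₁ v₂ v₃ : ℂ,
    HasIntegralOn (fun x : ℝ => g (Real.log x - Real.pi * I)) (Ioi R) v₁ ∧
    HasIntegralOn (fun φ : ℝ => g (Real.log R + φ * I) * (I * R * exp (φ * I)))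
      (Ioc (-Real.pi) Real.pi) v₂ ∧
    HasIntegralOn (fun x : ℝ => g (Real.log x + Real.pi * I)) (Ioi R) v₃ ∧
    v = v₁ + v₂ - v₃

/-- Integral over the loop that departs from `0` along the lower side of `[-r, 0]`, runs
counterclockwise once around the circle `|t| = r` and returns to `0` along the upper side.
The integrand is a function of `ℓ = log t`, and `arg t` runs from `-π` to `π`. -/
def HasLoopIntegralFromZero (g : ℂ → ℂ) (r : ℝ) (v : ℂ) : Prop :=
  ∃ v₁ v₂ v₃ : ℂ,
    HasIntegralOn (fun x : ℝ => g (Real.log x - Real.pi * I)) (Ioo 0 r) v₁ ∧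
    HasIntegralOn (fun φ : ℝ => g (Real.log r + φ * I) * (I * r * exp (φ * I)))
      (Ioc (-Real.pi) Real.pi) v₂ ∧
    HasIntegralOn (fun x : ℝ => g (Real.log x + Real.pi * I)) (Ioo 0 r) v₃ ∧
    v = -v₁ + v₂ + v₃

/-- The parametrized integrand `t^(a-c) e^t (t-w)^(-a) dt` on the contour
`t = p τ + w * q τ`, with the branches given by `L₀` (of `log t`) and `L₁` (of `log (t - w)`). -/
def integrandA (a c : ℂ) (p q : ℝ → ℂ) (L₀ L₁ : ℝ × ℂ → ℂ) (w : ℂ) (τ : ℝ) : ℂ :=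
  exp ((a - c) * L₀ (τ, w)) * exp (p τ + w * q τ) * exp (-a * L₁ (τ, w))
    * (deriv p τ + w * deriv q τ)

/-- The boundary expression `t^(a-c+1) e^t (t-w)^(-a-1)`. -/
def boundaryA (a c : ℂ) (p q : ℝ → ℂ) (L₀ L₁ : ℝ × ℂ → ℂ) (w : ℂ) (τ : ℝ) : ℂ :=
  exp ((a - c + 1) * L₀ (τ, w)) * exp (p τ + w * q τ) * exp ((-a - 1) * L₁ (τ, w))

/-- The parametrized integrand `e^(w/t) t^(-c) (1-t)^(c-a-1) dt`, with the branches given by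
`L₀` (of `log t`) and `L₁` (of `log (1 - t)`). -/
def integrandB (a c : ℂ) (t L₀ L₁ : ℝ → ℂ) (w : ℂ) (τ : ℝ) : ℂ :=
  exp (w / t τ) * exp (-c * L₀ τ) * exp ((c - a - 1) * L₁ τ) * deriv t τ

/-- The boundary expression `e^(w/t) t^(-c) (1-t)^(c-a)`. -/
def boundaryB (a c : ℂ) (t L₀ L₁ : ℝ → ℂ) (w : ℂ) (τ : ℝ) : ℂ :=
  exp (w / t τ) * exp (-c * L₀ τ) * exp ((c - a) * L₁ τ)

end

open Complex Set Filter Topology MeasureTheory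

/-! Contour integrals. Applied in w, Kummer's operator turns the integrand into an exact
differential dG. For type (b), G is minus the boundary term. For type (a) on a fixed contour it is
-a times the boundary term, with corrections where the contour moves. Differentiation under the
integral sign then gives G(1) - G(0) = 0 (`solvesKummerAt_integral`). Cauchy's estimates control the
derivatives, so only the integrand itself has to be dominated locally uniformly in w, although
absolute convergence is assumed only for each single w. For type (b), |e^(z/t)| on a disc is at most
its maximum over the corners of a square. For type (a), the logarithm of the integrand has bounded
oscillation in w, by compactness inside ]0,1[ and by `norm_sub_le_of_exp_eq_affine` near the ends.

Special functions. Identities for `kummerBold` come from comparing coefficients. The function ₂F₀ is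
a limit of rescaled Euler integrals, hence a Laplace integral when Re b > 0. All its properties are
proved there first and then carried to every (a, b) by `twoFZero_recursion`, which expresses the
parameters (a, b) through (a+1, b+1) and (a+2, b+2).

Integral representations. Segments and [1,∞[ reduce to Euler's Beta-type integral
(`hasIntegralOn_euler_kummer`). Half-lines and [0,1] of type (b) reduce to the two Laplace integrals
of Tricomi's function `kummerU`. Loops reduce to Hankel's integral for 1/Γ, summed against a
binomial series (`hasLoopIntegral_kummerBold`).

Connection formulas. The Wronskian of U with the second solution at 0 is a constant multiple of the
explicit Wronskian factor, and the constant is found from the limit w → 0+. Together with the same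
statement for exchanged parameters this is a linear system for U
(`kummerU_connection_of_one_le_re`). The recursion removes the restriction on the parameters, and
Kummer's transformation w ↦ -w, θ ↦ -θ gives the second formula. -/

/-! ### Holomorphic dependence of integrals on a parameter -/

section ParametricIntegrals

variable {α : Type*} [MeasurableSpace α] {μ : Measure α}

/-- Holomorphy under the integral sign, with a locally uniform integrable bound. -/
theorem hasDerivAt_integral_of_dominated_holomorphic {F : ℂ → α → ℂ} {bound : α → ℝ} {w : ℂ}
    {r : ℝ} (hmeas : ∀ z ∈ Metric.ball w r, AEStronglyMeasurable (F z) μ)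
    (hd : ∀ᵐ τ ∂μ, DifferentiableOn ℂ (fun z => F z τ) (Metric.ball w r))
    (hb : ∀ᵐ τ ∂μ, ∀ z ∈ Metric.ball w r, ‖F z τ‖ ≤ bound τ) (hbi : Integrable bound μ)
    {z : ℂ} (hz : z ∈ Metric.ball w r) :
    Integrable (fun τ => deriv (fun z => F z τ) z) μ ∧
      HasDerivAt (fun z => ∫ τ, F z τ ∂μ) (∫ τ, deriv (fun z => F z τ) z ∂μ) z := by
  obtain ⟨δ, hδ, hδr⟩ := Metric.isOpen_ball.mem_nhds_iff.1 (Metric.isOpen_ball.mem_nhds hz) |>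
    fun h => Metric.mem_nhds_iff.1 (mem_nhds_iff.2 ⟨_, subset_rfl, Metric.isOpen_ball, hz⟩)
  have hint : ∀ y ∈ Metric.ball w r, Integrable (F y) μ := fun y hy =>
    hbi.mono' (hmeas y hy) (hb.mono fun τ hτ => hτ y hy)
  have hsub : ∀ y ∈ Metric.ball z (δ / 2), Metric.closedBall y (δ / 2) ⊆ Metric.ball w r := by
    intro y hy x hx
    apply hδr
    rw [Metric.mem_ball] at hy ⊢
    rw [Metric.mem_closedBall] at hx
    linarith [dist_triangle x y z]
  have hmem : ∀ y ∈ Metric.ball z (δ / 2), y ∈ Metric.ball w r := fun y hy =>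
    hsub y hy (Metric.mem_closedBall_self (by positivity))
  have hderiv : ∀ᵐ τ ∂μ, ∀ y ∈ Metric.ball z (δ / 2),
      HasDerivAt (fun z => F z τ) (deriv (fun z => F z τ) y) y := by
    filter_upwards [hd] with τ hτ y hy
    exact (hτ.differentiableAt (Metric.isOpen_ball.mem_nhds (hmem y hy))).hasDerivAt
  refine hasDerivAt_integral_of_dominated_loc_of_deriv_le (bound := fun τ => bound τ / (δ / 2))
    (F := F) (F' := fun y τ => deriv (fun z => F z τ) y) (Metric.ball_mem_nhds z (half_pos hδ))
    ?_ (hint z hz) ?_ ?_ (hbi.div_const _) hderiv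
  · filter_upwards [Metric.isOpen_ball.mem_nhds hz] with y hy using hmeas y hy
  -- Measurability in τ of the derivative: it is a limit of difference quotients along a sequence.
  -- The denominator n + 2 keeps already the term n = 0 strictly inside the ball of radius δ/2.
  · have hlim : Tendsto (fun n : ℕ => z + ((δ / 2 / (n + 2) : ℝ) : ℂ)) atTop (𝓝[≠] z) := by
      apply tendsto_nhdsWithin_of_tendsto_nhds_of_eventually_within
      · have : Tendsto (fun n : ℕ => δ / 2 / ((n : ℝ) + 2)) atTop (𝓝 0) :=
          tendsto_const_nhds.div_atTop
            (tendsto_atTop_add_const_right _ _ tendsto_natCast_atTop_atTop)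
        simpa using tendsto_const_nhds.add ((continuous_ofReal.tendsto 0).comp this)
      · refine Eventually.of_forall fun n => ?_
        have : (δ / 2 / ((n : ℝ) + 2)) ≠ 0 := by positivity
        simp only [mem_compl_iff, mem_singleton_iff, add_eq_left]
        exact_mod_cast this
    refine aestronglyMeasurable_of_tendsto_ae atTop
      (f := fun (n : ℕ) τ => slope (fun z => F z τ) z (z + ((δ / 2 / (n + 2) : ℝ) : ℂ)))
      (fun n => ?_) ?_
    · have hy : z + ((δ / 2 / (n + 2) : ℝ) : ℂ) ∈ Metric.ball z (δ / 2) := by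
        rw [Metric.mem_ball, dist_eq_norm, add_sub_cancel_left, norm_real, Real.norm_eq_abs,
          abs_of_pos (by positivity), div_lt_iff₀ (by positivity)]
        nlinarith [Nat.cast_nonneg (α := ℝ) n]
      simp only [slope, vsub_eq_sub, smul_eq_mul]
      exact ((hmeas _ (hmem _ hy)).sub (hmeas z hz)).const_mul _
    · filter_upwards [hderiv] with τ hτ
      exact (hasDerivAt_iff_tendsto_slope.1
        (hτ z (Metric.mem_ball_self (half_pos hδ)))).comp hlim
  -- Cauchy's estimate on the circle of radius δ/2 about y: a bound for F is also a bound, up to a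
  -- constant, for its derivative.
  · filter_upwards [hd, hb] with τ hτ hbτ y hy
    refine norm_deriv_le_of_forall_mem_sphere_norm_le (half_pos hδ) ?_ fun x hx =>
      hbτ x (hsub y hy (Metric.sphere_subset_closedBall hx))
    exact (hτ.mono (hsub y hy)).diffContOnCl_ball subset_rfl

/-- Second derivatives under the integral sign. -/
theorem hasDerivAt_deriv_integral_of_dominated_holomorphic {F : ℂ → α → ℂ} {bound : α → ℝ} {w : ℂ}
    {r : ℝ} (hr : 0 < r) (hmeas : ∀ z ∈ Metric.ball w r, AEStronglyMeasurable (F z) μ)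
    (hd : ∀ᵐ τ ∂μ, DifferentiableOn ℂ (fun z => F z τ) (Metric.ball w r))
    (hb : ∀ᵐ τ ∂μ, ∀ z ∈ Metric.ball w r, ‖F z τ‖ ≤ bound τ) (hbi : Integrable bound μ) :
    Integrable (fun τ => deriv (deriv (fun z => F z τ)) w) μ ∧
      HasDerivAt (deriv (fun z => ∫ τ, F z τ ∂μ)) (∫ τ, deriv (deriv (fun z => F z τ)) w ∂μ) w := by
  have hsub : ∀ y ∈ Metric.ball w (r / 2), Metric.closedBall y (r / 2) ⊆ Metric.ball w r := by
    intro y hy x hx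
    rw [Metric.mem_ball] at hy ⊢
    rw [Metric.mem_closedBall] at hx
    linarith [dist_triangle x y w]
  have hmem : ∀ y ∈ Metric.ball w (r / 2), y ∈ Metric.ball w r := fun y hy =>
    hsub y hy (Metric.mem_closedBall_self (by positivity))
  -- The first-order statement is applied to ∂F on the half disc, where Cauchy's estimate dominates
  -- ∂F.
  have h := hasDerivAt_integral_of_dominated_holomorphic
    (F := fun z τ => deriv (fun z => F z τ) z) (bound := fun τ => bound τ / (r / 2))
    (w := w) (r := r / 2) (μ := μ)
    (fun z hz => (hasDerivAt_integral_of_dominated_holomorphic hmeas hd hb hbi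
      (hmem z hz)).1.aestronglyMeasurable)
    (by
      filter_upwards [hd] with τ hτ
      exact (hτ.deriv Metric.isOpen_ball).mono hmem)
    (by
      filter_upwards [hd, hb] with τ hτ hbτ y hy
      refine norm_deriv_le_of_forall_mem_sphere_norm_le (half_pos hr) ?_ fun x hx =>
        hbτ x (hsub y hy (Metric.sphere_subset_closedBall hx))
      exact (hτ.mono (hsub y hy)).diffContOnCl_ball subset_rfl)
    (hbi.div_const _) (Metric.mem_ball_self (half_pos hr))
  refine ⟨h.1, h.2.congr_of_eventuallyEq ?_⟩
  filter_upwards [Metric.ball_mem_nhds w hr] with z hz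
  exact (hasDerivAt_integral_of_dominated_holomorphic hmeas hd hb hbi hz).2.deriv

theorem analyticAt_integral_of_dominated_holomorphic {F : ℂ → α → ℂ} {bound : α → ℝ} {w : ℂ}
    {r : ℝ} (hr : 0 < r) (hmeas : ∀ z ∈ Metric.ball w r, AEStronglyMeasurable (F z) μ)
    (hd : ∀ᵐ τ ∂μ, DifferentiableOn ℂ (fun z => F z τ) (Metric.ball w r))
    (hb : ∀ᵐ τ ∂μ, ∀ z ∈ Metric.ball w r, ‖F z τ‖ ≤ bound τ) (hbi : Integrable bound μ) :
    AnalyticAt ℂ (fun z => ∫ τ, F z τ ∂μ) w := by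
  have : DifferentiableOn ℂ (fun z => ∫ τ, F z τ ∂μ) (Metric.ball w r) := fun z hz =>
    (hasDerivAt_integral_of_dominated_holomorphic hmeas hd hb
      hbi hz).2.differentiableAt.differentiableWithinAt
  exact this.analyticAt (Metric.ball_mem_nhds w hr)

end ParametricIntegrals

/-- The fundamental theorem of calculus on `]0,1[` for a continuous function with limits at the
ends which is differentiable off a finite set. -/
theorem setIntegral_Ioo_eq_sub_of_tendsto {G g : ℝ → ℂ} {S : Set ℝ} (hS : S.Countable)
    (hG : ContinuousOn G (Ioo 0 1)) (hd : ∀ τ ∈ Ioo (0 : ℝ) 1 \ S, HasDerivAt G (g τ) τ)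
    (hg : IntegrableOn g (Ioo 0 1)) {l₀ l₁ : ℂ} (h0 : Tendsto G (𝓝[>] 0) (𝓝 l₀))
    (h1 : Tendsto G (𝓝[<] 1) (𝓝 l₁)) : ∫ τ in Ioo (0 : ℝ) 1, g τ = l₁ - l₀ := by
  -- `G` is replaced at the two ends by its limits, which makes it continuous on [0,1].
  set F : ℝ → ℂ := Function.update (Function.update G 0 l₀) 1 l₁ with hF
  have hFG : ∀ τ ∈ Ioo (0 : ℝ) 1, F τ = G τ := fun τ hτ => by
    simp [hF, Function.update_of_ne hτ.2.ne, Function.update_of_ne hτ.1.ne']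
  have hcont : ContinuousOn F (Icc 0 1) := by
    rw [hF, continuousOn_update_iff, continuousOn_update_iff, Icc_sdiff_right, Ico_sdiff_left]
    refine ⟨⟨hG, ?_⟩, ?_⟩
    · exact fun _ => h0.mono_left (nhdsWithin_mono _ Ioo_subset_Ioi_self)
    · rintro -
      refine (h1.congr' ?_).mono_left (nhdsWithin_mono _ Ico_subset_Iio_self)
      filter_upwards [Ioo_mem_nhdsLT zero_lt_one] with _ hz using
        (Function.update_of_ne hz.1.ne' _ _).symm
  have := integral_eq_of_hasDerivAt_off_countable_of_le F g zero_le_one hS hcont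
    (fun τ hτ => (hd τ hτ).congr_of_eventuallyEq (by
      filter_upwards [Ioo_mem_nhds hτ.1.1 hτ.1.2] with y hy using hFG y hy))
    ((intervalIntegrable_iff_integrableOn_Ioo_of_le zero_le_one).2 hg)
  rw [intervalIntegral.integral_of_le zero_le_one, integral_Ioc_eq_integral_Ioo] at this
  rw [this]
  simp [hF]

/-- An integral solves Kummer's equation if Kummer's operator turns the integrand into the
derivative of a function with equal limits at the ends. -/
theorem solvesKummerAt_integral {a c : ℂ} {F : ℂ → ℝ → ℂ} {bound : ℝ → ℝ} {w : ℂ}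
    {r : ℝ} (hr : 0 < r)
    (hmeas : ∀ z ∈ Metric.ball w r, AEStronglyMeasurable (F z) (volume.restrict (Ioo 0 1)))
    {S : Set ℝ} (hS : S.Countable)
    (hd : ∀ τ ∈ Ioo (0 : ℝ) 1 \ S, DifferentiableOn ℂ (fun z => F z τ) (Metric.ball w r))
    (hb : ∀ τ ∈ Ioo (0 : ℝ) 1, ∀ z ∈ Metric.ball w r, ‖F z τ‖ ≤ bound τ)
    (hbi : IntegrableOn bound (Ioo 0 1)) {G : ℝ → ℂ} (hG : ContinuousOn G (Ioo 0 1))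
    (hGd : ∀ τ ∈ Ioo (0 : ℝ) 1 \ S, HasDerivAt G (kummerOp a c (fun z => F z τ) w) τ)
    (hl : EndpointVariationZero G) :
    SolvesKummerAt a c (fun z => ∫ τ in Ioo (0 : ℝ) 1, F z τ) w := by
  have hd' : ∀ᵐ τ ∂(volume.restrict (Ioo (0 : ℝ) 1)),
      DifferentiableOn ℂ (fun z => F z τ) (Metric.ball w r) := by
    rw [ae_restrict_iff' measurableSet_Ioo]
    filter_upwards [(hS.ae_notMem volume)] with τ hτ h using hd τ ⟨h, hτ⟩
  have hb' : ∀ᵐ τ ∂(volume.restrict (Ioo (0 : ℝ) 1)), ∀ z ∈ Metric.ball w r,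
      ‖F z τ‖ ≤ bound τ := by
    rw [ae_restrict_iff' measurableSet_Ioo]
    exact Eventually.of_forall hb
  have hw := Metric.mem_ball_self (x := w) hr
  obtain ⟨i1, d1⟩ := hasDerivAt_integral_of_dominated_holomorphic hmeas hd' hb' hbi hw
  obtain ⟨i2, d2⟩ := hasDerivAt_deriv_integral_of_dominated_holomorphic hr hmeas hd' hb' hbi
  have i0 : Integrable (F w) (volume.restrict (Ioo (0 : ℝ) 1)) :=
    hbi.mono' (hmeas w hw) (hb'.mono fun τ hτ => hτ w hw)
  refine ⟨analyticAt_integral_of_dominated_holomorphic hr hmeas hd' hb' hbi, ?_⟩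
  obtain ⟨l, h0, h1⟩ := hl
  have key := setIntegral_Ioo_eq_sub_of_tendsto hS hG hGd
    (((i2.const_mul w).add (i1.const_mul (c - w))).sub (i0.const_mul a)) h0 h1
  rw [sub_self] at key
  -- The right-hand side 0 becomes the integral of Kummer's operator applied to the integrand. What
  -- remains is to move the operator out of the integral.
  rw [← key]
  simp only [kummerOp]
  have i3 : Integrable (fun τ => w * deriv (deriv fun z => F z τ) w +
      (c - w) * deriv (fun z => F z τ) w) (volume.restrict (Ioo (0 : ℝ) 1)) :=
    (i2.const_mul w).add (i1.const_mul (c - w))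
  rw [d1.deriv, d2.deriv, integral_sub i3 (i0.const_mul a), integral_add (i2.const_mul w) (i1.const_mul (c - w)), integral_const_mul, integral_const_mul,
    integral_const_mul]

theorem kummerOp_eq_of_hasDerivAt {a c w f₂ : ℂ} {f f₁ : ℂ → ℂ}
    (h₁ : ∀ᶠ z in 𝓝 w, HasDerivAt f (f₁ z) z) (h₂ : HasDerivAt f₁ f₂ w) :
    kummerOp a c f w = w * f₂ + (c - w) * f₁ w - a * f w := by
  have e : deriv f =ᶠ[𝓝 w] f₁ := h₁.mono fun z hz => hz.deriv
  rw [kummerOp, e.deriv_eq, h₂.deriv, e.eq_of_nhds]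

/-! ### Branches of the logarithm -/

section LogBranches

/-- By continuity L y - L x has imaginary part in ]-π, π[ near x, and there the principal logarithm
inverts exp. Every continuous branch thus inherits its derivative from the principal one at 1. -/
theorem eventually_eq_add_log_of_exp_eq {X : Type*} [TopologicalSpace X] {L g : X → ℂ} {x : X}
    (hc : ContinuousAt L x) (he : ∀ᶠ y in 𝓝 x, exp (L y) = g y) :
    ∀ᶠ y in 𝓝 x, L y = L x + log (g y / g x) := by
  have hlim : Tendsto (fun y => (L y - L x).im) (𝓝 x) (𝓝 0) := by
    have : ContinuousAt (fun y => (L y - L x).im) x :=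
      continuous_im.continuousAt.comp (hc.sub continuousAt_const)
    simpa [ContinuousAt] using this
  filter_upwards [he, hlim (Ioo_mem_nhds (neg_lt_zero.2 Real.pi_pos) Real.pi_pos)] with y hy hI
  rw [← hy, ← he.self_of_nhds, ← exp_sub, log_exp hI.1 hI.2.le]
  ring

theorem hasDerivAt_of_exp_eq {L g : ℂ → ℂ} {z g' : ℂ} (hc : ContinuousAt L z)
    (he : ∀ᶠ y in 𝓝 z, exp (L y) = g y) (hg : HasDerivAt g g' z) :
    HasDerivAt L (g' / g z) z := by
  have h0 : g z ≠ 0 := by rw [← he.self_of_nhds]; exact exp_ne_zero _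
  have := ((hg.div_const (g z)).clog (by rw [div_self h0]; exact one_mem_slitPlane)).const_add (L z)
  rw [div_self h0, div_one] at this
  exact this.congr_of_eventuallyEq (eventually_eq_add_log_of_exp_eq hc he)

theorem hasDerivAt_of_exp_eq_real {L g : ℝ → ℂ} {x : ℝ} {g' : ℂ} (hc : ContinuousAt L x)
    (he : ∀ᶠ y in 𝓝 x, exp (L y) = g y) (hg : HasDerivAt g g' x) :
    HasDerivAt L (g' / g x) x := by
  have h0 : g x ≠ 0 := by rw [← he.self_of_nhds]; exact exp_ne_zero _
  have := ((hg.div_const (g x)).clog_real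
    (by rw [div_self h0]; exact one_mem_slitPlane)).const_add (L x)
  rw [div_self h0, div_one] at this
  exact this.congr_of_eventuallyEq (eventually_eq_add_log_of_exp_eq hc he)

/-- The oscillation of a branch of `log (u + k z)`, with `k = 0` or `|k| = 1`, on a disc of half
the radius. -/
theorem norm_sub_le_of_exp_eq_affine {L : ℂ → ℂ} {w u k : ℂ} {r : ℝ} (hr : 0 < r)
    (hk : k = 0 ∨ ‖k‖ = 1) (hc : ContinuousOn L (Metric.ball w (2 * r)))
    (he : ∀ z ∈ Metric.ball w (2 * r), exp (L z) = u + k * z) {z z' : ℂ}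
    (hz : z ∈ Metric.closedBall w r) (hz' : z' ∈ Metric.closedBall w r) : ‖L z - L z'‖ ≤ 2 := by
  have hsub : ∀ y ∈ Metric.closedBall w r, y ∈ Metric.ball w (2 * r) := fun y hy => by
    rw [Metric.mem_closedBall] at hy
    rw [Metric.mem_ball]
    linarith
  have hd : ∀ y ∈ Metric.closedBall w r,
      HasDerivWithinAt L (k / (u + k * y)) (Metric.closedBall w r) y := fun y hy => by
    have hn := Metric.isOpen_ball.mem_nhds (hsub y hy)
    refine (hasDerivAt_of_exp_eq (g := fun y => u + k * y) (hc.continuousAt hn) ?_ ?_).hasDerivWithinAt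
    · filter_upwards [hn] with x hx using he x hx
    · simpa using ((hasDerivAt_id y).const_mul k).const_add u
  -- With |L'| ≤ 1/r, the mean value inequality over a distance of at most 2r gives the bound 2,
  -- independent of r and u.
  have hb : ∀ y ∈ Metric.closedBall w r, ‖k / (u + k * y)‖ ≤ 1 / r := fun y hy => by
    rcases hk with rfl | hk
    · simp [hr.le]
    · have hk0 : k ≠ 0 := by rintro rfl; simp at hk
      rw [norm_div, hk]
      refine one_div_le_one_div_of_le hr ?_
      -- If |u + k y| < r, the zero -u/k of u + k z would lie within r of y, hence in the disc of
      -- radius 2r, where exp (L z) cannot vanish.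
      by_contra hlt
      push Not at hlt
      have hroot : -u / k ∈ Metric.ball w (2 * r) := by
        have h1 : ‖-u / k - y‖ < r := by
          have : -u / k - y = -(u + k * y) / k := by field_simp; ring
          rwa [this, norm_div, hk, norm_neg, div_one]
        rw [Metric.mem_ball]
        rw [Metric.mem_closedBall] at hy
        rw [← dist_eq_norm] at h1
        linarith [dist_triangle (-u / k) y w]
      have := he _ hroot
      rw [mul_div_cancel₀ _ hk0, add_neg_cancel] at this
      exact exp_ne_zero _ this
  have := (convex_closedBall w r).norm_image_sub_le_of_norm_hasDerivWithin_le hd hb hz' hz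
  refine this.trans ?_
  have h2 : ‖z - z'‖ ≤ 2 * r := by
    rw [← dist_eq_norm]
    rw [Metric.mem_closedBall] at hz hz'
    linarith [dist_triangle_right z z' w]
  rw [div_mul_eq_mul_div, one_mul, div_le_iff₀ hr]
  exact h2

end LogBranches

/-- A continuous function on `]0,1[ × U` whose oscillation in the second variable is bounded near
the ends of `]0,1[` has bounded oscillation. -/
theorem exists_oscillation_bound {N : ℝ × ℂ → ℂ} {U K : Set ℂ} (hK : IsCompact K) (hKU : K ⊆ U)
    (hN : ContinuousOn N (Ioo 0 1 ×ˢ U)) {C : ℝ}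
    (h0 : ∀ᶠ τ in 𝓝[>] (0 : ℝ), ∀ z ∈ K, ∀ z' ∈ K, ‖N (τ, z) - N (τ, z')‖ ≤ C)
    (h1 : ∀ᶠ τ in 𝓝[<] (1 : ℝ), ∀ z ∈ K, ∀ z' ∈ K, ‖N (τ, z) - N (τ, z')‖ ≤ C) :
    ∃ M, ∀ τ ∈ Ioo (0 : ℝ) 1, ∀ z ∈ K, ∀ z' ∈ K, ‖N (τ, z) - N (τ, z')‖ ≤ M := by
  obtain ⟨x, hx, hx0⟩ := (mem_nhdsGT_iff_exists_Ioo_subset' zero_lt_one).1 h0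
  obtain ⟨y, hy, hy1⟩ := (mem_nhdsLT_iff_exists_Ioo_subset' zero_lt_one).1 h1
  have hcomp : IsCompact (Icc x y ×ˢ K) := isCompact_Icc.prod hK
  obtain ⟨M, hM⟩ := hcomp.exists_bound_of_continuousOn
    (hN.mono (prod_mono (fun τ hτ => ⟨hx.trans_le hτ.1, hτ.2.trans_lt hy⟩) hKU))
  refine ⟨max C (M + M), fun τ hτ z hz z' hz' => ?_⟩
  by_cases hτx : τ < x
  · exact (hx0 ⟨hτ.1, hτx⟩ z hz z' hz').trans (le_max_left _ _)
  by_cases hτy : y < τ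
  · exact (hy1 ⟨hτy, hτ.2⟩ z hz z' hz').trans (le_max_left _ _)
  · have hm : τ ∈ Icc x y := ⟨not_lt.1 hτx, not_lt.1 hτy⟩
    exact ((norm_sub_le _ _).trans (add_le_add (hM (τ, z) ⟨hm, hz⟩) (hM (τ, z') ⟨hm, hz'⟩))).trans
      (le_max_right _ _)

/-! ### Contour integrals of type b) -/

/-- Kummer's operator multiplies the integrand by w/t² + (c-w)/t - a, which is the derivative of
minus the boundary term. For domination, |e^(z/t)| = exp(Re(z/t)) is the exponential of a real
linear function of z. On the disc of radius δ it is therefore at most its value at some corner of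
the circumscribed square, and the sum over the four corners is an integrable bound. -/
theorem solvesKummerAt_integral_integrandB (a c : ℂ) (t : ℝ → ℂ) (U : Set ℂ) (L₀ L₁ : ℝ → ℂ)
    (ht : IsPiecewiseC1 t) (hU : IsOpen U) (hL₀ : IsLogBranchOn L₀ t (Ioo 0 1))
    (hL₁ : IsLogBranchOn L₁ (fun τ => 1 - t τ) (Ioo 0 1))
    (hint : ∀ w ∈ U, IntegrableOn (integrandB a c t L₀ L₁ w) (Ioo 0 1)) (w : ℂ) (hw : w ∈ U)
    (hB : EndpointVariationZero (boundaryB a c t L₀ L₁ w)) :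
    SolvesKummerAt a c (fun z => ∫ τ in Ioo (0 : ℝ) 1, integrandB a c t L₀ L₁ z τ) w := by
  obtain ⟨ε, hε, hball⟩ := Metric.isOpen_iff.1 hU w hw
  obtain ⟨htc, S, hS⟩ := ht
  have ht0 : ∀ τ ∈ Ioo (0 : ℝ) 1, t τ ≠ 0 := fun τ hτ => by
    rw [← hL₀.2 τ hτ]; exact exp_ne_zero _
  have he1 : ∀ τ ∈ Ioo (0 : ℝ) 1, exp (L₁ τ) = 1 - t τ := hL₁.2
  have ht1 : ∀ τ ∈ Ioo (0 : ℝ) 1, 1 - t τ ≠ 0 := fun τ hτ => by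
    rw [← he1 τ hτ]; exact exp_ne_zero _
  -- The corners of the square lie at distance √2 δ < ε from w, so they belong to U.
  set δ : ℝ := ε / 2 with hδ
  have hδ0 : 0 < δ := half_pos hε
  have hv : ∀ s s' : ℝ, |s| ≤ δ → |s'| ≤ δ → w + (s + s' * I) ∈ U := by
    intro s s' hs hs'
    apply hball
    rw [Metric.mem_ball, dist_eq_norm, add_sub_cancel_left]
    have h1 : ‖(s : ℂ) + s' * I‖ ^ 2 = s ^ 2 + s' ^ 2 := by
      rw [← normSq_eq_norm_sq, normSq_add_mul_I]
    have h2 : s ^ 2 ≤ δ ^ 2 := sq_le_sq' (abs_le.1 hs).1 (abs_le.1 hs).2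
    have h3 : s' ^ 2 ≤ δ ^ 2 := sq_le_sq' (abs_le.1 hs').1 (abs_le.1 hs').2
    refine lt_of_pow_lt_pow_left₀ 2 hε.le ?_
    nlinarith
  have hd1 : |δ| ≤ δ := (abs_of_pos hδ0).le
  have hd2 : |(-δ)| ≤ δ := by rw [abs_neg]; exact hd1
  have hcont0 : ContinuousOn (fun τ => exp (w / t τ)) (Ioo 0 1) :=
    (continuousOn_const.div htc ht0).cexp
  have hderz : ∀ τ z, HasDerivAt (fun z => integrandB a c t L₀ L₁ z τ)
      (1 / t τ * integrandB a c t L₀ L₁ z τ) z := by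
    intro τ z
    have h1 : HasDerivAt (fun z : ℂ => exp (z / t τ)) (exp (z / t τ) * (1 / t τ)) z :=
      ((hasDerivAt_id z).div_const (t τ)).cexp
    refine (((h1.mul_const (exp (-c * L₀ τ))).mul_const (exp ((c - a - 1) * L₁ τ))).mul_const
      (deriv t τ)).congr_deriv ?_
    simp only [integrandB]
    ring
  refine solvesKummerAt_integral (r := δ) hδ0 (S := S)
    (bound := fun τ => ‖integrandB a c t L₀ L₁ (w + ((δ : ℝ) + (δ : ℝ) * I)) τ‖ +
      ‖integrandB a c t L₀ L₁ (w + ((δ : ℝ) + (-δ : ℝ) * I)) τ‖ +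
      ‖integrandB a c t L₀ L₁ (w + ((-δ : ℝ) + (δ : ℝ) * I)) τ‖ +
      ‖integrandB a c t L₀ L₁ (w + ((-δ : ℝ) + (-δ : ℝ) * I)) τ‖)
    (G := fun τ => -boundaryB a c t L₀ L₁ w τ) ?_ S.countable_toSet ?_ ?_ ?_ ?_ ?_ ?_
  · intro z hz
    exact (hint z (hball (Metric.ball_subset_ball (by linarith) hz))).aestronglyMeasurable
  · intro τ _ z _
    exact (hderz τ z).differentiableAt.differentiableWithinAt
  · intro τ _ z hz
    have key : ∃ s s' : ℝ, (s = δ ∨ s = -δ) ∧ (s' = δ ∨ s' = -δ) ∧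
        (z / t τ).re ≤ ((w + (s + s' * I)) / t τ).re := by
      set u : ℂ := (t τ)⁻¹
      have hre : |(z - w).re| ≤ δ := (abs_re_le_norm _).trans (by
        rw [← dist_eq_norm]; exact (Metric.mem_ball.1 hz).le)
      have him : |(z - w).im| ≤ δ := (abs_im_le_norm _).trans (by
        rw [← dist_eq_norm]; exact (Metric.mem_ball.1 hz).le)
      have h1 : (z - w).re * u.re ≤ δ * |u.re| := (le_abs_self _).trans (by
        rw [abs_mul]; exact mul_le_mul_of_nonneg_right hre (abs_nonneg _))
      have h2 : -((z - w).im * u.im) ≤ δ * |u.im| := (neg_le_abs _).trans (by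
        rw [abs_mul]; exact mul_le_mul_of_nonneg_right him (abs_nonneg _))
      refine ⟨if 0 ≤ u.re then δ else -δ, if 0 ≤ u.im then -δ else δ, ?_, ?_, ?_⟩
      · split_ifs <;> simp
      · split_ifs <;> simp
      · rw [div_eq_mul_inv, div_eq_mul_inv]
        change (z * u).re ≤ ((w + _) * u).re
        simp only [sub_re, sub_im] at h1 h2
        split_ifs with h3 h4 h4 <;>
        [rw [abs_of_nonneg h3] at h1; rw [abs_of_nonneg h3] at h1; rw [abs_of_neg (not_le.1 h3)] at h1;
          rw [abs_of_neg (not_le.1 h3)] at h1] <;>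
        [rw [abs_of_nonneg h4] at h2; rw [abs_of_neg (not_le.1 h4)] at h2; rw [abs_of_nonneg h4] at h2;
          rw [abs_of_neg (not_le.1 h4)] at h2] <;>
        · simp only [mul_re, add_re, add_im, ofReal_re, ofReal_im, I_re, I_im, mul_im]
          linarith
    obtain ⟨s, s', hs, hs', hle⟩ := key
    have hmono : ‖integrandB a c t L₀ L₁ z τ‖ ≤
        ‖integrandB a c t L₀ L₁ (w + (s + s' * I)) τ‖ := by
      simp only [integrandB, norm_mul]
      gcongr ?_ * _ * _ * _
      rw [norm_exp, norm_exp]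
      exact Real.exp_le_exp.2 hle
    refine hmono.trans ?_
    rcases hs with rfl | rfl <;> rcases hs' with rfl | rfl <;>
    · have h1 := norm_nonneg (integrandB a c t L₀ L₁ (w + ((δ : ℝ) + (δ : ℝ) * I)) τ)
      have h2 := norm_nonneg (integrandB a c t L₀ L₁ (w + ((δ : ℝ) + (-δ : ℝ) * I)) τ)
      have h3 := norm_nonneg (integrandB a c t L₀ L₁ (w + ((-δ : ℝ) + (δ : ℝ) * I)) τ)
      have h4 := norm_nonneg (integrandB a c t L₀ L₁ (w + ((-δ : ℝ) + (-δ : ℝ) * I)) τ)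
      linarith
  · exact ((((hint _ (hv _ _ hd1 hd1)).norm).add (hint _ (hv _ _ hd1 hd2)).norm).add
      (hint _ (hv _ _ hd2 hd1)).norm).add (hint _ (hv _ _ hd2 hd2)).norm
  · exact ((hcont0.mul (continuousOn_const.mul hL₀.1).cexp).mul
      (continuousOn_const.mul hL₁.1).cexp).neg
  · intro τ hτ
    have hn := Ioo_mem_nhds hτ.1.1 hτ.1.2
    have hdt : HasDerivAt t (deriv t τ) τ :=
      ((hS τ hτ.1 hτ.2).differentiableAt one_ne_zero).hasDerivAt
    have h0 := hasDerivAt_of_exp_eq_real (hL₀.1.continuousAt hn)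
      (by filter_upwards [hn] with x hx using hL₀.2 x hx) hdt
    have h1 := hasDerivAt_of_exp_eq_real (hL₁.1.continuousAt hn)
      (by filter_upwards [hn] with x hx using hL₁.2 x hx) (hdt.const_sub 1)
    have hE := (((hdt.fun_inv (ht0 τ hτ.1)).const_mul w).cexp.mul (h0.const_mul (-c)).cexp).mul
      (h1.const_mul (c - a)).cexp
    rw [kummerOp_eq_of_hasDerivAt (Eventually.of_forall (hderz τ))
      ((hderz τ w).const_mul (1 / t τ))]
    refine (hE.neg.congr_of_eventuallyEq (Eventually.of_forall fun x => ?_)).congr_deriv ?_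
    · simp only [boundaryB, Pi.neg_apply, Pi.mul_apply, div_eq_mul_inv]
    · have e1 : exp ((c - a) * L₁ τ) = exp ((c - a - 1) * L₁ τ) * (1 - t τ) := by
        rw [← he1 τ hτ.1, ← exp_add]
        ring_nf
      have := ht0 τ hτ.1
      have := ht1 τ hτ.1
      simp only [integrandB, Pi.mul_apply, e1, div_eq_mul_inv w]
      field_simp
      ring
  · obtain ⟨l, h0, h1⟩ := hB
    exact ⟨-l, h0.neg, h1.neg⟩

/-! ### Contour integrals of type a) -/

section TypeA

variable {a c : ℂ} {p q : ℝ → ℂ} {U : Set ℂ} {L₀ L₁ : ℝ × ℂ → ℂ}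

/-- The exponent of the integrand of type a). -/
noncomputable def exponentA (a c : ℂ) (p q : ℝ → ℂ) (L₀ L₁ : ℝ × ℂ → ℂ) (x : ℝ × ℂ) : ℂ :=
  (a - c) * L₀ x + (p x.1 + x.2 * q x.1) - a * L₁ x

theorem integrandA_eq (w : ℂ) (τ : ℝ) : integrandA a c p q L₀ L₁ w τ =
    exp (exponentA a c p q L₀ L₁ (τ, w)) * (deriv p τ + w * deriv q τ) := by
  rw [integrandA, exponentA, ← exp_add, ← exp_add]
  congr 2
  ring

theorem continuousOn_exponentA (hp : ContinuousOn p (Ioo 0 1)) (hq : ContinuousOn q (Ioo 0 1))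
    (h₀ : ContinuousOn L₀ (Ioo 0 1 ×ˢ U)) (h₁ : ContinuousOn L₁ (Ioo 0 1 ×ˢ U)) :
    ContinuousOn (exponentA a c p q L₀ L₁) (Ioo 0 1 ×ˢ U) := by
  have hm : MapsTo Prod.fst (Ioo (0 : ℝ) 1 ×ˢ U) (Ioo 0 1) := fun x hx => hx.1
  exact ((continuousOn_const.mul h₀).add ((hp.comp continuousOn_fst hm).add
    (continuousOn_snd.mul (hq.comp continuousOn_fst hm)))).sub (continuousOn_const.mul h₁)

/-- Where q is 0 or 1, both t and t - z are affine in z with slope 0 or of modulus 1. The two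
logarithms then oscillate by at most 2 on the disc, however close τ is to the end and however close
the contour is to a singular point. -/
theorem eventually_oscillation_exponentA {w : ℂ} {r : ℝ} (hr : 0 < r)
    (hball : Metric.ball w (2 * r) ⊆ U)
    (hL₀ : IsLogBranchOn L₀ (fun x => p x.1 + x.2 * q x.1) (Ioo 0 1 ×ˢ U))
    (hL₁ : IsLogBranchOn L₁ (fun x => p x.1 + x.2 * q x.1 - x.2) (Ioo 0 1 ×ˢ U))
    {l : Filter ℝ} (hl : ∀ᶠ τ in l, τ ∈ Ioo (0 : ℝ) 1)
    (hq : (∀ᶠ τ in l, q τ = 0) ∨ (∀ᶠ τ in l, q τ = 1)) :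
    ∀ᶠ τ in l, ∀ z ∈ Metric.closedBall w r, ∀ z' ∈ Metric.closedBall w r,
      ‖exponentA a c p q L₀ L₁ (τ, z) - exponentA a c p q L₀ L₁ (τ, z')‖ ≤
        ‖a - c‖ * 2 + 2 * r + ‖a‖ * 2 := by
  have hq' : ∀ᶠ τ in l, q τ = 0 ∨ q τ = 1 :=
    hq.elim (fun h => h.mono fun _ => Or.inl) fun h => h.mono fun _ => Or.inr
  filter_upwards [hl, hq'] with τ hτ hqτ z hz z' hz'
  have hmap : ContinuousOn (fun z : ℂ => (τ, z)) (Metric.ball w (2 * r)) := by fun_prop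
  have hmaps : MapsTo (fun z : ℂ => (τ, z)) (Metric.ball w (2 * r)) (Ioo 0 1 ×ˢ U) :=
    fun z hz => ⟨hτ, hball hz⟩
  have e0 : ‖L₀ (τ, z) - L₀ (τ, z')‖ ≤ 2 := by
    refine norm_sub_le_of_exp_eq_affine (L := fun z => L₀ (τ, z)) (u := p τ) (k := q τ) hr ?_
      (hL₀.1.comp hmap hmaps) (fun z hz => ?_) hz hz'
    · rcases hqτ with h | h <;> simp [h]
    · rw [hL₀.2 _ (hmaps hz), mul_comm]
  have e1 : ‖L₁ (τ, z) - L₁ (τ, z')‖ ≤ 2 := by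
    refine norm_sub_le_of_exp_eq_affine (L := fun z => L₁ (τ, z)) (u := p τ) (k := q τ - 1) hr ?_
      (hL₁.1.comp hmap hmaps) (fun z hz => ?_) hz hz'
    · rcases hqτ with h | h <;> simp [h]
    · rw [hL₁.2 _ (hmaps hz)]; ring
  have e2 : ‖(z - z') * q τ‖ ≤ 2 * r := by
    have : ‖z - z'‖ ≤ 2 * r := by
      rw [← dist_eq_norm]
      rw [Metric.mem_closedBall] at hz hz'
      linarith [dist_triangle_right z z' w]
    rcases hqτ with h | h
    · simp [h, hr.le]
    · simpa [h] using this
  have : exponentA a c p q L₀ L₁ (τ, z) - exponentA a c p q L₀ L₁ (τ, z') =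
      (a - c) * (L₀ (τ, z) - L₀ (τ, z')) + (z - z') * q τ - a * (L₁ (τ, z) - L₁ (τ, z')) := by
    simp only [exponentA]; ring
  rw [this]
  refine (norm_sub_le _ _).trans (add_le_add ((norm_add_le _ _).trans (add_le_add ?_ e2)) ?_)
  · rw [norm_mul]; gcongr
  · rw [norm_mul]; gcongr

theorem AdmissibleEnd.q_eq {B : ℝ → ℂ} {l : Filter ℝ} (h : AdmissibleEnd p q B l) :
    (∀ᶠ τ in l, q τ = 0) ∨ (∀ᶠ τ in l, q τ = 1) :=
  h.imp_right fun h => h.1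

/-- The function whose derivative is Kummer's operator applied to the integrand of type a). -/
noncomputable def primitiveA (a c : ℂ) (p q : ℝ → ℂ) (L₀ L₁ : ℝ × ℂ → ℂ) (w : ℂ) (τ : ℝ) : ℂ :=
  exp (exponentA a c p q L₀ L₁ (τ, w)) *
    (w * (((a - c) * (p τ + w * q τ)⁻¹ + 1 - a * (p τ + w * q τ - w)⁻¹) * q τ ^ 2 +
      2 * a * (p τ + w * q τ - w)⁻¹ * q τ) + (c - w) * q τ -
      a * (p τ + w * q τ) * (p τ + w * q τ - w)⁻¹)

theorem boundaryA_eq {w : ℂ} {τ : ℝ} (h₀ : exp (L₀ (τ, w)) = p τ + w * q τ)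
    (h₁ : exp (L₁ (τ, w)) = p τ + w * q τ - w) :
    boundaryA a c p q L₀ L₁ w τ = exp (exponentA a c p q L₀ L₁ (τ, w)) * (p τ + w * q τ) *
      (p τ + w * q τ - w)⁻¹ := by
  have : exp (exponentA a c p q L₀ L₁ (τ, w)) * (p τ + w * q τ) * (p τ + w * q τ - w)⁻¹ =
      exp (exponentA a c p q L₀ L₁ (τ, w)) * exp (L₀ (τ, w)) * exp (-L₁ (τ, w)) := by
    rw [exp_neg, h₀, h₁]
  rw [this, boundaryA, exponentA, ← exp_add, ← exp_add, ← exp_add, ← exp_add]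
  congr 1
  ring

/-- At a fixed end q = 0 and `primitiveA` is exactly -a times the boundary term. At an end at w,
where t - w = p → 0, it is the boundary term times a factor that stays bounded. There the boundary
term tends to 0, so b = 0. -/
theorem tendsto_primitiveA {w : ℂ} (hU : IsOpen U) (hw : w ∈ U)
    (hL₀ : IsLogBranchOn L₀ (fun x => p x.1 + x.2 * q x.1) (Ioo 0 1 ×ˢ U))
    (hL₁ : IsLogBranchOn L₁ (fun x => p x.1 + x.2 * q x.1 - x.2) (Ioo 0 1 ×ˢ U))
    {l : Filter ℝ} [l.NeBot] (hl : ∀ᶠ τ in l, τ ∈ Ioo (0 : ℝ) 1)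
    (hend : AdmissibleEnd p q (boundaryA a c p q L₀ L₁ w) l) {b : ℂ}
    (hb : Tendsto (boundaryA a c p q L₀ L₁ w) l (𝓝 b)) :
    Tendsto (primitiveA a c p q L₀ L₁ w) l (𝓝 (-a * b)) := by
  have he0 : ∀ τ ∈ Ioo (0 : ℝ) 1, ∀ z ∈ U, exp (L₀ (τ, z)) = p τ + z * q τ :=
    fun τ hτ z hz => hL₀.2 (τ, z) ⟨hτ, hz⟩
  have he1 : ∀ τ ∈ Ioo (0 : ℝ) 1, ∀ z ∈ U, exp (L₁ (τ, z)) = p τ + z * q τ - z :=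
    fun τ hτ z hz => hL₁.2 (τ, z) ⟨hτ, hz⟩
  rcases hend with hq | ⟨hq, hp, hB⟩
  · refine (hb.const_mul (-a)).congr' ?_
    filter_upwards [hl, hq] with τ hτ hqτ
    rw [boundaryA_eq (he0 τ hτ w hw) (he1 τ hτ w hw), primitiveA, hqτ]
    ring
  · have hb0 : b = 0 := tendsto_nhds_unique hb hB
    -- If w = 0, then near this end the parameter z = -p τ lies in U, and the contour for this z
    -- passes through p τ + z = 0, which is excluded.
    have hw0 : w ≠ 0 := by
      rintro rfl
      have h1 : ∀ᶠ τ in l, -p τ ∈ U := by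
        have : Tendsto (fun τ => -p τ) l (𝓝 0) := by simpa using hp.neg
        exact this (hU.mem_nhds hw)
      obtain ⟨τ, hτ, hqτ, hpτ⟩ := (hl.and (hq.and h1)).exists
      have := he0 τ hτ _ hpτ
      rw [hqτ, mul_one, add_neg_cancel] at this
      exact exp_ne_zero _ this
    have hinv : Tendsto (fun τ => (p τ + w)⁻¹) l (𝓝 w⁻¹) := by
      have : Tendsto (fun τ => p τ + w) l (𝓝 w) := by simpa using hp.add_const w
      exact this.inv₀ hw0
    have hfac : Tendsto (fun τ => p τ * (p τ + w)⁻¹ * (w * ((a - c) * (p τ + w)⁻¹ + 1) + c - w) +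
        a * w * (p τ + w)⁻¹ - a) l
        (𝓝 (0 * w⁻¹ * (w * ((a - c) * w⁻¹ + 1) + c - w) + a * w * w⁻¹ - a)) :=
      (((hp.mul hinv).mul (((((hinv.const_mul (a - c)).add_const 1).const_mul w).add_const
        c).sub_const w)).add (hinv.const_mul (a * w))).sub_const a
    have := hB.mul hfac
    rw [zero_mul] at this
    rw [hb0, mul_zero]
    refine this.congr' ?_
    filter_upwards [hl, hq] with τ hτ hqτ
    have h0 : p τ + w ≠ 0 := by
      have := he0 τ hτ w hw
      rw [hqτ, mul_one] at this
      rw [← this]; exact exp_ne_zero _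
    have h1 : p τ ≠ 0 := by
      have := he1 τ hτ w hw
      rw [hqτ, mul_one, add_sub_cancel_right] at this
      rw [← this]; exact exp_ne_zero _
    rw [boundaryA_eq (he0 τ hτ w hw) (he1 τ hτ w hw), primitiveA, hqτ]
    simp only [mul_one, add_sub_cancel_right]
    field_simp
    ring

/-- Write f(t, w) for the integrand without dt and t_τ for the derivative of the contour. For a
moving contour ∂_w (f t_τ) = ∂_τ (f q) + f_w t_τ and ∂_w² (f t_τ) = ∂_τ (f_t q² + 2 f_w q) + f_ww
t_τ. On a fixed contour the operator gives ∂_τ (-a t f / (t - w)). Collecting the τ-derivatives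
yields `primitiveA`. -/
theorem solvesKummerAt_integral_integrandA (a c : ℂ) (p q : ℝ → ℂ) (U : Set ℂ)
    (L₀ L₁ : ℝ × ℂ → ℂ) (hp : IsPiecewiseC1 p) (hq : IsPiecewiseC1 q) (hU : IsOpen U)
    (hL₀ : IsLogBranchOn L₀ (fun x => p x.1 + x.2 * q x.1) (Ioo 0 1 ×ˢ U))
    (hL₁ : IsLogBranchOn L₁ (fun x => p x.1 + x.2 * q x.1 - x.2) (Ioo 0 1 ×ˢ U))
    (hint : ∀ w ∈ U, IntegrableOn (integrandA a c p q L₀ L₁ w) (Ioo 0 1)) (w : ℂ) (hw : w ∈ U)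
    (hend₀ : AdmissibleEnd p q (boundaryA a c p q L₀ L₁ w) (𝓝[>] 0))
    (hend₁ : AdmissibleEnd p q (boundaryA a c p q L₀ L₁ w) (𝓝[<] 1))
    (hB : EndpointVariationZero (boundaryA a c p q L₀ L₁ w)) :
    SolvesKummerAt a c (fun z => ∫ τ in Ioo (0 : ℝ) 1, integrandA a c p q L₀ L₁ z τ) w := by
  obtain ⟨ε, hε, hballε⟩ := Metric.isOpen_iff.1 hU w hw
  obtain ⟨r, hr, rfl⟩ : ∃ r : ℝ, 0 < r ∧ ε = 2 * r := ⟨ε / 2, half_pos hε, by ring⟩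
  have hcb : Metric.closedBall w r ⊆ U := fun z hz => hballε (by
    rw [Metric.mem_closedBall] at hz; rw [Metric.mem_ball]; linarith)
  have hbU : Metric.ball w r ⊆ U := Metric.ball_subset_closedBall.trans hcb
  obtain ⟨hpc, Sp, hSp⟩ := hp
  obtain ⟨hqc, Sq, hSq⟩ := hq
  have hcS := continuousOn_exponentA (a := a) (c := c) hpc hqc hL₀.1 hL₁.1
  have hl0 : ∀ᶠ τ in 𝓝[>] (0 : ℝ), τ ∈ Ioo (0 : ℝ) 1 := Ioo_mem_nhdsGT zero_lt_one
  have hl1 : ∀ᶠ τ in 𝓝[<] (1 : ℝ), τ ∈ Ioo (0 : ℝ) 1 := Ioo_mem_nhdsLT zero_lt_one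
  have he0 : ∀ τ ∈ Ioo (0 : ℝ) 1, ∀ z ∈ U, exp (L₀ (τ, z)) = p τ + z * q τ :=
    fun τ hτ z hz => hL₀.2 (τ, z) ⟨hτ, hz⟩
  have he1 : ∀ τ ∈ Ioo (0 : ℝ) 1, ∀ z ∈ U, exp (L₁ (τ, z)) = p τ + z * q τ - z :=
    fun τ hτ z hz => hL₁.2 (τ, z) ⟨hτ, hz⟩
  have ht0 : ∀ τ ∈ Ioo (0 : ℝ) 1, ∀ z ∈ U, p τ + z * q τ ≠ 0 := fun τ hτ z hz => by
    rw [← he0 τ hτ z hz]; exact exp_ne_zero _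
  have ht1 : ∀ τ ∈ Ioo (0 : ℝ) 1, ∀ z ∈ U, p τ + z * q τ - z ≠ 0 := fun τ hτ z hz => by
    rw [← he1 τ hτ z hz]; exact exp_ne_zero _
  obtain ⟨M, hM⟩ := exists_oscillation_bound (isCompact_closedBall w r) hcb hcS
    (eventually_oscillation_exponentA hr hballε hL₀ hL₁ hl0 hend₀.q_eq)
    (eventually_oscillation_exponentA hr hballε hL₀ hL₁ hl1 hend₁.q_eq)
  have hratio : ∀ τ ∈ Ioo (0 : ℝ) 1, ∀ z ∈ Metric.closedBall w r, ∀ z' ∈ Metric.closedBall w r,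
      ‖exp (exponentA a c p q L₀ L₁ (τ, z))‖ ≤
        Real.exp M * ‖exp (exponentA a c p q L₀ L₁ (τ, z'))‖ := by
    intro τ hτ z hz z' hz'
    rw [norm_exp, norm_exp, ← Real.exp_add]
    refine Real.exp_le_exp.2 ?_
    have := (re_le_norm _).trans (hM τ hτ z hz z' hz')
    rw [sub_re] at this
    linarith
  -- A second parameter value: p' + z q' is affine in z, hence a combination of its values at w and
  -- w', with coefficients of modulus at most 3 and 2 on the disc. The integrands at w and w'
  -- together therefore dominate.
  set w' : ℂ := w + (r / 2 : ℝ) with hw'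
  have hww' : ‖w - w'‖ = r / 2 := by
    rw [hw', sub_add_cancel_left, norm_neg, norm_real, Real.norm_eq_abs, abs_of_pos (half_pos hr)]
  have hw'b : w' ∈ Metric.closedBall w r := by
    rw [Metric.mem_closedBall, dist_comm, dist_eq_norm, hww']; linarith
  have hwb : w ∈ Metric.closedBall w r := Metric.mem_closedBall_self hr.le
  have hne : w - w' ≠ 0 := by rw [← norm_pos_iff, hww']; exact half_pos hr
  -- derivatives with respect to the parameter
  have hS1 : ∀ τ ∈ Ioo (0 : ℝ) 1, ∀ z ∈ U,
      HasDerivAt (fun z => exponentA a c p q L₀ L₁ (τ, z))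
        ((a - c) * q τ * (p τ + z * q τ)⁻¹ + q τ - a * (q τ - 1) * (p τ + z * q τ - z)⁻¹) z := by
    intro τ hτ z hz
    have hn := hU.mem_nhds hz
    have hmap : ContinuousAt (fun z : ℂ => (τ, z)) z := by fun_prop
    have hnn : Ioo (0 : ℝ) 1 ×ˢ U ∈ 𝓝 (τ, z) := prod_mem_nhds (Ioo_mem_nhds hτ.1 hτ.2) hn
    have hg0 : HasDerivAt (fun z => p τ + z * q τ) (q τ) z := by
      simpa using ((hasDerivAt_id z).mul_const (q τ)).const_add (p τ)
    have d0 : HasDerivAt (fun z => L₀ (τ, z)) (q τ / (p τ + z * q τ)) z :=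
      hasDerivAt_of_exp_eq (g := fun z => p τ + z * q τ)
        (ContinuousAt.comp (g := L₀) (f := fun z : ℂ => (τ, z)) (hL₀.1.continuousAt hnn) hmap)
        (by filter_upwards [hn] with y hy using he0 τ hτ y hy) hg0
    have d1 : HasDerivAt (fun z => L₁ (τ, z)) ((q τ - 1) / (p τ + z * q τ - z)) z :=
      hasDerivAt_of_exp_eq (g := fun z => p τ + z * q τ - z)
        (ContinuousAt.comp (g := L₁) (f := fun z : ℂ => (τ, z)) (hL₁.1.continuousAt hnn) hmap)
        (by filter_upwards [hn] with y hy using he1 τ hτ y hy) (hg0.sub (hasDerivAt_id z))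
    refine (((d0.const_mul (a - c)).add hg0).sub (d1.const_mul a)).congr_deriv ?_
    ring
  have hF1 : ∀ τ ∈ Ioo (0 : ℝ) 1, ∀ z ∈ U,
      HasDerivAt (fun z => integrandA a c p q L₀ L₁ z τ)
        (exp (exponentA a c p q L₀ L₁ (τ, z)) *
          (((a - c) * q τ * (p τ + z * q τ)⁻¹ + q τ - a * (q τ - 1) * (p τ + z * q τ - z)⁻¹) *
            (deriv p τ + z * deriv q τ) + deriv q τ)) z := by
    intro τ hτ z hz
    simp only [integrandA_eq]
    have hlin : HasDerivAt (fun z => deriv p τ + z * deriv q τ) (deriv q τ) z := by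
      simpa using ((hasDerivAt_id z).mul_const (deriv q τ)).const_add (deriv p τ)
    refine ((hS1 τ hτ z hz).cexp.mul hlin).congr_deriv ?_
    ring
  refine solvesKummerAt_integral hr (S := (Sp ∪ Sq : Finset ℝ))
    (bound := fun τ => Real.exp M * (3 * ‖integrandA a c p q L₀ L₁ w τ‖) +
      Real.exp M * (2 * ‖integrandA a c p q L₀ L₁ w' τ‖))
    (G := primitiveA a c p q L₀ L₁ w) (fun z hz => (hint z (hbU hz)).aestronglyMeasurable)
    (Finset.countable_toSet _) (fun τ hτ z hz =>
      (hF1 τ hτ.1 z (hbU hz)).differentiableAt.differentiableWithinAt) ?_ ?_ ?_ ?_ ?_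
  · intro τ hτ z hz
    have hz' := Metric.ball_subset_closedBall hz
    have hzw : ‖z - w‖ ≤ r := by rw [← dist_eq_norm]; exact hz'
    have hzw' : ‖z - w'‖ ≤ 3 * (r / 2) := by
      have : z - w' = (z - w) + (w - w') := by ring
      rw [this]
      refine (norm_add_le _ _).trans ?_
      rw [hww']; linarith
    have hsplit : deriv p τ + z * deriv q τ =
        (z - w') / (w - w') * (deriv p τ + w * deriv q τ) +
          (w - z) / (w - w') * (deriv p τ + w' * deriv q τ) := by
      field_simp
      ring
    have h3 : ‖(z - w') / (w - w')‖ ≤ 3 := by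
      rw [norm_div, hww', div_le_iff₀ (half_pos hr)]; exact hzw'
    have h2 : ‖(w - z) / (w - w')‖ ≤ 2 := by
      rw [norm_div, hww', div_le_iff₀ (half_pos hr), norm_sub_rev]; linarith
    simp only [integrandA_eq, norm_mul]
    rw [hsplit]
    set E := ‖exp (exponentA a c p q L₀ L₁ (τ, z))‖
    set E₁ := ‖exp (exponentA a c p q L₀ L₁ (τ, w))‖
    set E₂ := ‖exp (exponentA a c p q L₀ L₁ (τ, w'))‖
    have hE₁ : E ≤ Real.exp M * E₁ := hratio τ hτ z hz' w hwb
    have hE₂ : E ≤ Real.exp M * E₂ := hratio τ hτ z hz' w' hw'b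
    calc E * ‖(z - w') / (w - w') * (deriv p τ + w * deriv q τ) +
          (w - z) / (w - w') * (deriv p τ + w' * deriv q τ)‖
        ≤ E * (3 * ‖deriv p τ + w * deriv q τ‖ + 2 * ‖deriv p τ + w' * deriv q τ‖) := by
          refine mul_le_mul_of_nonneg_left ((norm_add_le _ _).trans ?_) (norm_nonneg _)
          rw [norm_mul, norm_mul]
          gcongr
      _ = E * (3 * ‖deriv p τ + w * deriv q τ‖) + E * (2 * ‖deriv p τ + w' * deriv q τ‖) := by ring
      _ ≤ Real.exp M * E₁ * (3 * ‖deriv p τ + w * deriv q τ‖) +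
          Real.exp M * E₂ * (2 * ‖deriv p τ + w' * deriv q τ‖) := by gcongr
      _ = _ := by ring
  · exact (((hint w hw).norm.const_mul 3).const_mul _).add
      (((hint w' (hcb hw'b)).norm.const_mul 2).const_mul _)
  · have hmap : ContinuousOn (fun τ : ℝ => (τ, w)) (Ioo 0 1) := by fun_prop
    have hE : ContinuousOn (fun τ => exp (exponentA a c p q L₀ L₁ (τ, w))) (Ioo 0 1) :=
      (hcS.comp hmap fun τ hτ => ⟨hτ, hw⟩).cexp
    have ht : ContinuousOn (fun τ => p τ + w * q τ) (Ioo 0 1) := hpc.add (continuousOn_const.mul hqc)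
    have hi0 := ht.inv₀ fun τ hτ => ht0 τ hτ w hw
    have hi1 := (ht.sub continuousOn_const).inv₀ fun τ hτ => ht1 τ hτ w hw
    exact hE.mul (((continuousOn_const.mul (((((continuousOn_const.mul hi0).add
      continuousOn_const).sub (continuousOn_const.mul hi1)).mul (hqc.pow 2)).add
        ((continuousOn_const.mul hi1).mul hqc))).add (continuousOn_const.mul hqc)).sub
          ((continuousOn_const.mul ht).mul hi1))
  · intro τ hτ
    have hτ' := hτ.1
    have hn := Ioo_mem_nhds hτ.1.1 hτ.1.2
    simp only [Finset.coe_union, Set.mem_sdiff, mem_union, Finset.mem_coe, not_or] at hτ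
    have hdp : HasDerivAt p (deriv p τ) τ :=
      ((hSp τ hτ' hτ.2.1).differentiableAt one_ne_zero).hasDerivAt
    have hdq : HasDerivAt q (deriv q τ) τ :=
      ((hSq τ hτ' hτ.2.2).differentiableAt one_ne_zero).hasDerivAt
    have hnn : Ioo (0 : ℝ) 1 ×ˢ U ∈ 𝓝 (τ, w) := prod_mem_nhds hn (hU.mem_nhds hw)
    have hmap : ContinuousAt (fun τ : ℝ => (τ, w)) τ := by fun_prop
    have hdt : HasDerivAt (fun τ => p τ + w * q τ) (deriv p τ + w * deriv q τ) τ :=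
      hdp.add (hdq.const_mul w)
    have d0 : HasDerivAt (fun τ => L₀ (τ, w)) _ τ :=
      hasDerivAt_of_exp_eq_real (g := fun τ => p τ + w * q τ)
        (ContinuousAt.comp (g := L₀) (f := fun τ : ℝ => (τ, w)) (hL₀.1.continuousAt hnn) hmap)
        (by filter_upwards [hn] with y hy using he0 y hy w hw) hdt
    have d1 : HasDerivAt (fun τ => L₁ (τ, w)) _ τ :=
      hasDerivAt_of_exp_eq_real (g := fun τ => p τ + w * q τ - w)
        (ContinuousAt.comp (g := L₁) (f := fun τ : ℝ => (τ, w)) (hL₁.1.continuousAt hnn) hmap)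
        (by filter_upwards [hn] with y hy using he1 y hy w hw) (hdt.sub_const w)
    have hE : HasDerivAt (fun τ => exp (exponentA a c p q L₀ L₁ (τ, w)))
        (exp (exponentA a c p q L₀ L₁ (τ, w)) *
          ((a - c) * ((deriv p τ + w * deriv q τ) / (p τ + w * q τ)) +
            (deriv p τ + w * deriv q τ) -
            a * ((deriv p τ + w * deriv q τ) / (p τ + w * q τ - w)))) τ :=
      (((d0.const_mul (a - c)).add hdt).sub (d1.const_mul a)).cexp
    have hT0 := ht0 τ hτ' w hw
    have hT1 := ht1 τ hτ' w hw
    have hi0 := hdt.fun_inv hT0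
    have hi1 := (hdt.sub_const w).fun_inv hT1
    have hG : HasDerivAt (primitiveA a c p q L₀ L₁ w) _ τ :=
      hE.mul (((((((hi0.const_mul (a - c)).add_const 1).sub (hi1.const_mul a)).mul
        (hdq.fun_pow 2)).add ((hi1.const_mul (2 * a)).mul hdq)).const_mul w |>.add
          (hdq.const_mul (c - w))).sub ((hdt.const_mul a).mul hi1))
    have hgz : HasDerivAt (fun z => p τ + z * q τ) (q τ) w := by
      simpa using ((hasDerivAt_id w).mul_const (q τ)).const_add (p τ)
    have hlin : HasDerivAt (fun z => deriv p τ + z * deriv q τ) (deriv q τ) w := by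
      simpa using ((hasDerivAt_id w).mul_const (deriv q τ)).const_add (deriv p τ)
    have hF2 := (hS1 τ hτ' w hw).cexp.mul
      (((((hgz.fun_inv hT0).const_mul ((a - c) * q τ)).add_const (q τ)).sub
        (((hgz.sub (hasDerivAt_id w)).fun_inv hT1).const_mul (a * (q τ - 1)))).mul hlin
          |>.add_const (deriv q τ))
    rw [kummerOp_eq_of_hasDerivAt (f₁ := fun z => exp (exponentA a c p q L₀ L₁ (τ, z)) *
          (((a - c) * q τ * (p τ + z * q τ)⁻¹ + q τ - a * (q τ - 1) * (p τ + z * q τ - z)⁻¹) *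
            (deriv p τ + z * deriv q τ) + deriv q τ))
        (by filter_upwards [hU.mem_nhds hw] with z hz using hF1 τ hτ' z hz) hF2]
    refine hG.congr_deriv ?_
    simp only [integrandA_eq, Pi.mul_apply, Pi.sub_apply, id_eq, Nat.cast_ofNat,
      Nat.add_one_sub_one, pow_one]
    generalize exp (exponentA a c p q L₀ L₁ (τ, w)) = E
    generalize deriv p τ = p'
    generalize deriv q τ = q'
    generalize q τ = Q at *
    -- With X = t - w the two denominators are X and X + w, and the claim is an identity of rational
    -- functions.
    obtain ⟨X, hX⟩ : ∃ X, X = p τ + w * Q - w := ⟨_, rfl⟩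
    have hT : p τ + w * Q = X + w := by rw [hX]; ring
    rw [hT] at hT0 hT1 ⊢
    simp only [add_sub_cancel_right] at hT1 ⊢
    field_simp
    ring
  · obtain ⟨b, h0, h1⟩ := hB
    exact ⟨-a * b, tendsto_primitiveA hU hw hL₀ hL₁ hl0 hend₀ h0,
      tendsto_primitiveA hU hw hL₀ hL₁ hl1 hend₁ h1⟩

end TypeA

/-! ### The normalized confluent function -/

section KummerBold

theorem ascPochhammer_eval_succ_left (a : ℂ) (n : ℕ) :
    (ascPochhammer ℂ (n + 1)).eval a = a * (ascPochhammer ℂ n).eval (a + 1) := by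
  simp [ascPochhammer_succ_left, Polynomial.eval_comp]

theorem ascPochhammer_eval_succ_right (a : ℂ) (n : ℕ) :
    (ascPochhammer ℂ (n + 1)).eval a = (ascPochhammer ℂ n).eval a * (a + n) :=
  ascPochhammer_succ_eval n a

theorem inv_Gamma_eq (s : ℂ) : (Gamma s)⁻¹ = s * (Gamma (s + 1))⁻¹ :=
  one_div_Gamma_eq_self_mul_one_div_Gamma_add_one s

/-- The terms of the series `kummerBold`. -/
noncomputable def kummerTerm (a c w : ℂ) (n : ℕ) : ℂ :=
  (ascPochhammer ℂ n).eval a * (Gamma (c + n))⁻¹ * (w ^ n / (n.factorial : ℂ))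

theorem kummerTerm_zero (a c w : ℂ) : kummerTerm a c w 0 = (Gamma c)⁻¹ := by
  simp [kummerTerm]

theorem summable_norm_kummerTerm (a c w : ℂ) : Summable fun n => ‖kummerTerm a c w n‖ := by
  have hlim : Tendsto (fun n : ℕ => (a + n) / (c + n) * (w / (1 + n))) atTop (𝓝 0) := by
    have h1 := tendsto_add_mul_div_add_mul_atTop_nhds a c (1 : ℂ) one_ne_zero
    have h2 : Tendsto (fun n : ℕ => w / (1 + (n : ℂ))) atTop (𝓝 0) := by
      have := (tendsto_one_div_add_atTop_nhds_zero_nat (𝕜 := ℂ)).const_mul w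
      simpa [div_eq_mul_inv, add_comm] using this
    simpa using h1.mul h2
  refine summable_of_ratio_norm_eventually_le (r := 1 / 2) (by norm_num) ?_
  -- The ratio of consecutive terms has the denominator c + n, which can vanish only for small n.
  -- Thus the poles of Γ need no separate treatment.
  have hc : ∀ᶠ n : ℕ in atTop, c + n ≠ 0 := by
    obtain ⟨N, hN⟩ := exists_nat_gt ‖c‖
    filter_upwards [eventually_ge_atTop N] with n hn h
    have : ‖c‖ = n := by rw [eq_neg_of_add_eq_zero_left h, norm_neg, norm_natCast]
    have h2 : (N : ℝ) ≤ n := by exact_mod_cast hn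
    linarith
  have hsmall := hlim.norm.eventually_lt_const (u := (1 / 2 : ℝ)) (by simp)
  filter_upwards [hc, hsmall] with n hn hs
  have e : kummerTerm a c w (n + 1) =
      ((a + n) / (c + n) * (w / (1 + n))) * kummerTerm a c w n := by
    have h1 : (1 + (n : ℂ)) ≠ 0 := by rw [add_comm]; exact Nat.cast_add_one_ne_zero n
    rw [kummerTerm, kummerTerm, ascPochhammer_eval_succ_right, inv_Gamma_eq (c + n),
      Nat.factorial_succ]
    push_cast
    rw [← add_assoc c, add_comm (n : ℂ) 1]
    have h3 : (n.factorial : ℂ) ≠ 0 := Nat.cast_ne_zero.2 n.factorial_ne_zero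
    field_simp
    ring
  rw [norm_norm, norm_norm, e, norm_mul]
  exact mul_le_mul_of_nonneg_right hs.le (norm_nonneg _)

theorem hasSum_kummerBold (a c w : ℂ) : HasSum (kummerTerm a c w) (kummerBold a c w) :=
  (summable_norm_kummerTerm a c w).of_norm.hasSum

theorem kummerBold_zero (a c : ℂ) : kummerBold a c 0 = (Gamma c)⁻¹ := by
  rw [← (hasSum_kummerBold a c 0).tsum_eq, tsum_eq_single 0, kummerTerm_zero]
  intro n hn
  simp [kummerTerm, hn]

theorem hasDerivAt_kummerBold (a c w : ℂ) :
    HasDerivAt (kummerBold a c) (a * kummerBold (a + 1) (c + 1) w) w := by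
  set R : ℝ := ‖w‖ + 1
  have hw : w ∈ Metric.ball (0 : ℂ) R := by
    rw [mem_ball_zero_iff]; exact lt_add_one _
  have hdt : ∀ n z, HasDerivAt (fun z => kummerTerm a c z n)
      ((ascPochhammer ℂ n).eval a * (Gamma (c + n))⁻¹ * (n * z ^ (n - 1) / n.factorial)) z :=
    fun n z => ((hasDerivAt_pow n z).div_const _).const_mul _
  have hb : ∀ n, ∀ z ∈ Metric.ball (0 : ℂ) R, ‖kummerTerm a c z n‖ ≤ ‖kummerTerm a c (R : ℂ) n‖ := by
    intro n z hz
    have hR : 0 ≤ R := by positivity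
    rw [mem_ball_zero_iff] at hz
    simp only [kummerTerm, norm_mul, norm_div, norm_pow, norm_real, Real.norm_eq_abs,
      abs_of_nonneg hR]
    gcongr
  have hdiff := differentiableOn_tsum_of_summable_norm (summable_norm_kummerTerm a c R)
    (fun n z _ => (hdt n z).differentiableAt.differentiableWithinAt) Metric.isOpen_ball hb
  have hs := hasSum_deriv_of_summable_norm (summable_norm_kummerTerm a c R)
    (fun n z _ => (hdt n z).differentiableAt.differentiableWithinAt) Metric.isOpen_ball hb hw
  have he : (fun z => ∑' n, kummerTerm a c z n) = kummerBold a c := rfl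
  rw [he] at hs hdiff
  have hd := (hdiff.differentiableAt (Metric.isOpen_ball.mem_nhds hw)).hasDerivAt
  have hs' := (hasSum_kummerBold (a + 1) (c + 1) w).mul_left a
  rw [← hasSum_nat_add_iff' 1] at hs
  have hfun : (fun n => deriv (fun z => kummerTerm a c z (n + 1)) w) =
      fun n => a * kummerTerm (a + 1) (c + 1) w n := by
    funext n
    rw [(hdt (n + 1) w).deriv, ascPochhammer_eval_succ_left, kummerTerm, Nat.factorial_succ]
    push_cast [Nat.add_sub_cancel]
    rw [add_comm (n : ℂ) 1, ← add_assoc c]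
    have h1 : (1 + (n : ℂ)) ≠ 0 := by rw [add_comm]; exact Nat.cast_add_one_ne_zero n
    have h3 : (n.factorial : ℂ) ≠ 0 := Nat.cast_ne_zero.2 n.factorial_ne_zero
    field_simp
  have h0 : ∑ i ∈ Finset.range 1, deriv (fun z => kummerTerm a c z i) w = 0 := by
    rw [Finset.sum_range_one, (hdt 0 w).deriv]
    simp
  rw [hfun, h0, sub_zero] at hs
  rwa [← hs'.unique hs] at hd

theorem differentiable_kummerBold (a c : ℂ) : Differentiable ℂ (kummerBold a c) :=
  fun w => (hasDerivAt_kummerBold a c w).differentiableAt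

/-- Comparison of coefficients. Together with `kummerBold_eq_add`, this relation yields by linear
combination the further contiguity relations and the differential equation. -/
theorem mul_kummerBold_add_one (a c w : ℂ) :
    w * kummerBold (a + 1) (c + 1) w = kummerBold (a + 1) c w - kummerBold a c w := by
  have h := (hasSum_kummerBold (a + 1) c w).sub (hasSum_kummerBold a c w)
  rw [← hasSum_nat_add_iff' 1, Finset.sum_range_one, kummerTerm_zero, kummerTerm_zero, sub_self,
    sub_zero] at h
  refine ((hasSum_kummerBold (a + 1) (c + 1) w).mul_left w).unique ?_
  refine h.congr_fun fun n => ?_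
  rw [kummerTerm, kummerTerm, kummerTerm, ascPochhammer_eval_succ_left a,
    ascPochhammer_eval_succ_right, Nat.factorial_succ]
  push_cast
  rw [add_comm (n : ℂ) 1, ← add_assoc c]
  have h1 : (1 + (n : ℂ)) ≠ 0 := by rw [add_comm]; exact Nat.cast_add_one_ne_zero n
  have h3 : (n.factorial : ℂ) ≠ 0 := Nat.cast_ne_zero.2 n.factorial_ne_zero
  field_simp
  ring

theorem hasSum_natCast_mul_kummerTerm (a c w : ℂ) :
    HasSum (fun n => n * kummerTerm a c w n) (w * (a * kummerBold (a + 1) (c + 1) w)) := by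
  rw [← hasSum_nat_add_iff' 1, Finset.sum_range_one, Nat.cast_zero, zero_mul, sub_zero]
  refine (((hasSum_kummerBold (a + 1) (c + 1) w).mul_left a).mul_left w).congr_fun fun n => ?_
  rw [kummerTerm, kummerTerm, ascPochhammer_eval_succ_left a, Nat.factorial_succ]
  push_cast
  rw [add_comm (n : ℂ) 1, ← add_assoc c]
  have h1 : (1 + (n : ℂ)) ≠ 0 := by rw [add_comm]; exact Nat.cast_add_one_ne_zero n
  have h3 : (n.factorial : ℂ) ≠ 0 := Nat.cast_ne_zero.2 n.factorial_ne_zero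
  field_simp
  ring

/-- Termwise this is 1/Γ(c+n) = (c+n)/Γ(c+n+1), with the factor n produced by the Euler operator w
∂. -/
theorem kummerBold_eq_add (a c w : ℂ) :
    c * kummerBold a (c + 1) w + w * (a * kummerBold (a + 1) (c + 2) w) = kummerBold a c w := by
  have h := ((hasSum_kummerBold a (c + 1) w).mul_left c).add
    (hasSum_natCast_mul_kummerTerm a (c + 1) w)
  rw [show c + 1 + 1 = c + 2 by ring] at h
  refine h.unique ?_
  refine (hasSum_kummerBold a c w).congr_fun fun n => ?_
  rw [kummerTerm, kummerTerm, inv_Gamma_eq (c + n), show c + 1 + (n : ℂ) = c + n + 1 by ring]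
  ring

theorem kummerBold_contiguous (a c w : ℂ) :
    (a + 1) * kummerBold (a + 2) c w + (a + 1 - c) * kummerBold a c w =
      (2 * a + 2 - c + w) * kummerBold (a + 1) c w := by
  have h1 := mul_kummerBold_add_one a c w
  have h2 := mul_kummerBold_add_one (a + 1) c w
  have h3 := mul_kummerBold_add_one (a + 1) (c + 1) w
  have h4 := kummerBold_eq_add (a + 1) c w
  rw [show a + 1 + 1 = a + 2 by ring] at h2 h3 h4
  rw [show c + 1 + 1 = c + 2 by ring] at h3
  linear_combination w * h4 - c * h1 - (a + 1) * h2 + (a + 1) * h1 - (a + 1) * w * h3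

theorem kummerBold_add_one_sub (a c w : ℂ) :
    a * kummerBold (a + 1) (c + 1) w - kummerBold a c w = (a - c) * kummerBold a (c + 1) w := by
  have h1 := mul_kummerBold_add_one a (c + 1) w
  have h2 := kummerBold_eq_add a c w
  rw [show c + 1 + 1 = c + 2 by ring] at h1
  linear_combination h2 - a * h1

theorem solvesKummerAt_kummerBold (a c w : ℂ) : SolvesKummerAt a c (kummerBold a c) w := by
  refine ⟨(differentiable_kummerBold a c).analyticAt w, ?_⟩
  rw [kummerOp_eq_of_hasDerivAt (Eventually.of_forall (hasDerivAt_kummerBold a c))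
    ((hasDerivAt_kummerBold (a + 1) (c + 1) w).const_mul a)]
  have h1 := mul_kummerBold_add_one a c w
  have h2 := kummerBold_eq_add (a + 1) c w
  rw [show a + 1 + 1 = a + 2 by ring] at h2 ⊢
  rw [show c + 1 + 1 = c + 2 by ring]
  linear_combination a * h2 - a * h1

theorem hasDerivAt_cpow_mul_kummerBold (b c : ℂ) {w : ℂ} (hw : w ∈ slitPlane) :
    HasDerivAt (fun z => z ^ c * kummerBold b (c + 1) z) (w ^ (c - 1) * kummerBold b c w) w := by
  have h := ((hasDerivAt_id w).cpow_const (c := c) hw).mul (hasDerivAt_kummerBold b (c + 1) w)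
  refine h.congr_deriv ?_
  have h2 := kummerBold_eq_add b c w
  have hw0 := slitPlane_ne_zero hw
  have h3 : w ^ c = w ^ (c - 1) * w := by
    rw [cpow_sub _ _ hw0, cpow_one, div_mul_cancel₀ _ hw0]
  rw [show c + 1 + 1 = c + 2 by ring]
  simp only [id_eq, mul_one, h3]
  linear_combination w ^ (c - 1) * h2

theorem solvesKummerAt_cpow_mul_kummerBold (a c : ℂ) {w : ℂ} (hw : w ∈ slitPlane) :
    SolvesKummerAt a c (fun z => z ^ (1 - c) * kummerBold (a - c + 1) (2 - c) z) w := by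
  have hev : ∀ᶠ z in 𝓝 w, z ∈ slitPlane := isOpen_slitPlane.mem_nhds hw
  have hd : ∀ z ∈ slitPlane, HasDerivAt (fun z => z ^ (1 - c) * kummerBold (a - c + 1) (2 - c) z)
      (z ^ (-c) * kummerBold (a - c + 1) (1 - c) z) z := fun z hz => by
    have := hasDerivAt_cpow_mul_kummerBold (a - c + 1) (1 - c) hz
    rwa [show 1 - c + 1 = 2 - c by ring, show 1 - c - 1 = -c by ring] at this
  refine ⟨analyticAt_iff_eventually_differentiableAt.2 (hev.mono fun z hz =>
    (hd z hz).differentiableAt), ?_⟩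
  have h2 := ((hasDerivAt_id w).cpow_const (c := -c) hw).mul
    (hasDerivAt_kummerBold (a - c + 1) (1 - c) w)
  rw [kummerOp_eq_of_hasDerivAt (hev.mono fun z hz => hd z hz) h2]
  have hw0 := slitPlane_ne_zero hw
  have e1 : w ^ (-c) = w ^ (-c - 1) * w := by
    rw [cpow_sub _ _ hw0, cpow_one, div_mul_cancel₀ _ hw0]
  have e2 : w ^ (1 - c) = w ^ (-c - 1) * w ^ 2 := by
    rw [show (1 - c : ℂ) = -c - 1 + (2 : ℕ) by push_cast; ring, cpow_add _ _ hw0, cpow_natCast]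
  have h3 := kummerBold_add_one_sub (a - c + 1) (1 - c) w
  rw [show 1 - c + 1 = 2 - c by ring] at h3 ⊢
  simp only [id_eq, mul_one, e1, e2]
  linear_combination w ^ (-c - 1) * w ^ 2 * h3

/-- Kummer's transformation. -/
theorem exp_mul_kummerBold_neg (a c w : ℂ) :
    exp w * kummerBold (c - a) c (-w) = kummerBold a c w := by
  -- The parameter c is kept variable because differentiation raises it: d_c' = (a - c) d_{c+1}.
  -- Every d_c vanishes at 0, hence so do all derivatives of d_c there, and the entire function d_c
  -- is zero.
  set d : ℂ → ℂ → ℂ := fun c z => exp (-z) * kummerBold a c z - kummerBold (c - a) c (-z) with hd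
  have hder : ∀ c z, HasDerivAt (d c) ((a - c) * d (c + 1) z) z := by
    intro c z
    have h1 := ((hasDerivAt_neg z).cexp.mul (hasDerivAt_kummerBold a c z)).sub
      ((hasDerivAt_kummerBold (c - a) c (-z)).comp z (hasDerivAt_neg z))
    refine h1.congr_deriv ?_
    simp only [hd]
    rw [show c + 1 - a = c - a + 1 by ring]
    linear_combination exp (-z) * kummerBold_add_one_sub a c z
  have h0 : ∀ c, d c 0 = 0 := fun c => by simp [hd, kummerBold_zero]
  have hiter : ∀ n c, iteratedDeriv n (d c) 0 = 0 := by
    intro n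
    induction n with
    | zero => intro c; simpa using h0 c
    | succ n ih =>
      intro c
      have : deriv (d c) = fun z => (a - c) * d (c + 1) z := funext fun z => (hder c z).deriv
      rw [iteratedDeriv_succ', this, iteratedDeriv_const_mul_field, ih, mul_zero]
  have hz : d c w = 0 := by
    rw [← taylorSeries_eq_of_entire' 0 w
      (fun z => (hder c z).differentiableAt : Differentiable ℂ (d c))]
    simp [hiter]
  simp only [hd] at hz
  rw [← sub_eq_zero.1 hz, ← mul_assoc, ← exp_add]
  simp

end KummerBold

/-! ### Integrals over subsets of the line -/

section SetIntegrals

theorem HasIntegralOn.congr {f g : ℝ → ℂ} {s : Set ℝ} {v : ℂ} (hs : MeasurableSet s)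
    (h : HasIntegralOn f s v) (hfg : ∀ x ∈ s, g x = f x) : HasIntegralOn g s v :=
  ⟨h.1.congr_fun (fun x hx => (hfg x hx).symm) hs, by
    rw [setIntegral_congr_fun hs hfg]; exact h.2⟩

theorem HasIntegralOn.const_mul {f : ℝ → ℂ} {s : Set ℝ} {v : ℂ} (k : ℂ) (h : HasIntegralOn f s v) :
    HasIntegralOn (fun x => k * f x) s (k * v) :=
  ⟨h.1.const_mul k, by rw [integral_const_mul, h.2]⟩

theorem hasIntegralOn_image_iff {f : ℝ → ℂ} {s : Set ℝ} {φ φ' : ℝ → ℝ} {v : ℂ}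
    (hs : MeasurableSet s) (hφ : ∀ x ∈ s, HasDerivAt φ (φ' x) x) (hi : InjOn φ s) :
    HasIntegralOn f (φ '' s) v ↔ HasIntegralOn (fun x => (|φ' x| : ℝ) * f (φ x)) s v := by
  have hφ' : ∀ x ∈ s, HasDerivWithinAt φ (φ' x) s x := fun x hx => (hφ x hx).hasDerivWithinAt
  rw [HasIntegralOn, HasIntegralOn, integral_image_eq_integral_abs_deriv_smul hs hφ' hi,
    integrableOn_image_iff_integrableOn_abs_deriv_smul hs hφ' hi]
  simp only [real_smul]

/-- The substitution `x ↦ x⁻¹` on a set of positive numbers. -/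
theorem hasIntegralOn_inv_iff {f : ℝ → ℂ} {s : Set ℝ} (hs : MeasurableSet s) (hs0 : s ⊆ Ioi 0)
    {v : ℂ} : HasIntegralOn f (Inv.inv '' s) v ↔
      HasIntegralOn (fun x : ℝ => ((x : ℂ) ^ 2)⁻¹ * f x⁻¹) s v := by
  rw [hasIntegralOn_image_iff (φ' := fun x => -(x ^ 2)⁻¹) hs
    (fun x hx => hasDerivAt_inv (ne_of_gt (hs0 hx))) inv_injective.injOn]
  have : ∀ x : ℝ, ((|(-(x ^ 2)⁻¹)| : ℝ) : ℂ) = ((x : ℂ) ^ 2)⁻¹ := fun x => by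
    rw [abs_neg, abs_of_nonneg (by positivity)]; push_cast; rfl
  simp only [this]

theorem hasIntegralOn_neg_iff {f : ℝ → ℂ} {v : ℂ} :
    HasIntegralOn f (Iio 0) v ↔ HasIntegralOn (fun x => f (-x)) (Ioi 0) v := by
  have himg : (Neg.neg '' Ioi (0 : ℝ)) = Iio 0 := by simp
  rw [← himg, hasIntegralOn_image_iff (φ' := fun x => -1) measurableSet_Ioi
    (fun x _ => hasDerivAt_neg x) neg_injective.injOn]
  simp

theorem image_inv_Ioo_zero_one : Inv.inv '' Ioo (0 : ℝ) 1 = Ioi 1 := by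
  rw [image_inv_eq_inv, inv_Ioo_0_left zero_lt_one, inv_one]

theorem ofReal_mul_cpow {r : ℝ} (hr : 0 < r) {z : ℂ} (hz : z ≠ 0) (s : ℂ) :
    (r * z) ^ s = (r : ℂ) ^ s * z ^ s := by
  rw [cpow_def_of_ne_zero (mul_ne_zero (ofReal_ne_zero.2 hr.ne') hz), log_ofReal_mul hr hz,
    cpow_def_of_ne_zero (ofReal_ne_zero.2 hr.ne'), cpow_def_of_ne_zero hz, ← exp_add,
    ofReal_log hr.le, add_mul]

/-- Termwise integration of a product with a uniformly convergent series. -/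
theorem hasSum_integral_mul {α : Type*} [MeasurableSpace α] {μ : Measure α} {g H : α → ℂ}
    {h : ℕ → α → ℂ} {u : ℕ → ℝ} (hg : Integrable g μ) (hh : ∀ n, AEStronglyMeasurable (h n) μ)
    (hb : ∀ n, ∀ᵐ x ∂μ, ‖h n x‖ ≤ u n) (hu : Summable u)
    (hH : ∀ᵐ x ∂μ, HasSum (fun n => h n x) (H x)) :
    Integrable (fun x => g x * H x) μ ∧
      HasSum (fun n => ∫ x, g x * h n x ∂μ) (∫ x, g x * H x ∂μ) := by
  have hmeas : AEStronglyMeasurable H μ :=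
    aestronglyMeasurable_of_tendsto_ae atTop
      (f := fun N x => ∑ n ∈ Finset.range N, h n x)
      (fun N => Finset.aestronglyMeasurable_fun_sum _ fun n _ => hh n)
      (hH.mono fun x hx => hx.tendsto_sum_nat)
  have hb' := ae_all_iff.2 hb
  refine ⟨?_, ?_⟩
  · refine (hg.norm.mul_const (∑' n, u n)).mono' (hg.aestronglyMeasurable.mul hmeas) ?_
    filter_upwards [hb', hH] with x hx hHx
    rw [norm_mul]
    refine mul_le_mul_of_nonneg_left ?_ (norm_nonneg _)
    rw [← hHx.tsum_eq]
    exact tsum_of_norm_bounded hu.hasSum hx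
  · refine hasSum_integral_of_dominated_convergence (fun n x => ‖g x‖ * u n)
      (fun n => hg.aestronglyMeasurable.mul (hh n)) (fun n => ?_)
      (Eventually.of_forall fun x => hu.mul_left _) ?_ ?_
    · filter_upwards [hb n] with x hx
      rw [norm_mul]
      exact mul_le_mul_of_nonneg_left hx (norm_nonneg _)
    · simp only [tsum_mul_left]
      exact hg.norm.mul_const _
    · filter_upwards [hH] with x hx using hx.mul_left _

end SetIntegrals

/-! ### Euler's integral for the confluent function -/

section EulerKummer

theorem Gamma_add_natCast {a : ℂ} (ha : 0 < a.re) (n : ℕ) :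
    Gamma (a + n) = (ascPochhammer ℂ n).eval a * Gamma a := by
  rw [← Gamma_add_nat_div_Gamma_eq a, div_mul_cancel₀ _ (Gamma_ne_zero_of_re_pos ha)]
  intro k hk
  rw [hk] at ha
  simp only [neg_re, natCast_re] at ha
  linarith [Nat.cast_nonneg (α := ℝ) k]

theorem hasIntegralOn_beta {u v : ℂ} (hu : 0 < u.re) (hv : 0 < v.re) :
    HasIntegralOn (fun s : ℝ => (s : ℂ) ^ (u - 1) * (1 - (s : ℂ)) ^ (v - 1)) (Ioo 0 1)
      (Gamma u * Gamma v * (Gamma (u + v))⁻¹) := by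
  have h1 := betaIntegral_convergent hu hv
  have h2 := betaIntegral_eq_Gamma_mul_div u v hu hv
  rw [intervalIntegrable_iff_integrableOn_Ioo_of_le zero_le_one] at h1
  rw [betaIntegral, intervalIntegral.integral_of_le zero_le_one, integral_Ioc_eq_integral_Ioo,
    div_eq_mul_inv] at h2
  exact ⟨h1, h2⟩

theorem cpow_sub_one_mul_pow {s : ℝ} (hs : 0 < s) (a : ℂ) (n : ℕ) :
    (s : ℂ) ^ (a - 1) * (s : ℂ) ^ n = (s : ℂ) ^ (a + n - 1) := by
  rw [show a + n - 1 = a - 1 + n by ring, cpow_add _ _ (ofReal_ne_zero.2 hs.ne'), cpow_natCast]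

theorem hasIntegralOn_beta_mul_pow {a b : ℂ} (ha : 0 < a.re) (hb : 0 < b.re) (n : ℕ) :
    HasIntegralOn (fun s : ℝ => (s : ℂ) ^ (a - 1) * (1 - (s : ℂ)) ^ (b - 1) * (s : ℂ) ^ n)
      (Ioo 0 1) (Gamma a * Gamma b * ((ascPochhammer ℂ n).eval a * (Gamma (a + b + n))⁻¹)) := by
  have han : 0 < (a + n).re := by
    rw [add_re, natCast_re]; linarith [Nat.cast_nonneg (α := ℝ) n]
  have h := hasIntegralOn_beta han hb
  rw [Gamma_add_natCast ha, show a + n + b = a + b + n by ring] at h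
  have e : Gamma a * Gamma b * ((ascPochhammer ℂ n).eval a * (Gamma (a + b + n))⁻¹) =
      (ascPochhammer ℂ n).eval a * Gamma a * Gamma b * (Gamma (a + b + n))⁻¹ := by ring
  rw [e]
  refine h.congr measurableSet_Ioo fun s hs => ?_
  rw [← cpow_sub_one_mul_pow hs.1]
  ring

/-- The exponential series is integrated term by term against the Beta density, dominated by ∑ |w|^n
/ n!. -/
theorem hasIntegralOn_euler_kummer {a b : ℂ} (ha : 0 < a.re) (hb : 0 < b.re) (w : ℂ) :
    HasIntegralOn (fun s : ℝ => (s : ℂ) ^ (a - 1) * (1 - (s : ℂ)) ^ (b - 1) * exp (s * w))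
      (Ioo 0 1) (Gamma a * Gamma b * kummerBold a (a + b) w) := by
  have key := hasSum_integral_mul (μ := volume.restrict (Ioo (0 : ℝ) 1))
    (h := fun n s => ((s : ℂ) * w) ^ n / n.factorial) (H := fun s : ℝ => exp (s * w))
    (u := fun n => ‖w‖ ^ n / n.factorial) (hasIntegralOn_beta ha hb).1
    (fun n => by
      have : Continuous fun s : ℝ => ((s : ℂ) * w) ^ n / (n.factorial : ℂ) := by fun_prop
      exact this.aestronglyMeasurable)
    (fun n => by
      rw [ae_restrict_iff' measurableSet_Ioo]
      refine Eventually.of_forall fun s hs => ?_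
      rw [norm_div, norm_pow, norm_mul, norm_real, norm_natCast, Real.norm_eq_abs,
        abs_of_pos hs.1]
      have := hs.1.le
      gcongr
      exact mul_le_of_le_one_left (norm_nonneg w) hs.2.le)
    (Real.summable_pow_div_factorial _)
    (Eventually.of_forall fun s => by
      rw [exp_eq_exp_ℂ]
      exact NormedSpace.expSeries_div_hasSum_exp ((s : ℂ) * w))
  refine ⟨key.1, key.2.unique ?_⟩
  refine ((hasSum_kummerBold a (a + b) w).mul_left (Gamma a * Gamma b)).congr_fun fun n => ?_
  have h := ((hasIntegralOn_beta_mul_pow ha hb n).const_mul (w ^ n / n.factorial)).2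
  rw [kummerTerm, ← mul_assoc, mul_comm _ (w ^ n / (n.factorial : ℂ)), ← h]
  refine integral_congr_ae (Eventually.of_forall fun s => ?_)
  simp only [mul_pow]
  ring

theorem re_pos_of_abs_re_lt {θ α : ℂ} (h : |θ.re| < (1 + α).re) :
    0 < ((1 + α + θ) / 2).re ∧ 0 < ((1 + α - θ) / 2).re := by
  have := abs_lt.1 h
  simp only [add_re, one_re, sub_re, div_ofNat_re] at this ⊢
  constructor <;> linarith

/-- The substitution t = s w. Since s and 1 - s are positive, principal powers of s w and (1-s) w
split, and the powers of w combine to w^(-α). -/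
theorem hasIntegralOn_segment {θ α : ℂ} (h : |θ.re| < (1 - α).re) {w : ℂ} (hw : w ≠ 0) :
    HasIntegralOn (fun s : ℝ => (s * w) ^ ((-1 + θ - α) / 2) * exp (s * w) *
      (w - s * w) ^ ((-1 - θ - α) / 2) * w) (Ioo 0 1) (w ^ (-α) * FTypeI θ (-α) w) := by
  obtain ⟨h1, h2⟩ := re_pos_of_abs_re_lt (θ := θ) (α := -α) (by rwa [← sub_eq_add_neg])
  have key := (hasIntegralOn_euler_kummer h1 h2 w).const_mul (w ^ (-α))
  have e : w ^ (-α) * FTypeI θ (-α) w = w ^ (-α) * (Gamma ((1 + -α + θ) / 2) *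
      Gamma ((1 + -α - θ) / 2) * kummerBold ((1 + -α + θ) / 2)
        ((1 + -α + θ) / 2 + (1 + -α - θ) / 2) w) := by
    rw [FTypeI, FBold]
    ring_nf
  rw [e]
  refine key.congr measurableSet_Ioo fun s hs => ?_
  have hs1 : 0 < 1 - s := sub_pos.2 hs.2
  have e1 : w - s * w = ((1 - s : ℝ) : ℂ) * w := by push_cast; ring
  have e2 : w ^ (-α) = w ^ ((-1 + θ - α) / 2) * w ^ ((-1 - θ - α) / 2) * w := by
    nth_rewrite 4 [← cpow_one w]
    rw [← cpow_add _ _ hw, ← cpow_add _ _ hw]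
    ring_nf
  rw [e1, ofReal_mul_cpow hs.1 hw, ofReal_mul_cpow hs1 hw, e2]
  push_cast
  rw [show (1 + -α + θ) / 2 - 1 = (-1 + θ - α) / 2 by ring,
    show (1 + -α - θ) / 2 - 1 = (-1 - θ - α) / 2 by ring]
  ring

theorem hasIntegralOn_segment_neg {θ α : ℂ} (h : |θ.re| < (1 - α).re) {w : ℂ} (hw : w ≠ 0) :
    HasIntegralOn (fun s : ℝ => (-(s * w)) ^ ((-1 + θ - α) / 2) * exp (s * w) *
      (s * w - w) ^ ((-1 - θ - α) / 2) * (-w)) (Ioo 0 1) ((-w) ^ (-α) * FTypeI θ (-α) w) := by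
  obtain ⟨h1, h2⟩ := re_pos_of_abs_re_lt (θ := θ) (α := -α) (by rwa [← sub_eq_add_neg])
  have key := (hasIntegralOn_euler_kummer h1 h2 w).const_mul ((-w) ^ (-α))
  have e : (-w) ^ (-α) * FTypeI θ (-α) w = (-w) ^ (-α) * (Gamma ((1 + -α + θ) / 2) *
      Gamma ((1 + -α - θ) / 2) * kummerBold ((1 + -α + θ) / 2)
        ((1 + -α + θ) / 2 + (1 + -α - θ) / 2) w) := by
    rw [FTypeI, FBold]
    ring_nf
  rw [e]
  refine key.congr measurableSet_Ioo fun s hs => ?_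
  have hs1 : 0 < 1 - s := sub_pos.2 hs.2
  have hw' := neg_ne_zero.2 hw
  have e0 : -((s : ℂ) * w) = s * -w := by ring
  have e1 : s * w - w = ((1 - s : ℝ) : ℂ) * -w := by push_cast; ring
  have e2 : (-w) ^ (-α) = (-w) ^ ((-1 + θ - α) / 2) * (-w) ^ ((-1 - θ - α) / 2) * (-w) := by
    nth_rewrite 4 [← cpow_one (-w)]
    rw [← cpow_add _ _ hw', ← cpow_add _ _ hw']
    ring_nf
  rw [e0, e1, ofReal_mul_cpow hs.1 hw', ofReal_mul_cpow hs1 hw', e2]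
  push_cast
  rw [show (1 + -α + θ) / 2 - 1 = (-1 + θ - α) / 2 by ring,
    show (1 + -α - θ) / 2 - 1 = (-1 - θ - α) / 2 by ring]
  ring

theorem ofReal_inv_cpow {s : ℝ} (hs : 0 < s) (x : ℂ) : ((s : ℂ)⁻¹) ^ x = (s : ℂ) ^ (-x) := by
  rw [inv_cpow _ _ (by rw [arg_ofReal_of_nonneg hs.le]; exact Real.pi_pos.ne), cpow_neg]

theorem hasIntegralOn_Ioi_one {θ α : ℂ} (h : |θ.re| < (1 + α).re) (w : ℂ) :
    HasIntegralOn (fun t : ℝ => exp (w / t) * (t : ℂ) ^ (-1 - α) *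
      ((t : ℂ) - 1) ^ ((-1 - θ + α) / 2)) (Ioi 1) (FTypeI θ α w) := by
  obtain ⟨h1, h2⟩ := re_pos_of_abs_re_lt h
  have key := hasIntegralOn_euler_kummer h1 h2 w
  rw [← image_inv_Ioo_zero_one, hasIntegralOn_inv_iff measurableSet_Ioo fun x hx => hx.1]
  have e : FTypeI θ α w = Gamma ((1 + α + θ) / 2) * Gamma ((1 + α - θ) / 2) *
      kummerBold ((1 + α + θ) / 2) ((1 + α + θ) / 2 + (1 + α - θ) / 2) w := by
    rw [FTypeI, FBold]
    ring_nf
  rw [e]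
  refine key.congr measurableSet_Ioo fun s hs => ?_
  have hs0 : (s : ℂ) ≠ 0 := ofReal_ne_zero.2 hs.1.ne'
  have hs1 : 0 < 1 - s := sub_pos.2 hs.2
  have e1 : (s : ℂ)⁻¹ - 1 = ((1 - s : ℝ) : ℂ) * (s : ℂ)⁻¹ := by
    push_cast; field_simp
  have e2 : (s : ℂ) ^ ((1 + α + θ) / 2 - 1) =
      ((s : ℂ) ^ 2)⁻¹ * (s : ℂ) ^ (1 + α) * (s : ℂ) ^ (-((-1 - θ + α) / 2)) := by
    rw [← cpow_natCast, ← cpow_neg, ← cpow_add _ _ hs0, ← cpow_add _ _ hs0]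
    push_cast
    ring_nf
  rw [e2]
  push_cast
  rw [e1, ofReal_mul_cpow hs1 (inv_ne_zero hs0), ofReal_inv_cpow hs.1, ofReal_inv_cpow hs.1,
    div_inv_eq_mul, show (1 + α - θ) / 2 - 1 = (-1 - θ + α) / 2 by ring,
    show -(-1 - α) = 1 + α by ring, mul_comm w]
  push_cast
  ring

end EulerKummer

/-! ### The Gauss hypergeometric function off the cut -/

section GaussFunction

theorem one_sub_mul_mem_slitPlane {z : ℂ} (hz : 1 - z ∈ slitPlane) {t : ℝ} (ht : t ∈ Icc (0 : ℝ) 1) :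
    1 - z * t ∈ slitPlane := by
  have h := starConvex_one_slitPlane.add_smul_mem (x := 1) (y := -z)
    (by rwa [← sub_eq_add_neg]) ht.1 ht.2
  rw [real_smul] at h
  convert h using 1
  ring

theorem isOpen_gaussDomain : IsOpen {z : ℂ | 1 - z ∈ slitPlane} :=
  isOpen_slitPlane.preimage (by fun_prop)

theorem isPreconnected_gaussDomain : IsPreconnected {z : ℂ | 1 - z ∈ slitPlane} := by
  have hstar : StarConvex ℝ (0 : ℂ) {z : ℂ | 1 - z ∈ slitPlane} := by
    rw [starConvex_zero_iff]
    intro z hz t h0 h1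
    rw [mem_ofPred_eq, real_smul, mul_comm]
    exact one_sub_mul_mem_slitPlane hz ⟨h0, h1⟩
  exact (hstar.isPathConnected (show 1 - (0 : ℂ) ∈ slitPlane by simp)).isConnected.isPreconnected

theorem IsGaussFunction.eqOn {a b c : ℂ} {f g : ℂ → ℂ} (hf : IsGaussFunction a b c f)
    (hg : IsGaussFunction a b c g) {z : ℂ} (hz : 1 - z ∈ slitPlane) : f z = g z := by
  refine hf.1.eqOn_of_preconnected_of_eventuallyEq hg.1 isPreconnected_gaussDomain
    (z₀ := 0) (by simp) ?_ hz
  filter_upwards [Metric.ball_mem_nhds (0 : ℂ) one_pos] with y hy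
  rw [mem_ball_zero_iff] at hy
  rw [hf.2 y hy, hg.2 y hy]

theorem gaussF_spec {a b c : ℂ} (h : ∃ f, IsGaussFunction a b c f) :
    IsGaussFunction a b c (gaussF a b c) :=
  Classical.epsilon_spec h

theorem gaussF_symm (a b c : ℂ) : gaussF a b c = gaussF b a c := by
  have : IsGaussFunction a b c = IsGaussFunction b a c := by
    funext f
    simp only [IsGaussFunction, ordinaryHypergeometric]
    rw [ordinaryHypergeometricSeries_symm]
  rw [gaussF, gaussF, this]

/-- The terms of the Gauss series. -/
noncomputable def gaussTerm (a b c z : ℂ) (n : ℕ) : ℂ :=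
  (ascPochhammer ℂ n).eval a * (ascPochhammer ℂ n).eval b * ((ascPochhammer ℂ n).eval c)⁻¹ *
    (z ^ n / n.factorial)

theorem ordinaryHypergeometric_eq_tsum_gaussTerm (a b c z : ℂ) :
    ordinaryHypergeometric a b c z = ∑' n, gaussTerm a b c z n := by
  rw [ordinaryHypergeometric_eq_tsum]
  refine tsum_congr fun n => ?_
  rw [gaussTerm, smul_eq_mul]
  ring

theorem add_natCast_ne_zero {c : ℝ} (hc : 0 < c) (n : ℕ) : (c : ℂ) + n ≠ 0 := by
  have : c + n ≠ 0 := by positivity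
  exact_mod_cast this

theorem ascPochhammer_eval_ofReal_ne_zero {c : ℝ} (hc : 0 < c) (n : ℕ) :
    (ascPochhammer ℂ n).eval (c : ℂ) ≠ 0 := by
  induction n with
  | zero => simp
  | succ n ih =>
    rw [ascPochhammer_eval_succ_right]
    exact mul_ne_zero ih (add_natCast_ne_zero hc n)

theorem hasSum_gaussTerm (a b : ℂ) {c : ℝ} (hc : 0 < c) {z : ℂ} (hz : ‖z‖ < 1) :
    HasSum (gaussTerm a b c z) (ordinaryHypergeometric a b (c : ℂ) z) := by
  rw [ordinaryHypergeometric_eq_tsum_gaussTerm]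
  refine Summable.hasSum ?_
  obtain ⟨ρ, hzρ, hρ⟩ := exists_between hz
  have hlim : Tendsto (fun n : ℕ => (a + n) / (c + n) * ((b + n) / (1 + n)) * z) atTop (𝓝 z) := by
    have h1 := tendsto_add_mul_div_add_mul_atTop_nhds a (c : ℂ) (1 : ℂ) one_ne_zero
    have h2 := tendsto_add_mul_div_add_mul_atTop_nhds b 1 (1 : ℂ) one_ne_zero
    simpa using (h1.mul h2).mul_const z
  refine summable_of_ratio_norm_eventually_le hρ ?_
  filter_upwards [hlim.norm.eventually_lt_const hzρ] with n hs
  have e : gaussTerm a b c z (n + 1) =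
      ((a + n) / (c + n) * ((b + n) / (1 + n)) * z) * gaussTerm a b c z n := by
    have h1 : (1 + (n : ℂ)) ≠ 0 := by rw [add_comm]; exact Nat.cast_add_one_ne_zero n
    have h2 := add_natCast_ne_zero hc n
    have h3 : (n.factorial : ℂ) ≠ 0 := Nat.cast_ne_zero.2 n.factorial_ne_zero
    have h4 := ascPochhammer_eval_ofReal_ne_zero hc n
    rw [gaussTerm, gaussTerm, ascPochhammer_eval_succ_right, ascPochhammer_eval_succ_right,
      ascPochhammer_eval_succ_right, Nat.factorial_succ]
    push_cast
    rw [add_comm (n : ℂ) 1]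
    field_simp
    ring
  rw [e, norm_mul]
  exact mul_le_mul_of_nonneg_right hs.le (norm_nonneg _)

/-- Gauss's equation for the Gauss series, as a recursion. -/
theorem ordinaryHypergeometric_recursion (a b : ℂ) {c : ℝ} (hc : 0 < c) {z : ℂ} (hz : ‖z‖ < 1) :
    ordinaryHypergeometric a b (c : ℂ) z =
      z * (1 - z) * ((a + 1) * (b + 1) / (c * (c + 1))) *
          ordinaryHypergeometric (a + 2) (b + 2) ((c + 2 : ℝ) : ℂ) z +
        (1 - (a + b + 1) * z / c) * ordinaryHypergeometric (a + 1) (b + 1) ((c + 1 : ℝ) : ℂ) z := by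
  have hc1 : 0 < c + 1 := by positivity
  have hc2 : 0 < c + 2 := by positivity
  have hc0 : (c : ℂ) ≠ 0 := ofReal_ne_zero.2 hc.ne'
  have hc10 : (c : ℂ) + 1 ≠ 0 := by exact_mod_cast hc1.ne'
  set F₁ := ordinaryHypergeometric (a + 1) (b + 1) ((c + 1 : ℝ) : ℂ) z
  set F₂ := ordinaryHypergeometric (a + 2) (b + 2) ((c + 2 : ℝ) : ℂ) z
  have s1 : HasSum (gaussTerm (a + 1) (b + 1) ((c + 1 : ℝ) : ℂ) z) F₁ := hasSum_gaussTerm _ _ hc1 hz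
  have s2 : HasSum (gaussTerm (a + 2) (b + 2) ((c + 2 : ℝ) : ℂ) z) F₂ := hasSum_gaussTerm _ _ hc2 hz
  have fac : ∀ n : ℕ, (n.factorial : ℂ) ≠ 0 := fun n => Nat.cast_ne_zero.2 n.factorial_ne_zero
  have cast1 : ∀ n : ℕ, (n : ℂ) + 1 ≠ 0 := Nat.cast_add_one_ne_zero
  -- The Euler operator ϑ = z ∂ applied to F₁. Termwise, the recursion is c F = (ϑ + c) F₁ - z (ϑ +
  -- a + b + 1) F₁.
  have sn : HasSum (fun n : ℕ => n * gaussTerm (a + 1) (b + 1) ((c + 1 : ℝ) : ℂ) z n)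
      (z * ((a + 1) * (b + 1) / (c + 1)) * F₂) := by
    rw [← hasSum_nat_add_iff' 1, Finset.sum_range_one, Nat.cast_zero, zero_mul, sub_zero]
    refine (s2.mul_left (z * ((a + 1) * (b + 1) / (c + 1)))).congr_fun fun n => ?_
    rw [gaussTerm, gaussTerm, ascPochhammer_eval_succ_left, ascPochhammer_eval_succ_left,
      ascPochhammer_eval_succ_left, Nat.factorial_succ]
    push_cast
    rw [show a + 1 + 1 = a + 2 by ring, show b + 1 + 1 = b + 2 by ring,
      show (c : ℂ) + 1 + 1 = c + 2 by ring]
    have h4 : (ascPochhammer ℂ n).eval ((c : ℂ) + 2) ≠ 0 := by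
      exact_mod_cast ascPochhammer_eval_ofReal_ne_zero hc2 n
    have := fac n
    have := cast1 n
    field_simp
    ring
  have sA := sn.add (s1.mul_left (c : ℂ))
  have sB := (sn.add (s1.mul_left (a + b + 1))).mul_left z
  -- Multiplication by z shifts the index, so the coefficient at n = 0 is set to zero by hand.
  have hB : HasSum (fun n : ℕ => if n = 0 then (0 : ℂ) else
      z * ((n - 1 : ℕ) * gaussTerm (a + 1) (b + 1) ((c + 1 : ℝ) : ℂ) z (n - 1) +
        (a + b + 1) * gaussTerm (a + 1) (b + 1) ((c + 1 : ℝ) : ℂ) z (n - 1)))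
      (z * (z * ((a + 1) * (b + 1) / (c + 1)) * F₂ + (a + b + 1) * F₁)) := by
    rw [← hasSum_nat_add_iff' 1, Finset.sum_range_one, if_pos rfl, sub_zero]
    simpa using sB
  have sC := ((sA.sub hB).mul_left ((c : ℂ)⁻¹))
  have h0 := hasSum_gaussTerm a b hc hz
  have heq : ∀ n, gaussTerm a b c z n = (c : ℂ)⁻¹ *
      (n * gaussTerm (a + 1) (b + 1) ((c + 1 : ℝ) : ℂ) z n +
        c * gaussTerm (a + 1) (b + 1) ((c + 1 : ℝ) : ℂ) z n -
        if n = 0 then (0 : ℂ) else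
      z * ((n - 1 : ℕ) * gaussTerm (a + 1) (b + 1) ((c + 1 : ℝ) : ℂ) z (n - 1) +
        (a + b + 1) * gaussTerm (a + 1) (b + 1) ((c + 1 : ℝ) : ℂ) z (n - 1))) := by
    intro n
    rcases n with _ | n
    · simp [gaussTerm, hc0]
    · rw [if_neg (Nat.succ_ne_zero n), Nat.add_sub_cancel]
      have h4 : (ascPochhammer ℂ n).eval ((c : ℂ) + 1) ≠ 0 := by
        exact_mod_cast ascPochhammer_eval_ofReal_ne_zero hc1 n
      have h5 : (c : ℂ) + 1 + n ≠ 0 := by exact_mod_cast add_natCast_ne_zero hc1 n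
      simp only [gaussTerm]
      rw [ascPochhammer_eval_succ_left a, ascPochhammer_eval_succ_left b,
        ascPochhammer_eval_succ_left (c : ℂ), ascPochhammer_eval_succ_right (a + 1),
        ascPochhammer_eval_succ_right (b + 1), Nat.factorial_succ]
      push_cast
      rw [ascPochhammer_eval_succ_right ((c : ℂ) + 1)]
      have := fac n
      have := cast1 n
      field_simp
      ring
  rw [h0.unique (sC.congr_fun heq)]
  field_simp
  ring

theorem isGaussFunction_recursion {a b : ℂ} {c : ℝ} (hc : 0 < c) {f₁ f₂ : ℂ → ℂ}
    (h₁ : IsGaussFunction (a + 1) (b + 1) ((c + 1 : ℝ) : ℂ) f₁)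
    (h₂ : IsGaussFunction (a + 2) (b + 2) ((c + 2 : ℝ) : ℂ) f₂) :
    IsGaussFunction a b c (fun z => z * (1 - z) * ((a + 1) * (b + 1) / (c * (c + 1))) * f₂ z +
        (1 - (a + b + 1) * z / c) * f₁ z) := by
  refine ⟨fun z hz => ?_, fun z hz => ?_⟩
  · have a1 := h₁.1 z hz
    have a2 := h₂.1 z hz
    fun_prop
  · rw [ordinaryHypergeometric_recursion a b hc hz, ← h₁.2 z hz, ← h₂.2 z hz]

/-- The binomial series, with coefficients written as Pochhammer symbols. -/
theorem hasSum_one_sub_cpow_neg (a : ℂ) {x : ℂ} (hx : ‖x‖ < 1) :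
    HasSum (fun n : ℕ => (ascPochhammer ℂ n).eval a / n.factorial * x ^ n) ((1 - x) ^ (-a)) := by
  have h := (one_div_one_sub_cpow_hasFPowerSeriesOnBall_zero a).hasSum (y := x)
    (by rw [Metric.mem_eball, edist_zero_right, ← ofReal_norm, ENNReal.ofReal_lt_one]; exact hx)
  rw [zero_add, one_div, ← cpow_neg] at h
  refine h.congr_fun fun n => ?_
  rw [FormalMultilinearSeries.ofScalars_apply_eq, smul_eq_mul]
  congr 1
  have h2 := Ring.factorial_nsmul_multichoose_eq_ascPochhammer a n
  rw [Polynomial.ascPochhammer_smeval_eq_eval, nsmul_eq_mul] at h2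
  rw [← h2, Ring.choose, mul_div_cancel_left₀ _ (Nat.cast_ne_zero.2 n.factorial_ne_zero)]
  congr 1
  ring

/-- Euler's integral for the Gauss function. -/
noncomputable def eulerGauss (a b c z : ℂ) : ℂ :=
  (∫ t in Ioo (0 : ℝ) 1, (t : ℂ) ^ (b - 1) * (1 - (t : ℂ)) ^ (c - b - 1) * (1 - z * t) ^ (-a)) /
    ∫ t in Ioo (0 : ℝ) 1, (t : ℂ) ^ (b - 1) * (1 - (t : ℂ)) ^ (c - b - 1)

theorem continuousOn_one_sub_mul_cpow (a : ℂ) :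
    ContinuousOn (fun x : ℝ × ℂ => (1 - x.2 * x.1) ^ (-a))
      (Icc 0 1 ×ˢ {z : ℂ | 1 - z ∈ slitPlane}) := by
  intro x hx
  refine ContinuousAt.continuousWithinAt ?_
  exact ContinuousAt.cpow (by fun_prop) continuousAt_const (one_sub_mul_mem_slitPlane hx.2 hx.1)

/-- For z off the cut, 1 - z t stays in the slit plane for all t in [0,1], which gives holomorphy.
For |z| < 1 the binomial series is integrated termwise. Dividing by the Beta integral itself, and
not by its value in Gamma functions, lets the scaling factors cancel later when t is replaced by s /
c. -/
theorem isGaussFunction_eulerGauss (a : ℂ) {b : ℂ} {c : ℝ} (hb : 0 < b.re) (hbc : b.re < c) :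
    IsGaussFunction a b c (eulerGauss a b c) := by
  have hcb : 0 < ((c : ℂ) - b).re := by simpa using hbc
  have hc : 0 < c := hb.trans hbc
  have hβ := hasIntegralOn_beta hb hcb
  refine ⟨fun z₀ hz₀ => ?_, fun z hz => ?_⟩
  · obtain ⟨r, hr, hball⟩ := Metric.nhds_basis_closedBall.mem_iff.1
      (isOpen_gaussDomain.mem_nhds hz₀)
    obtain ⟨C, hC⟩ := (isCompact_Icc.prod (isCompact_closedBall z₀ r)).exists_bound_of_continuousOn
      ((continuousOn_one_sub_mul_cpow a).mono (prod_mono subset_rfl hball))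
    have hin : ∀ z ∈ Metric.ball z₀ r, 1 - z ∈ slitPlane := fun z hz =>
      hball (Metric.ball_subset_closedBall hz)
    refine AnalyticAt.div_const ?_
    refine analyticAt_integral_of_dominated_holomorphic (r := r)
      (bound := fun t : ℝ => ‖(t : ℂ) ^ (b - 1) * (1 - (t : ℂ)) ^ ((c : ℂ) - b - 1)‖ * C) hr
      (fun z hz => ?_) ?_ ?_ (hβ.1.norm.mul_const C)
    · refine hβ.1.aestronglyMeasurable.mul (ContinuousOn.aestronglyMeasurable ?_ measurableSet_Ioo)
      exact (continuousOn_one_sub_mul_cpow a).comp (f := fun t : ℝ => (t, z)) (by fun_prop)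
        fun t ht => ⟨Ioo_subset_Icc_self ht, hin z hz⟩
    · rw [ae_restrict_iff' measurableSet_Ioo]
      refine Eventually.of_forall fun t ht z hz => ?_
      refine DifferentiableAt.differentiableWithinAt ?_
      have hlin : DifferentiableAt ℂ (fun z : ℂ => 1 - z * t) z := by fun_prop
      exact (hlin.cpow_const
        (one_sub_mul_mem_slitPlane (hin z hz) (Ioo_subset_Icc_self ht))).const_mul _
    · rw [ae_restrict_iff' measurableSet_Ioo]
      refine Eventually.of_forall fun t ht z hz => ?_
      rw [norm_mul]
      exact mul_le_mul_of_nonneg_left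
        (hC (t, z) ⟨Ioo_subset_Icc_self ht, Metric.ball_subset_closedBall hz⟩) (norm_nonneg _)
  · have key := hasSum_integral_mul (μ := volume.restrict (Ioo (0 : ℝ) 1)) hβ.1
      (h := fun n t => (ascPochhammer ℂ n).eval a / n.factorial * (z * t) ^ n)
      (H := fun t : ℝ => (1 - z * t) ^ (-a))
      (u := fun n => ‖(ascPochhammer ℂ n).eval a / n.factorial * z ^ n‖)
      (fun n => by
        have : Continuous fun t : ℝ =>
          (ascPochhammer ℂ n).eval a / n.factorial * (z * t) ^ n := by fun_prop
        exact this.aestronglyMeasurable)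
      (fun n => by
        rw [ae_restrict_iff' measurableSet_Ioo]
        refine Eventually.of_forall fun t ht => ?_
        have := ht.1.le
        rw [norm_mul, norm_mul, norm_pow, norm_pow, norm_mul, norm_real, Real.norm_eq_abs,
          abs_of_pos ht.1]
        gcongr
        exact mul_le_of_le_one_right (norm_nonneg z) ht.2.le)
      (hasSum_one_sub_cpow_neg a hz).summable.norm
      (by
        rw [ae_restrict_iff' measurableSet_Ioo]
        refine Eventually.of_forall fun t ht => hasSum_one_sub_cpow_neg a ?_
        rw [norm_mul, norm_real, Real.norm_eq_abs, abs_of_pos ht.1]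
        exact (mul_le_of_le_one_right (norm_nonneg z) ht.2.le).trans_lt hz)
    rw [eulerGauss, hβ.2]
    have hGb := Gamma_ne_zero_of_re_pos hb
    have hGcb := Gamma_ne_zero_of_re_pos hcb
    have hGc : Gamma (c : ℂ) ≠ 0 := Gamma_ne_zero_of_re_pos (by simpa using hc)
    rw [show b + ((c : ℂ) - b) = c by ring]
    have hne : Gamma b * Gamma (c - b) * (Gamma (c : ℂ))⁻¹ ≠ 0 :=
      mul_ne_zero (mul_ne_zero hGb hGcb) (inv_ne_zero hGc)
    rw [div_eq_iff hne]
    refine key.2.unique ?_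
    refine ((hasSum_gaussTerm a b hc hz).mul_right _).congr_fun fun n => ?_
    have h := ((hasIntegralOn_beta_mul_pow hb hcb n).const_mul
      ((ascPochhammer ℂ n).eval a / n.factorial * z ^ n)).2
    rw [show b + ((c : ℂ) - b) = c by ring] at h
    calc _ = _ := integral_congr_ae (Eventually.of_forall fun t => by simp only [mul_pow]; ring)
      _ = _ := h
      _ = _ := by
        have h4 := ascPochhammer_eval_ofReal_ne_zero hc n
        have h5 : Gamma ((c : ℂ) + n) ≠ 0 := Gamma_ne_zero_of_re_pos (by
          simp only [add_re, ofReal_re, natCast_re]; positivity)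
        rw [gaussTerm, Gamma_add_natCast (by simpa using hc), mul_inv]
        ring

/-- Euler's integral covers Re b > 0. The recursion expresses the parameters (a, b, c) through those
raised by 1 and by 2, so each step gains one unit in Re b while Re b < c is preserved. -/
theorem exists_isGaussFunction (n : ℕ) : ∀ (a b : ℂ) (c : ℝ), -(n : ℝ) < b.re → 0 < c → b.re < c →
    ∃ f, IsGaussFunction a b c f := by
  induction n with
  | zero =>
    intro a b c hb _ hbc
    exact ⟨_, isGaussFunction_eulerGauss a (by simpa using hb) hbc⟩
  | succ n ih =>
    intro a b c hb hc hbc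
    push_cast at hb
    obtain ⟨f₁, h₁⟩ := ih (a + 1) (b + 1) (c + 1) (by simp only [add_re, one_re]; linarith)
      (by linarith) (by simp only [add_re, one_re]; linarith)
    obtain ⟨f₂, h₂⟩ := ih (a + 2) (b + 2) (c + 2) (by simp only [add_re, re_ofNat]; linarith)
      (by linarith) (by simp only [add_re, re_ofNat]; linarith)
    exact ⟨_, isGaussFunction_recursion hc h₁ h₂⟩

theorem isGaussFunction_gaussF (a b : ℂ) {c : ℝ} (hc : 0 < c) (hbc : b.re < c) :
    IsGaussFunction a b c (gaussF a b c) := by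
  obtain ⟨n, hn⟩ := exists_nat_gt (-b.re)
  exact gaussF_spec (exists_isGaussFunction n a b c (by linarith) hc hbc)

theorem gaussF_eq_eulerGauss (a : ℂ) {b : ℂ} {c : ℝ} (hb : 0 < b.re) (hbc : b.re < c) {z : ℂ}
    (hz : 1 - z ∈ slitPlane) : gaussF a b c z = eulerGauss a b c z :=
  (isGaussFunction_gaussF a b (hb.trans hbc) hbc).eqOn (isGaussFunction_eulerGauss a hb hbc) hz

theorem gaussF_recursion (a b : ℂ) {c : ℝ} (hc : 0 < c) (hbc : b.re < c) {z : ℂ}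
    (hz : 1 - z ∈ slitPlane) : gaussF a b c z =
      z * (1 - z) * ((a + 1) * (b + 1) / (c * (c + 1))) *
          gaussF (a + 2) (b + 2) ((c + 2 : ℝ) : ℂ) z +
        (1 - (a + b + 1) * z / c) * gaussF (a + 1) (b + 1) ((c + 1 : ℝ) : ℂ) z :=
  (isGaussFunction_gaussF a b hc hbc).eqOn (isGaussFunction_recursion hc
    (isGaussFunction_gaussF (a + 1) (b + 1) (by linarith) (by simp only [add_re, one_re]; linarith))
    (isGaussFunction_gaussF (a + 2) (b + 2) (by linarith)
      (by simp only [add_re, re_ofNat]; linarith))) hz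

end GaussFunction

/-! ### The function `₂F₀` and its Laplace integral -/

section TwoFZero

theorem one_sub_mul_mem_slitPlane_of_nonneg {z : ℂ} (hz : -z ∈ slitPlane) {s : ℝ} (hs : 0 ≤ s) :
    1 - z * s ∈ slitPlane := by
  rw [mem_slitPlane_iff] at hz ⊢
  simp only [neg_re, neg_im, sub_re, one_re, mul_re, ofReal_re, ofReal_im, mul_zero, sub_zero,
    sub_im, one_im, mul_im, zero_add, zero_sub] at hz ⊢
  rcases hz with h | h
  · left
    nlinarith
  · rcases hs.eq_or_lt with rfl | hs
    · left; simp
    · right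
      simpa [hs.ne'] using h

theorem rpow_one_add_le_exp (A : ℝ) {ε : ℝ} (hε : 0 < ε) :
    ∃ C : ℝ, 0 ≤ C ∧ ∀ s : ℝ, 0 ≤ s → (1 + s) ^ A ≤ C * Real.exp (ε * s) := by
  obtain ⟨N, hN⟩ := exists_nat_ge A
  refine ⟨N.factorial / ε ^ N * Real.exp ε, by positivity, fun s hs => ?_⟩
  have h1 : (1 + s) ^ A ≤ (1 + s) ^ N := by
    rw [← Real.rpow_natCast]
    exact Real.rpow_le_rpow_of_exponent_le (by linarith) hN
  have h2 := Real.pow_div_factorial_le_exp (x := ε * (1 + s)) (by positivity) N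
  rw [mul_pow, div_le_iff₀ (by positivity)] at h2
  refine h1.trans ?_
  rw [mul_assoc, ← Real.exp_add, div_mul_eq_mul_div, le_div_iff₀ (by positivity)]
  calc (1 + s) ^ N * ε ^ N = ε ^ N * (1 + s) ^ N := mul_comm _ _
    _ ≤ Real.exp (ε * (1 + s)) * N.factorial := h2
    _ = _ := by rw [mul_comm]; ring_nf

/-- Powers of `1 - z s` grow at most subexponentially in `s`, locally uniformly in `z`. -/
theorem exists_norm_one_sub_mul_cpow_le {w : ℂ} (hw : -w ∈ slitPlane) (a : ℂ) {ε : ℝ} (hε : 0 < ε) :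
    ∃ r > 0, ∃ C : ℝ, 0 ≤ C ∧ ∀ z ∈ Metric.ball w r, -z ∈ slitPlane ∧
      ∀ s : ℝ, 0 ≤ s → ‖(1 - z * s) ^ a‖ ≤ C * Real.exp (ε * s) := by
  have hopen : IsOpen {z : ℂ | -z ∈ slitPlane} := isOpen_slitPlane.preimage (by fun_prop)
  obtain ⟨r, hr, hball⟩ := Metric.nhds_basis_closedBall.mem_iff.1 (hopen.mem_nhds hw)
  -- Compactification of the half-line by σ = s/(1+s): |1 - z s| = (1+s) |1 - σ - z σ|. The second
  -- factor is continuous and nonzero on K, including σ = 1, which stands for s = ∞. Hence |1 - z s|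
  -- is comparable to 1 + s uniformly in z.
  set K : Set (ℝ × ℂ) := Icc 0 1 ×ˢ Metric.closedBall w r
  have hK : IsCompact K := isCompact_Icc.prod (isCompact_closedBall w r)
  have hcont : ContinuousOn (fun x : ℝ × ℂ => ‖(1 - (x.1 : ℂ)) - x.2 * x.1‖) K := by fun_prop
  have hpos : ∀ x ∈ K, 0 < ‖(1 - (x.1 : ℂ)) - x.2 * x.1‖ := by
    rintro ⟨σ, z⟩ ⟨hσ, hz⟩
    have h1 : 1 - (1 + z) ∈ slitPlane := by
      rw [sub_add_cancel_left]; exact hball hz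
    have := slitPlane_ne_zero (one_sub_mul_mem_slitPlane h1 hσ)
    rw [norm_pos_iff]
    convert this using 1
    ring
  have hKne : K.Nonempty := ⟨(0, w), ⟨by simp, Metric.mem_closedBall_self hr.le⟩⟩
  obtain ⟨x₀, hx₀, hmin⟩ := hK.exists_isMinOn hKne hcont
  obtain ⟨x₁, hx₁, hmax⟩ := hK.exists_isMaxOn hKne hcont
  set δ := ‖(1 - (x₀.1 : ℂ)) - x₀.2 * x₀.1‖
  set M := ‖(1 - (x₁.1 : ℂ)) - x₁.2 * x₁.1‖
  have hδ : 0 < δ := hpos _ hx₀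
  have hM : 0 < M := hpos _ hx₁
  obtain ⟨C, hC, hCs⟩ := rpow_one_add_le_exp |a.re| hε
  refine ⟨r, hr, (δ ^ a.re + M ^ a.re) * C * Real.exp (Real.pi * |a.im|), by positivity,
    fun z hz => ⟨hball (Metric.ball_subset_closedBall hz), fun s hs => ?_⟩⟩
  have h1s : (0 : ℝ) < 1 + s := by positivity
  have hmem : (s / (1 + s), z) ∈ K := ⟨⟨by positivity, by rw [div_le_one h1s]; linarith⟩,
    Metric.ball_subset_closedBall hz⟩
  have h1sc : (1 : ℂ) + s ≠ 0 := by exact_mod_cast h1s.ne'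
  have hfac : ‖1 - z * s‖ = (1 + s) * ‖(1 - ((s / (1 + s) : ℝ) : ℂ)) - z * (s / (1 + s) : ℝ)‖ := by
    have : 1 - z * s = (1 + s : ℝ) * ((1 - ((s / (1 + s) : ℝ) : ℂ)) - z * (s / (1 + s) : ℝ)) := by
      push_cast
      field_simp
      ring
    rw [this, norm_mul, norm_real, Real.norm_eq_abs, abs_of_pos h1s]
  have hlo : δ * (1 + s) ≤ ‖1 - z * s‖ := by
    rw [hfac, mul_comm]; exact mul_le_mul_of_nonneg_left (hmin hmem) h1s.le
  have hup : ‖1 - z * s‖ ≤ M * (1 + s) := by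
    rw [hfac, mul_comm]; exact mul_le_mul_of_nonneg_right (hmax hmem) h1s.le
  have hx0 : 0 < ‖1 - z * s‖ := (by positivity : 0 < δ * (1 + s)).trans_le hlo
  have hone : (1 : ℝ) ≤ 1 + s := by linarith
  have hpow : ‖1 - z * s‖ ^ a.re ≤ (δ ^ a.re + M ^ a.re) * (1 + s) ^ |a.re| := by
    rcases le_total 0 a.re with h | h
    · calc ‖1 - z * s‖ ^ a.re ≤ (M * (1 + s)) ^ a.re := Real.rpow_le_rpow hx0.le hup h
        _ = M ^ a.re * (1 + s) ^ |a.re| := by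
          rw [Real.mul_rpow hM.le h1s.le, abs_of_nonneg h]
        _ ≤ _ := by gcongr; linarith [Real.rpow_nonneg hδ.le a.re]
    · calc ‖1 - z * s‖ ^ a.re ≤ (δ * (1 + s)) ^ a.re :=
            Real.rpow_le_rpow_of_nonpos (by positivity) hlo h
        _ = δ ^ a.re * (1 + s) ^ a.re := Real.mul_rpow hδ.le h1s.le
        _ ≤ δ ^ a.re * (1 + s) ^ |a.re| := by
          gcongr; exact le_abs_self _
        _ ≤ _ := by gcongr; linarith [Real.rpow_nonneg hM.le a.re]
  have harg : -(arg (1 - z * s) * a.im) ≤ Real.pi * |a.im| := by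
    refine (neg_le_abs _).trans ?_
    rw [abs_mul]
    exact mul_le_mul_of_nonneg_right (abs_arg_le_pi _) (abs_nonneg _)
  calc ‖(1 - z * s) ^ a‖ ≤ ‖1 - z * s‖ ^ a.re / Real.exp (arg (1 - z * s) * a.im) := norm_cpow_le _ _
    _ = ‖1 - z * s‖ ^ a.re * Real.exp (-(arg (1 - z * s) * a.im)) := by
      rw [Real.exp_neg, div_eq_mul_inv]
    _ ≤ ((δ ^ a.re + M ^ a.re) * (C * Real.exp (ε * s))) * Real.exp (Real.pi * |a.im|) := by
      gcongr
      exact hpow.trans (mul_le_mul_of_nonneg_left (hCs s hs) (by positivity))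
    _ = _ := by ring

theorem integrableOn_rpow_mul_exp_neg_mul {p k : ℝ} (hp : 0 < p) (hk : 0 < k) :
    IntegrableOn (fun s : ℝ => s ^ (p - 1) * Real.exp (-k * s)) (Ioi 0) := by
  simpa using integrableOn_rpow_mul_exp_neg_mul_rpow (s := p - 1) (p := 1) (by linarith) one_pos hk

/-- The integrand of the Laplace integral of `₂F₀`. -/
noncomputable def laplaceIntegrand (a b w : ℂ) (s : ℝ) : ℂ :=
  (s : ℂ) ^ (b - 1) * exp (-s) * (1 - w * s) ^ (-a)

theorem measurable_laplaceIntegrand (a b w : ℂ) : Measurable (laplaceIntegrand a b w) := by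
  unfold laplaceIntegrand
  fun_prop

theorem exists_norm_laplaceIntegrand_le {w : ℂ} (hw : -w ∈ slitPlane) (a b : ℂ) :
    ∃ r > 0, ∃ C : ℝ, ∀ z ∈ Metric.ball w r, -z ∈ slitPlane ∧
      ∀ s ∈ Ioi (0 : ℝ), ‖laplaceIntegrand a b z s‖ ≤
        C * (s ^ (b.re - 1) * Real.exp (-(1 / 2) * s)) := by
  obtain ⟨r, hr, C, hC, h⟩ := exists_norm_one_sub_mul_cpow_le hw (-a) (ε := 1 / 2) (by norm_num)
  refine ⟨r, hr, C, fun z hz => ⟨(h z hz).1, fun s hs => ?_⟩⟩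
  rw [laplaceIntegrand, norm_mul, norm_mul, norm_cpow_eq_rpow_re_of_pos hs, norm_exp]
  have h1 := (h z hz).2 s (le_of_lt hs)
  have hs' : 0 ≤ s ^ (b.re - 1) := Real.rpow_nonneg (le_of_lt hs) _
  simp only [sub_re, one_re, neg_re, ofReal_re]
  calc s ^ (b.re - 1) * Real.exp (-s) * ‖(1 - z * s) ^ (-a)‖
      ≤ s ^ (b.re - 1) * Real.exp (-s) * (C * Real.exp (1 / 2 * s)) := by gcongr
    _ = C * (s ^ (b.re - 1) * (Real.exp (-s) * Real.exp (1 / 2 * s))) := by ring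
    _ = _ := by rw [← Real.exp_add]; ring_nf

theorem integrableOn_laplaceIntegrand {w : ℂ} (hw : -w ∈ slitPlane) (a : ℂ) {b : ℂ}
    (hb : 0 < b.re) : IntegrableOn (laplaceIntegrand a b w) (Ioi 0) := by
  obtain ⟨r, hr, C, h⟩ := exists_norm_laplaceIntegrand_le hw a b
  refine ((integrableOn_rpow_mul_exp_neg_mul hb (k := 1 / 2) (by norm_num)).const_mul C).mono'
    (measurable_laplaceIntegrand a b w).aestronglyMeasurable ?_
  rw [ae_restrict_iff' measurableSet_Ioi]
  exact Eventually.of_forall (h w (Metric.mem_ball_self hr)).2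

/-- The rescaled integrand of Euler's integral. -/
noncomputable def scaledEulerIntegrand (a b w : ℂ) (d : ℕ) (c s : ℝ) : ℂ :=
  (s : ℂ) ^ (b - 1) * (1 - (s / c : ℝ)) ^ ((c : ℂ) + d - b - 1) * (1 - w * s) ^ (-a)

/-- Here (1 - s/c)^(c+d-b-1) → e^(-s). The shift d is needed because the recursion raises the third
parameter of ₂F₁ while the argument c w stays the same. -/
theorem tendsto_integral_scaledEulerIntegrand {w : ℂ} (hw : -w ∈ slitPlane) (a : ℂ) {b : ℂ}
    (hb : 0 < b.re) (d : ℕ) :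
    Tendsto (fun c : ℝ => ∫ s in Ioo (0 : ℝ) c, scaledEulerIntegrand a b w d c s) atTop
      (𝓝 (∫ s in Ioi (0 : ℝ), laplaceIntegrand a b w s)) := by
  obtain ⟨r, hr, C, hC, h⟩ := exists_norm_one_sub_mul_cpow_le hw (-a) (ε := 1 / 4) (by norm_num)
  have hK := (h w (Metric.mem_ball_self hr)).2
  have hind : ∀ c : ℝ, ∫ s in Ioo (0 : ℝ) c, scaledEulerIntegrand a b w d c s =
      ∫ s in Ioi (0 : ℝ), (Ioo (0 : ℝ) c).indicator (scaledEulerIntegrand a b w d c) s := fun c => by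
    rw [setIntegral_indicator measurableSet_Ioo, inter_eq_right.2 Ioo_subset_Ioi_self]
  simp only [hind]
  refine tendsto_integral_filter_of_dominated_convergence
    (fun s => C * (s ^ (b.re - 1) * Real.exp (-(1 / 4) * s))) ?_ ?_ ?_ ?_
  · refine Eventually.of_forall fun c => ?_
    have : Measurable (scaledEulerIntegrand a b w d c) := by
      unfold scaledEulerIntegrand
      fun_prop
    exact (this.indicator measurableSet_Ioo).aestronglyMeasurable
  -- From this threshold on the exponent has real part at least c/2, so the power of 1 - s/c is at
  -- most e^(-s/2). The power of 1 - w s costs e^(s/4), and e^(-s/4) remains.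
  · filter_upwards [eventually_ge_atTop (2 * (b.re + 1)), eventually_gt_atTop 0] with c hc hc0
    rw [ae_restrict_iff' measurableSet_Ioi]
    refine Eventually.of_forall fun s hs => ?_
    have hs0 : (0 : ℝ) < s := hs
    have hs' : 0 ≤ s ^ (b.re - 1) := Real.rpow_nonneg hs0.le _
    by_cases hsc : s ∈ Ioo (0 : ℝ) c
    · rw [indicator_of_mem hsc, scaledEulerIntegrand, norm_mul, norm_mul,
        norm_cpow_eq_rpow_re_of_pos hs0]
      have hq : 0 < 1 - s / c := by rw [sub_pos, div_lt_one hc0]; exact hsc.2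
      have e1 : (1 : ℂ) - (s / c : ℝ) = ((1 - s / c : ℝ) : ℂ) := by push_cast; ring
      rw [e1, norm_cpow_eq_rpow_re_of_pos hq]
      simp only [sub_re, one_re, add_re, ofReal_re, natCast_re]
      have hle : (1 - s / c) ^ (c + d - b.re - 1) ≤ Real.exp (-(1 / 2) * s) := by
        have h1 : 1 - s / c ≤ Real.exp (-(s / c)) := by
          have := Real.add_one_le_exp (-(s / c)); linarith
        have hexp : c / 2 ≤ c + d - b.re - 1 := by
          have : (0 : ℝ) ≤ d := Nat.cast_nonneg d
          linarith
        calc (1 - s / c) ^ (c + d - b.re - 1)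
            ≤ Real.exp (-(s / c)) ^ (c + d - b.re - 1) :=
              Real.rpow_le_rpow hq.le h1 (by linarith)
          _ = Real.exp (-(s / c) * (c + d - b.re - 1)) := by rw [← Real.exp_mul]
          _ ≤ Real.exp (-(1 / 2) * s) := by
            refine Real.exp_le_exp.2 ?_
            have : s / c * (c / 2) ≤ s / c * (c + d - b.re - 1) :=
              mul_le_mul_of_nonneg_left hexp (by positivity)
            have e : s / c * (c / 2) = s / 2 := by field_simp
            linarith
      calc s ^ (b.re - 1) * (1 - s / c) ^ (c + d - b.re - 1) * ‖(1 - w * s) ^ (-a)‖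
          ≤ s ^ (b.re - 1) * Real.exp (-(1 / 2) * s) * (C * Real.exp (1 / 4 * s)) := by
            gcongr
            exact hK s hs0.le
        _ = C * (s ^ (b.re - 1) * (Real.exp (-(1 / 2) * s) * Real.exp (1 / 4 * s))) := by ring
        _ = _ := by rw [← Real.exp_add]; ring_nf
    · rw [indicator_of_notMem hsc, norm_zero]
      positivity
  · exact (integrableOn_rpow_mul_exp_neg_mul hb (by norm_num)).const_mul C
  · rw [ae_restrict_iff' measurableSet_Ioi]
    refine Eventually.of_forall fun s hs => ?_
    have hs0 : (0 : ℝ) < s := hs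
    have hlim1 : Tendsto (fun c : ℝ => c * Real.log (1 + -s / c)) atTop (𝓝 (-s)) :=
      Real.tendsto_mul_log_one_add_div_atTop (-s)
    have hlim0 : Tendsto (fun c : ℝ => Real.log (1 + -s / c)) atTop (𝓝 0) := by
      have h1 : Tendsto (fun c : ℝ => 1 + -s / c) atTop (𝓝 1) := by
        simpa using (tendsto_const_nhds (x := -s)).div_atTop tendsto_id |>.const_add 1
      simpa using h1.log one_ne_zero
    have hlimC : Tendsto (fun c : ℝ => exp (((c * Real.log (1 + -s / c) : ℝ) : ℂ) +
        ((Real.log (1 + -s / c) : ℝ) : ℂ) * (d - b - 1))) atTop (𝓝 (exp (-s))) := by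
      have h1 := (continuous_ofReal.tendsto _).comp hlim1
      have h0 := ((continuous_ofReal.tendsto _).comp hlim0).mul_const ((d : ℂ) - b - 1)
      have := (h1.add h0).cexp
      simpa using this
    have := (hlimC.const_mul ((s : ℂ) ^ (b - 1))).mul_const ((1 - w * s) ^ (-a))
    refine this.congr' ?_
    filter_upwards [eventually_gt_atTop s] with c hc
    have hc0 : 0 < c := hs0.trans hc
    have hq : 0 < 1 - s / c := by rw [sub_pos, div_lt_one hc0]; exact hc
    have e1 : (1 : ℂ) - (s / c : ℝ) = ((1 - s / c : ℝ) : ℂ) := by push_cast; ring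
    rw [indicator_of_mem (show s ∈ Ioo (0 : ℝ) c from ⟨hs0, hc⟩), scaledEulerIntegrand, e1,
      cpow_def_of_ne_zero (ofReal_ne_zero.2 hq.ne'), ← ofReal_log hq.le]
    congr 3
    rw [neg_div, ← sub_eq_add_neg]
    push_cast
    ring

theorem integral_euler_eq_scaled (a b w : ℂ) (d : ℕ) {c : ℝ} (hc : 0 < c) :
    ∫ t in Ioo (0 : ℝ) 1, (t : ℂ) ^ (b - 1) * (1 - (t : ℂ)) ^ (((c + d : ℝ) : ℂ) - b - 1) *
        (1 - (c : ℂ) * w * t) ^ (-a) =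
      (c : ℂ)⁻¹ * ((c : ℂ)⁻¹) ^ (b - 1) *
        ∫ s in Ioo (0 : ℝ) c, scaledEulerIntegrand a b w d c s := by
  have himg : (fun s : ℝ => s / c) '' Ioo 0 c = Ioo 0 1 := by
    ext x
    constructor
    · rintro ⟨s, hs, rfl⟩
      exact ⟨div_pos hs.1 hc, (div_lt_one hc).2 hs.2⟩
    · intro hx
      refine ⟨x * c, ⟨mul_pos hx.1 hc, ?_⟩, by field_simp⟩
      nlinarith [hx.2]
  rw [← himg, integral_image_eq_integral_abs_deriv_smul (f := fun s : ℝ => s / c) (f' := fun _ => 1 / c) measurableSet_Ioo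
    (fun s _ => ((hasDerivAt_id s).div_const c).hasDerivWithinAt)
    (fun x _ y _ hxy => (div_left_inj' hc.ne').1 hxy), ← integral_const_mul]
  refine setIntegral_congr_fun measurableSet_Ioo fun s hs => ?_
  have hcc : (c : ℂ) ≠ 0 := ofReal_ne_zero.2 hc.ne'
  have e : ((s / c : ℝ) : ℂ) ^ (b - 1) = (s : ℂ) ^ (b - 1) * ((c : ℂ)⁻¹) ^ (b - 1) := by
    rw [ofReal_div, div_eq_mul_inv, ofReal_mul_cpow hs.1 (inv_ne_zero hcc)]
  have e2 : (1 : ℂ) - c * w * (s / c : ℝ) = 1 - w * s := by push_cast; field_simp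
  simp only [real_smul, scaledEulerIntegrand]
  rw [abs_of_pos (by positivity), e, e2]
  push_cast
  rw [one_div]
  ring

theorem mul_mem_gaussDomain {w : ℂ} (hw : -w ∈ slitPlane) {c : ℝ} (hc : 0 ≤ c) :
    1 - (c : ℂ) * w ∈ slitPlane := by
  rw [mul_comm]; exact one_sub_mul_mem_slitPlane_of_nonneg hw hc

/-- ₂F₁ is a quotient of two rescaled Euler integrals. The denominator is the case a = 0 of the
numerator, and its limit is Γ(b). -/
theorem tendsto_gaussF_of_re_pos {w : ℂ} (hw : -w ∈ slitPlane) (a : ℂ) {b : ℂ} (hb : 0 < b.re)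
    (d : ℕ) : Tendsto (fun c : ℝ => gaussF a b ((c + d : ℝ) : ℂ) ((c : ℂ) * w)) atTop
      (𝓝 ((∫ s in Ioi (0 : ℝ), laplaceIntegrand a b w s) / Gamma b)) := by
  have h0 : ∫ s in Ioi (0 : ℝ), laplaceIntegrand 0 b w s = Gamma b := by
    rw [Gamma_eq_integral hb, GammaIntegral]
    refine integral_congr_ae (Eventually.of_forall fun s => ?_)
    simp only [laplaceIntegrand, neg_zero, cpow_zero, mul_one]
    push_cast
    ring
  have hlim := (tendsto_integral_scaledEulerIntegrand hw a hb d).div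
    (tendsto_integral_scaledEulerIntegrand hw 0 hb d)
    (by rw [h0]; exact Gamma_ne_zero_of_re_pos hb)
  rw [h0] at hlim
  refine hlim.congr' ?_
  filter_upwards [eventually_gt_atTop b.re] with c hc
  have hc0 : 0 < c := hb.trans hc
  have hcd : b.re < c + d := by
    have : (0 : ℝ) ≤ d := Nat.cast_nonneg d
    linarith
  rw [gaussF_eq_eulerGauss a hb hcd (mul_mem_gaussDomain hw hc0.le), eulerGauss,
    integral_euler_eq_scaled a b w d hc0]
  have e := integral_euler_eq_scaled 0 b w d hc0
  simp only [neg_zero, cpow_zero, mul_one] at e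
  rw [e, mul_div_mul_left]
  · simp
  have hcc : (c : ℂ)⁻¹ ≠ 0 := inv_ne_zero (ofReal_ne_zero.2 hc0.ne')
  exact mul_ne_zero hcc (by simp [cpow_eq_zero_iff, hcc])

/-- The limit c → ∞ in `gaussF_recursion` at the argument z = c w, where z (1 - z) / ((c+d)(c+d+1))
→ -w² and z / (c+d) → w. -/
theorem tendsto_gaussF_recursion {a b w L₁ L₂ : ℂ} (hw : -w ∈ slitPlane) {d : ℕ}
    (h₁ : Tendsto (fun c : ℝ => gaussF (a + 1) (b + 1) ((c + (d + 1 : ℕ) : ℝ) : ℂ) ((c : ℂ) * w))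
      atTop (𝓝 L₁))
    (h₂ : Tendsto (fun c : ℝ => gaussF (a + 2) (b + 2) ((c + (d + 2 : ℕ) : ℝ) : ℂ) ((c : ℂ) * w))
      atTop (𝓝 L₂)) :
    Tendsto (fun c : ℝ => gaussF a b ((c + d : ℝ) : ℂ) ((c : ℂ) * w)) atTop
      (𝓝 (-w ^ 2 * ((a + 1) * (b + 1)) * L₂ + (1 - (a + b + 1) * w) * L₁)) := by
  have hinv : Tendsto (fun c : ℝ => ((c : ℂ))⁻¹) atTop (𝓝 0) := by
    have := (continuous_ofReal.tendsto 0).comp (tendsto_inv_atTop_zero (𝕜 := ℝ))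
    simpa [Function.comp_def] using this
  have hq : ∀ k : ℂ, Tendsto (fun c : ℝ => (1 + k * (c : ℂ)⁻¹)⁻¹) atTop (𝓝 1) := fun k => by
    have : Tendsto (fun c : ℝ => (1 + k * (c : ℂ)⁻¹)) atTop (𝓝 1) := by
      simpa using (hinv.const_mul k).const_add 1
    simpa using this.inv₀ one_ne_zero
  have hA : Tendsto (fun c : ℝ => w * ((c : ℂ)⁻¹ - w) * ((a + 1) * (b + 1) *
      ((1 + d * (c : ℂ)⁻¹)⁻¹ * (1 + (d + 1) * (c : ℂ)⁻¹)⁻¹))) atTop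
      (𝓝 (w * (0 - w) * ((a + 1) * (b + 1) * (1 * 1)))) :=
    ((hinv.sub_const w).const_mul w).mul (((hq d).mul (hq (d + 1))).const_mul _)
  have hB : Tendsto (fun c : ℝ => 1 - (a + b + 1) * w * (1 + d * (c : ℂ)⁻¹)⁻¹) atTop
      (𝓝 (1 - (a + b + 1) * w * 1)) := ((hq d).const_mul _).const_sub 1
  have hlim := (hA.mul h₂).add (hB.mul h₁)
  rw [show w * (0 - w) * ((a + 1) * (b + 1) * (1 * 1)) = -w ^ 2 * ((a + 1) * (b + 1)) by ring,
    mul_one] at hlim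
  refine hlim.congr' ?_
  filter_upwards [eventually_gt_atTop b.re, eventually_gt_atTop 0] with c hc hc0
  have hd : (0 : ℝ) ≤ d := Nat.cast_nonneg d
  have hcd : 0 < c + d := by positivity
  rw [gaussF_recursion a b hcd (by linarith) (mul_mem_gaussDomain hw hc0.le)]
  have hcc : (c : ℂ) ≠ 0 := ofReal_ne_zero.2 hc0.ne'
  have hcdc : (c : ℂ) + d ≠ 0 := by exact_mod_cast hcd.ne'
  have hcdc1 : (c : ℂ) + d + 1 ≠ 0 := by exact_mod_cast (by positivity : c + d + 1 ≠ 0)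
  have hcdc1' : (c : ℂ) + (d + 1) ≠ 0 := by rwa [← add_assoc]
  push_cast
  rw [← add_assoc (c : ℂ) (d : ℂ) 1, ← add_assoc (c : ℂ) (d : ℂ) 2]
  have e1 : (1 + d * (c : ℂ)⁻¹)⁻¹ = c / (c + d) := by field_simp
  have e2 : (1 + (d + 1) * (c : ℂ)⁻¹)⁻¹ = c / (c + d + 1) := by field_simp; ring
  rw [e1, e2]
  congr 2 <;> field_simp

/-- One limit L for all shifts d: the induction step for the shift d uses the limits for the shifts
d + 1 and d + 2. -/
theorem exists_tendsto_gaussF {w : ℂ} (hw : -w ∈ slitPlane) (n : ℕ) : ∀ (a b : ℂ),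
    -(n : ℝ) < b.re → ∃ L, ∀ d : ℕ,
      Tendsto (fun c : ℝ => gaussF a b ((c + d : ℝ) : ℂ) ((c : ℂ) * w)) atTop (𝓝 L) := by
  induction n with
  | zero =>
    intro a b hb
    exact ⟨_, tendsto_gaussF_of_re_pos hw a (by simpa using hb)⟩
  | succ n ih =>
    intro a b hb
    push_cast at hb
    obtain ⟨L₁, h₁⟩ := ih (a + 1) (b + 1) (by simp only [add_re, one_re]; linarith)
    obtain ⟨L₂, h₂⟩ := ih (a + 2) (b + 2) (by simp only [add_re, re_ofNat]; linarith)
    exact ⟨_, fun d => tendsto_gaussF_recursion hw (h₁ (d + 1)) (h₂ (d + 2))⟩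

theorem tendsto_gaussF_add_twoFZero {w : ℂ} (hw : -w ∈ slitPlane) (a b : ℂ) (d : ℕ) :
    Tendsto (fun c : ℝ => gaussF a b ((c + d : ℝ) : ℂ) ((c : ℂ) * w)) atTop
      (𝓝 (twoFZero a b w)) := by
  obtain ⟨n, hn⟩ := exists_nat_gt (-b.re)
  obtain ⟨L, hL⟩ := exists_tendsto_gaussF hw n a b (by linarith)
  have h0 : twoFZero a b w = L := by
    have := hL 0
    simp only [Nat.cast_zero, add_zero] at this
    exact this.limUnder_eq
  rw [h0]
  exact hL d

theorem tendsto_gaussF_twoFZero {w : ℂ} (hw : -w ∈ slitPlane) (a b : ℂ) :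
    Tendsto (fun c : ℝ => gaussF a b (c : ℂ) ((c : ℂ) * w)) atTop (𝓝 (twoFZero a b w)) := by
  simpa using tendsto_gaussF_add_twoFZero hw a b 0

theorem twoFZero_symm (a b w : ℂ) : twoFZero a b w = twoFZero b a w := by
  simp only [twoFZero, gaussF_symm a b]

theorem integral_laplaceIntegrand {w : ℂ} (hw : -w ∈ slitPlane) (a : ℂ) {b : ℂ} (hb : 0 < b.re) :
    ∫ s in Ioi (0 : ℝ), laplaceIntegrand a b w s = Gamma b * twoFZero a b w := by
  have h := tendsto_gaussF_of_re_pos hw a hb 0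
  rw [tendsto_nhds_unique (tendsto_gaussF_add_twoFZero hw a b 0) h,
    mul_div_cancel₀ _ (Gamma_ne_zero_of_re_pos hb)]

theorem twoFZero_recursion {w : ℂ} (hw : -w ∈ slitPlane) (a b : ℂ) :
    twoFZero a b w = -w ^ 2 * ((a + 1) * (b + 1)) * twoFZero (a + 2) (b + 2) w +
      (1 - (a + b + 1) * w) * twoFZero (a + 1) (b + 1) w :=
  tendsto_nhds_unique (tendsto_gaussF_add_twoFZero hw a b 0)
    (tendsto_gaussF_recursion hw (tendsto_gaussF_add_twoFZero hw _ _ (0 + 1))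
      (tendsto_gaussF_add_twoFZero hw _ _ (0 + 2)))

theorem hasDerivAt_twoFZero_of_re_pos {w : ℂ} (hw : -w ∈ slitPlane) (a : ℂ) {b : ℂ}
    (hb : 0 < b.re) :
    HasDerivAt (twoFZero a b) (a * b * twoFZero (a + 1) (b + 1) w) w := by
  obtain ⟨r, hr, C, h⟩ := exists_norm_laplaceIntegrand_le hw a b
  have hderiv : ∀ s ∈ Ioi (0 : ℝ), ∀ z ∈ Metric.ball w r,
      HasDerivAt (fun z => laplaceIntegrand a b z s) (a * laplaceIntegrand (a + 1) (b + 1) z s) z := by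
    intro s hs z hz
    have hslit := one_sub_mul_mem_slitPlane_of_nonneg (h z hz).1 (le_of_lt hs)
    have hlin : HasDerivAt (fun z : ℂ => 1 - z * s) (-s) z := by
      simpa using ((hasDerivAt_id z).mul_const (s : ℂ)).const_sub 1
    refine ((hlin.cpow_const (c := -a) hslit).const_mul ((s : ℂ) ^ (b - 1) * exp (-s))).congr_deriv ?_
    have hs0 : (s : ℂ) ≠ 0 := ofReal_ne_zero.2 (ne_of_gt hs)
    rw [laplaceIntegrand, show b + 1 - 1 = b - 1 + 1 by ring, cpow_add _ _ hs0, cpow_one,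
      show -(a + 1) = -a - 1 by ring]
    ring
  have key := hasDerivAt_integral_of_dominated_holomorphic (μ := volume.restrict (Ioi (0 : ℝ)))
    (F := fun z s => laplaceIntegrand a b z s) (w := w) (r := r)
    (fun z _ => (measurable_laplaceIntegrand a b z).aestronglyMeasurable)
    (by
      rw [ae_restrict_iff' measurableSet_Ioi]
      exact Eventually.of_forall fun s hs z hz =>
        (hderiv s hs z hz).differentiableAt.differentiableWithinAt)
    (by
      rw [ae_restrict_iff' measurableSet_Ioi]
      exact Eventually.of_forall fun s hs z hz => (h z hz).2 s hs)
    ((integrableOn_rpow_mul_exp_neg_mul hb (k := 1 / 2) (by norm_num)).const_mul C)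
    (Metric.mem_ball_self hr)
  have hint : ∫ s in Ioi (0 : ℝ), deriv (fun z => laplaceIntegrand a b z s) w =
      a * (b * Gamma b * twoFZero (a + 1) (b + 1) w) := by
    have hb0 : b ≠ 0 := by rintro rfl; simp at hb
    rw [← Gamma_add_one b hb0, ← integral_laplaceIntegrand hw (a + 1) (b := b + 1)
      (by simp only [add_re, one_re]; linarith), ← integral_const_mul]
    exact setIntegral_congr_fun measurableSet_Ioi fun s hs =>
      (hderiv s hs w (Metric.mem_ball_self hr)).deriv
  have hG := Gamma_ne_zero_of_re_pos hb
  have h2 := (key.2.div_const (Gamma b)).congr_deriv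
    (g' := a * b * twoFZero (a + 1) (b + 1) w) (by rw [hint]; field_simp)
  refine h2.congr_of_eventuallyEq ?_
  filter_upwards [Metric.ball_mem_nhds w hr] with z hz
  rw [integral_laplaceIntegrand (h z hz).1 a hb, mul_div_cancel_left₀ _ hG]

/-- Descent in Re b from the Laplace integral. Differentiating the recursion for (a, b) gives a
right-hand side which the recursion for (a+1, b+1) reduces to the claimed derivative. -/
theorem hasDerivAt_twoFZero {w : ℂ} (hw : -w ∈ slitPlane) (a b : ℂ) :
    HasDerivAt (twoFZero a b) (a * b * twoFZero (a + 1) (b + 1) w) w := by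
  obtain ⟨n, hn⟩ := exists_nat_gt (-b.re)
  replace hn : -(n : ℝ) < b.re := by linarith
  induction n generalizing a b with
  | zero => exact hasDerivAt_twoFZero_of_re_pos hw a (by simpa using hn)
  | succ n ih =>
    push_cast at hn
    have h₁ := ih (a + 1) (b + 1) (by simp only [add_re, one_re]; linarith)
    have h₂ := ih (a + 2) (b + 2) (by simp only [add_re, re_ofNat]; linarith)
    have hlin : HasDerivAt (fun z : ℂ => 1 - (a + b + 1) * z) (-(a + b + 1)) w := by
      simpa using ((hasDerivAt_id w).const_mul (a + b + 1)).const_sub 1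
    have hsq : HasDerivAt (fun z : ℂ => -z ^ 2 * ((a + 1) * (b + 1)))
        (-(2 * w) * ((a + 1) * (b + 1))) w := by
      simpa using ((hasDerivAt_pow 2 w).neg).mul_const ((a + 1) * (b + 1))
    have hrec := twoFZero_recursion hw (a + 1) (b + 1)
    have hopen : IsOpen {z : ℂ | -z ∈ slitPlane} := isOpen_slitPlane.preimage (by fun_prop)
    refine (((hsq.mul h₂).add (hlin.mul h₁)).congr_of_eventuallyEq ?_).congr_deriv ?_
    · filter_upwards [hopen.mem_nhds hw] with z hz
      exact twoFZero_recursion hz a b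
    · rw [show a + 1 + 1 = a + 2 by ring, show b + 1 + 1 = b + 2 by ring,
        show a + 1 + 2 = a + 2 + 1 by ring, show b + 1 + 2 = b + 2 + 1 by ring] at hrec
      rw [show a + 1 + 1 = a + 2 by ring, show b + 1 + 1 = b + 2 by ring]
      linear_combination -(a + 1) * (b + 1) * hrec

end TwoFZero

/-! ### Tricomi's function -/

section Tricomi

/-- Under the Laplace integral this is (1 - z s)^(-a) = (1 - z s)^(-a-1) (1 - z s), with the extra
factor s raising b to b + 1. -/
theorem twoFZero_add_one_left_of_re_pos {z : ℂ} (hz : -z ∈ slitPlane) (a : ℂ) {b : ℂ}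
    (hb : 0 < b.re) :
    twoFZero (a + 1) b z = twoFZero a b z + b * z * twoFZero (a + 1) (b + 1) z := by
  have hb1 : 0 < (b + 1).re := by simp only [add_re, one_re]; linarith
  have hb0 : b ≠ 0 := by rintro rfl; simp at hb
  have hG := Gamma_ne_zero_of_re_pos hb
  have key : ∫ s in Ioi (0 : ℝ), laplaceIntegrand (a + 1) b z s =
      (∫ s in Ioi (0 : ℝ), laplaceIntegrand a b z s) +
        z * ∫ s in Ioi (0 : ℝ), laplaceIntegrand (a + 1) (b + 1) z s := by
    rw [← integral_const_mul, ← integral_add (integrableOn_laplaceIntegrand hz a hb)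
      ((integrableOn_laplaceIntegrand hz (a + 1) hb1).const_mul z)]
    refine setIntegral_congr_fun measurableSet_Ioi fun s hs => ?_
    have hs0 : (s : ℂ) ≠ 0 := ofReal_ne_zero.2 (ne_of_gt hs)
    have h1 := slitPlane_ne_zero (one_sub_mul_mem_slitPlane_of_nonneg hz (le_of_lt hs))
    have e1 : (1 - z * s) ^ (-a) = (1 - z * s) ^ (-(a + 1)) * (1 - z * s) := by
      nth_rewrite 3 [← cpow_one (1 - z * s)]
      rw [← cpow_add _ _ h1]; ring_nf
    have e2 : (s : ℂ) ^ (b + 1 - 1) = s ^ (b - 1) * s := by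
      nth_rewrite 3 [← cpow_one (s : ℂ)]
      rw [← cpow_add _ _ hs0]; ring_nf
    simp only [laplaceIntegrand, e1, e2]
    ring
  rw [integral_laplaceIntegrand hz _ hb, integral_laplaceIntegrand hz _ hb,
    integral_laplaceIntegrand hz _ hb1, Gamma_add_one b hb0] at key
  apply mul_left_cancel₀ hG
  linear_combination key

theorem twoFZero_add_one_left {z : ℂ} (hz : -z ∈ slitPlane) (a b : ℂ) :
    twoFZero (a + 1) b z = twoFZero a b z + b * z * twoFZero (a + 1) (b + 1) z := by
  obtain ⟨n, hn⟩ := exists_nat_gt (-b.re)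
  replace hn : -(n : ℝ) < b.re := by linarith
  induction n generalizing a b with
  | zero => exact twoFZero_add_one_left_of_re_pos hz a (by simpa using hn)
  | succ n ih =>
    push_cast at hn
    have h₁ := ih (a + 1) (b + 1) (by simp only [add_re, one_re]; linarith)
    have h₂ := ih (a + 2) (b + 2) (by simp only [add_re, re_ofNat]; linarith)
    have r₀ := twoFZero_recursion hz a b
    have r₁ := twoFZero_recursion hz (a + 1) b
    have r₂ := twoFZero_recursion hz (a + 1) (b + 1)
    simp only [add_assoc] at h₁ h₂ r₀ r₁ r₂
    norm_num at h₁ h₂ r₀ r₁ r₂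
    rw [r₁, h₂, h₁, r₀]
    linear_combination (-(b + 1) * z) * r₂

/-- Tricomi's function `w^(-a) ₂F₀(a, b; -; -1/w)`, with `b = a - c + 1`. -/
noncomputable def kummerU (a b w : ℂ) : ℂ := w ^ (-a) * twoFZero a b (-w⁻¹)

theorem inv_mem_slitPlane' {w : ℂ} (hw : w ∈ slitPlane) : w⁻¹ ∈ slitPlane := by
  have h0 := normSq_pos.2 (slitPlane_ne_zero hw)
  rw [mem_slitPlane_iff] at hw ⊢
  rw [inv_re, inv_im]
  rcases hw with h | h
  · exact Or.inl (div_pos h h0)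
  · exact Or.inr (div_ne_zero (neg_ne_zero.2 h) h0.ne')

theorem neg_neg_inv_mem_slitPlane {w : ℂ} (hw : w ∈ slitPlane) : -(-w⁻¹) ∈ slitPlane := by
  rw [neg_neg]; exact inv_mem_slitPlane' hw

/-- The symmetry of ₂F₀ in its two parameters. It shows that U times a power of w serves the
exchanged pair as well. -/
theorem kummerU_swap {w : ℂ} (hw : w ≠ 0) (a b : ℂ) :
    kummerU a b w = w ^ (b - a) * kummerU b a w := by
  rw [kummerU, kummerU, twoFZero_symm a b, ← mul_assoc, ← cpow_add _ _ hw]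
  ring_nf

theorem hasDerivAt_kummerU (a b : ℂ) {w : ℂ} (hw : w ∈ slitPlane) :
    HasDerivAt (kummerU a b) (-a * kummerU (a + 1) b w) w := by
  have hw0 := slitPlane_ne_zero hw
  have hz := neg_neg_inv_mem_slitPlane hw
  have h1 : HasDerivAt (fun z : ℂ => -z⁻¹) ((w ^ 2)⁻¹) w :=
    (hasDerivAt_inv hw0).fun_neg.congr_deriv (neg_neg _)
  have h2 := ((hasDerivAt_id w).cpow_const (c := -a) hw).mul
    ((hasDerivAt_twoFZero hz a b).comp w h1)
  refine h2.congr_deriv ?_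
  have e1 : w ^ (-a) = w ^ (-a - 1) * w := by
    rw [cpow_sub _ _ hw0, cpow_one, div_mul_cancel₀ _ hw0]
  simp only [id_eq, mul_one, Function.comp_apply, kummerU]
  rw [twoFZero_add_one_left hz a b, e1, show -(a + 1) = -a - 1 by ring]
  field_simp
  ring

/-- The contiguity relation in the first parameter of Kummer's equation. -/
theorem kummerU_contiguous (a b : ℂ) {w : ℂ} (hw : w ∈ slitPlane) :
    w * (a + 1) * kummerU (a + 2) b w = (a - b + 1 - w) * kummerU (a + 1) b w + kummerU a b w := by
  have hw0 := slitPlane_ne_zero hw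
  have hz := neg_neg_inv_mem_slitPlane hw
  have e1 : w ^ (-a) = w ^ (-a - 2) * w ^ 2 := by
    rw [cpow_sub _ _ hw0, cpow_ofNat, div_mul_cancel₀ _ (pow_ne_zero 2 hw0)]
  have e2 : w ^ (-(a + 1)) = w ^ (-a - 2) * w := by
    rw [show -(a + 1) = -a - 2 + 1 by ring, cpow_add _ _ hw0, cpow_one]
  have h₁ := twoFZero_add_one_left hz a b
  have h₂ := twoFZero_add_one_left hz (a + 1) b
  have h₃ := twoFZero_add_one_left hz b (a + 1)
  rw [twoFZero_symm (b + 1) (a + 1), twoFZero_symm b, twoFZero_symm (b + 1)] at h₃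
  rw [show a + 1 + 1 = a + 2 by ring] at h₂ h₃
  simp only [kummerU, e1, e2, show -(a + 2) = -a - 2 by ring]
  have hv := mul_inv_cancel₀ hw0
  linear_combination (a + 1) * w * w ^ (-a - 2) * h₂ + w ^ 2 * w ^ (-a - 2) * h₁ -
    b * w * w ^ (-a - 2) * h₃ - w * w ^ (-a - 2) * b * twoFZero (a + 1) (b + 1) (-w⁻¹) * hv

/-- The contiguity relation for equal second parameters of Kummer's equation. -/
theorem kummerU_recursion (a b : ℂ) {w : ℂ} (hw : w ∈ slitPlane) :
    kummerU a b w = -((a + 1) * (b + 1)) * kummerU (a + 2) (b + 2) w +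
      (w + a + b + 1) * kummerU (a + 1) (b + 1) w := by
  have hw0 := slitPlane_ne_zero hw
  have e1 : w ^ (-a) = w ^ (-a - 2) * w ^ 2 := by
    rw [cpow_sub _ _ hw0, cpow_ofNat, div_mul_cancel₀ _ (pow_ne_zero 2 hw0)]
  have e2 : w ^ (-(a + 1)) = w ^ (-a - 2) * w := by
    rw [show -(a + 1) = -a - 2 + 1 by ring, cpow_add _ _ hw0, cpow_one]
  simp only [kummerU, e1, e2, show -(a + 2) = -a - 2 by ring]
  rw [twoFZero_recursion (neg_neg_inv_mem_slitPlane hw) a b]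
  field_simp
  ring

/-- Differentiation raises a and leaves b fixed, so the equation becomes a three-term relation in a,
namely -a times `kummerU_contiguous`. -/
theorem solvesKummerAt_kummerU (a b : ℂ) {w : ℂ} (hw : w ∈ slitPlane) :
    SolvesKummerAt a (a - b + 1) (kummerU a b) w := by
  have hev : ∀ᶠ z in 𝓝 w, z ∈ slitPlane := isOpen_slitPlane.mem_nhds hw
  refine ⟨analyticAt_iff_eventually_differentiableAt.2 (hev.mono fun z hz =>
    (hasDerivAt_kummerU a b hz).differentiableAt), ?_⟩
  rw [kummerOp_eq_of_hasDerivAt (hev.mono fun z hz => hasDerivAt_kummerU a b hz)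
    ((hasDerivAt_kummerU (a + 1) b hw).const_mul (-a))]
  have h := kummerU_contiguous a b hw
  rw [show a + 1 + 1 = a + 2 by ring]
  linear_combination a * h

/-- Kummer's transformation of solutions. -/
theorem SolvesKummerAt.exp_mul_comp_neg {a c : ℂ} {f : ℂ → ℂ} {w : ℂ}
    (h : SolvesKummerAt (c - a) c f (-w)) :
    SolvesKummerAt a c (fun z => exp z * f (-z)) w := by
  have hneg : ∀ {g : ℂ → ℂ} {z : ℂ}, AnalyticAt ℂ g (-z) →
      HasDerivAt (fun z => g (-z)) (-deriv g (-z)) z := fun {g z} hg => by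
    simpa [Function.comp_def] using hg.differentiableAt.hasDerivAt.comp z (hasDerivAt_neg z)
  have hev : ∀ᶠ z in 𝓝 w, AnalyticAt ℂ f (-z) :=
    (continuous_neg.tendsto w).eventually h.1.eventually_analyticAt
  have h1 : ∀ z, AnalyticAt ℂ f (-z) → HasDerivAt (fun z => exp z * f (-z))
      (exp z * (f (-z) - deriv f (-z))) z := fun z hz =>
    ((hasDerivAt_exp z).mul (hneg hz)).congr_deriv (by ring)
  have h2 := (hasDerivAt_exp w).mul ((hneg h.1).fun_sub (hneg h.1.deriv))
  refine ⟨analyticAt_iff_eventually_differentiableAt.2 (hev.mono fun z hz =>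
    (h1 z hz).differentiableAt), ?_⟩
  rw [kummerOp_eq_of_hasDerivAt (hev.mono fun z hz => h1 z hz) h2]
  have := h.2
  rw [kummerOp] at this
  linear_combination (-exp w) * this

theorem solvesKummerAt_cpow_mul_FTilde (θ α : ℂ) {w : ℂ} (hw : w ∈ slitPlane) :
    SolvesKummerAt ((1 + α + θ) / 2) (1 + α)
      (fun z => z ^ ((-1 - θ - α) / 2) * FTilde θ α (-z⁻¹)) w := by
  have h := solvesKummerAt_kummerU ((1 + α + θ) / 2) ((1 - α + θ) / 2) hw
  have e : kummerU ((1 + α + θ) / 2) ((1 - α + θ) / 2) =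
      fun z => z ^ ((-1 - θ - α) / 2) * FTilde θ α (-z⁻¹) := by
    funext z
    rw [kummerU, FTilde]
    ring_nf
  rw [e] at h
  convert h using 1
  ring

theorem solvesKummerAt_exp_mul_cpow_mul_FTilde (θ α : ℂ) {w : ℂ} (hw : -w ∈ slitPlane) :
    SolvesKummerAt ((1 + α + θ) / 2) (1 + α)
      (fun z => exp z * (-z) ^ ((-1 + θ - α) / 2) * FTilde (-θ) α z⁻¹) w := by
  have h := solvesKummerAt_cpow_mul_FTilde (-θ) α hw
  rw [show (1 + α + -θ) / 2 = 1 + α - (1 + α + θ) / 2 by ring] at h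
  convert h.exp_mul_comp_neg using 2 with z
  rw [inv_neg, neg_neg, mul_assoc]
  ring_nf

end Tricomi

/-! ### Laplace integrals of Tricomi's function -/

section LaplaceTricomi

/-- Powers of `w + x` with `x ≥ 0`. -/
theorem add_ofReal_cpow {w : ℂ} (hw : w ∈ slitPlane) {x : ℝ} (hx : 0 ≤ x) (s : ℂ) :
    (w + x) ^ s = w ^ s * (1 - -w⁻¹ * x) ^ s := by
  have hw0 := slitPlane_ne_zero hw
  have h1 := one_sub_mul_mem_slitPlane_of_nonneg (neg_neg_inv_mem_slitPlane hw) hx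
  have h10 := slitPlane_ne_zero h1
  have e : w + x = w * (1 - -w⁻¹ * x) := by field_simp; ring
  have him : (1 - -w⁻¹ * x).im = -(w.im * (x / normSq w)) := by
    simp only [neg_mul, sub_neg_eq_add, add_im, one_im, mul_im, ofReal_re, ofReal_im, inv_im]
    ring
  have hxn : 0 ≤ x / normSq w := div_nonneg hx (normSq_nonneg w)
  -- The imaginary parts of w and 1 + x/w never have the same sign, so the arguments do not add up
  -- beyond ]-π, π] and the logarithm of the product splits.
  have harg : arg w + arg (1 - -w⁻¹ * x) ∈ Ioc (-Real.pi) Real.pi := by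
    have b1 := neg_pi_lt_arg w
    have b2 := neg_pi_lt_arg (1 - -w⁻¹ * x)
    have b3 := arg_le_pi w
    have b4 := arg_le_pi (1 - -w⁻¹ * x)
    rcases lt_trichotomy w.im 0 with h | h | h
    · have c1 := arg_neg_iff.2 h
      have c2 : 0 ≤ arg (1 - -w⁻¹ * x) := arg_nonneg_iff.2 (by rw [him]; nlinarith)
      constructor <;> linarith
    · have hre : 0 < w.re := by simpa [mem_slitPlane_iff, h] using hw
      rw [arg_eq_zero_iff.2 ⟨hre.le, h⟩, zero_add]
      exact ⟨b2, b4⟩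
    · have c1 := arg_nonneg_iff.2 h.le
      rcases hxn.eq_or_lt with h0 | h0
      · have c2 : 1 - -w⁻¹ * x = 1 := by
          have hx0 : x = 0 := by
            rcases div_eq_zero_iff.1 h0.symm with h' | h'
            · exact h'
            · exact absurd (normSq_eq_zero.1 h') hw0
          simp [hx0]
        rw [c2, arg_one, add_zero]
        exact ⟨b1, b3⟩
      · have c2 : arg (1 - -w⁻¹ * x) < 0 := arg_neg_iff.2 (by rw [him]; nlinarith)
        constructor <;> linarith
  rw [e, cpow_def_of_ne_zero (mul_ne_zero hw0 h10), log_mul hw0 h10 harg,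
    cpow_def_of_ne_zero hw0, cpow_def_of_ne_zero h10, ← exp_add, add_mul]

theorem hasIntegralOn_laplace_kummerU (a : ℂ) {b w : ℂ} (hb : 0 < b.re) (hw : w ∈ slitPlane) :
    HasIntegralOn (fun x : ℝ => (x : ℂ) ^ (b - 1) * exp (-x) * (w + x) ^ (-a)) (Ioi 0)
      (Gamma b * kummerU a b w) := by
  have hz := neg_neg_inv_mem_slitPlane hw
  have key : HasIntegralOn (laplaceIntegrand a b (-w⁻¹)) (Ioi 0) (Gamma b * twoFZero a b (-w⁻¹)) :=
    ⟨integrableOn_laplaceIntegrand hz a hb, integral_laplaceIntegrand hz a hb⟩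
  have e : Gamma b * kummerU a b w = w ^ (-a) * (Gamma b * twoFZero a b (-w⁻¹)) := by
    rw [kummerU]; ring
  rw [e]
  refine (key.const_mul (w ^ (-a))).congr measurableSet_Ioi fun x hx => ?_
  rw [add_ofReal_cpow hw (le_of_lt hx), laplaceIntegrand]
  ring

theorem hasIntegralOn_Iio_zero_typeA {θ α w : ℂ} (h : 0 < (1 + θ - α).re) (hw : w ∈ slitPlane) :
    HasIntegralOn (fun t : ℝ => (-(t : ℂ)) ^ ((-1 + θ - α) / 2) * exp t *
      (w - t) ^ ((-1 - θ - α) / 2)) (Iio 0)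
      (w ^ ((-1 - θ - α) / 2) * FTildeI θ α (-w⁻¹)) := by
  have hb : 0 < ((1 - α + θ) / 2).re := by
    simp only [add_re, one_re, sub_re, div_ofNat_re] at h ⊢; linarith
  have key := hasIntegralOn_laplace_kummerU ((1 + α + θ) / 2) hb hw
  rw [hasIntegralOn_neg_iff]
  have e : w ^ ((-1 - θ - α) / 2) * FTildeI θ α (-w⁻¹) =
      Gamma ((1 - α + θ) / 2) * kummerU ((1 + α + θ) / 2) ((1 - α + θ) / 2) w := by
    rw [kummerU, FTildeI, FTilde]; ring_nf
  rw [e]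
  refine key.congr measurableSet_Ioi fun x _ => ?_
  push_cast
  rw [neg_neg, sub_neg_eq_add]
  ring_nf

/-- Translation by w moves the end of the contour to 0 and produces e^w. What remains is the
integral over ]-∞,0] with θ and w replaced by -θ and -w. -/
theorem hasIntegralOn_Iio_zero_translate {θ α w : ℂ} (h : 0 < (1 - θ - α).re)
    (hw : -w ∈ slitPlane) :
    HasIntegralOn (fun x : ℝ => (-(w + x)) ^ ((-1 + θ - α) / 2) * exp (w + x) *
      (w - (w + x)) ^ ((-1 - θ - α) / 2)) (Iio 0)
      (exp w * (-w) ^ ((-1 + θ - α) / 2) * FTildeI (-θ) α w⁻¹) := by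
  have key := (hasIntegralOn_Iio_zero_typeA (θ := -θ) (α := α) (by rwa [← sub_eq_add_neg]) hw).const_mul
    (exp w)
  have e : exp w * (-w) ^ ((-1 + θ - α) / 2) * FTildeI (-θ) α w⁻¹ =
      exp w * ((-w) ^ ((-1 - -θ - α) / 2) * FTildeI (-θ) α (-(-w)⁻¹)) := by
    rw [inv_neg, neg_neg]; ring_nf
  rw [e]
  refine key.congr measurableSet_Iio fun x _ => ?_
  rw [exp_add, sub_add_cancel_left, neg_add]
  ring_nf

/-- The other Laplace integral, with the roles of a and b exchanged by the symmetry of ₂F₀. For r >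
0 the substitution s = r u stays on the half-line. -/
theorem hasIntegralOn_laplace_ofReal {a : ℂ} (b : ℂ) (ha : 0 < a.re) {r : ℝ} (hr : 0 < r) :
    HasIntegralOn (fun u : ℝ => exp (-r * u) * ((u : ℂ) ^ (a - 1) * (1 + (u : ℂ)) ^ (-b))) (Ioi 0)
      (Gamma a * kummerU a b r) := by
  have hrs : (r : ℂ) ∈ slitPlane := ofReal_mem_slitPlane.2 hr
  have hz := neg_neg_inv_mem_slitPlane hrs
  have key : HasIntegralOn (laplaceIntegrand b a (-(r : ℂ)⁻¹)) ((fun u => r * u) '' Ioi 0)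
      (Gamma a * twoFZero b a (-(r : ℂ)⁻¹)) := by
    rw [image_mul_left_Ioi hr, mul_zero]
    exact ⟨integrableOn_laplaceIntegrand hz b ha, integral_laplaceIntegrand hz b ha⟩
  rw [hasIntegralOn_image_iff (φ' := fun _ => r) measurableSet_Ioi
    (fun x _ => by simpa using (hasDerivAt_id x).const_mul r)
    (fun x _ y _ hxy => mul_left_cancel₀ hr.ne' hxy)] at key
  have e : Gamma a * kummerU a b r = (r : ℂ) ^ (-a) * (Gamma a * twoFZero b a (-(r : ℂ)⁻¹)) := by
    rw [kummerU, twoFZero_symm]; ring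
  rw [e]
  refine (key.const_mul ((r : ℂ) ^ (-a))).congr measurableSet_Ioi fun u hu => ?_
  have hr0 : (r : ℂ) ≠ 0 := ofReal_ne_zero.2 hr.ne'
  have e1 : (r : ℂ) ^ (-a) * r * r ^ (a - 1) = 1 := by
    nth_rewrite 2 [← cpow_one (r : ℂ)]
    rw [← cpow_add _ _ hr0, ← cpow_add _ _ hr0]; simp
  have e2 : (1 : ℂ) - -(r : ℂ)⁻¹ * (r * u : ℝ) = 1 + u := by push_cast; field_simp; ring
  rw [abs_of_pos hr, laplaceIntegrand, e2, ofReal_mul,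
    ofReal_mul_cpow hr (ofReal_ne_zero.2 (ne_of_gt hu))]
  rw [neg_mul]
  linear_combination -(exp (-(r * u)) * ((u : ℂ) ^ (a - 1) * (1 + (u : ℂ)) ^ (-b))) * e1

theorem exists_norm_laplace_le {w : ℂ} (hw : 0 < w.re) (a b : ℂ) :
    ∃ C : ℝ, ∀ z ∈ Metric.ball w (w.re / 2), ∀ u ∈ Ioi (0 : ℝ),
      ‖exp (-z * u) * ((u : ℂ) ^ (a - 1) * (1 + (u : ℂ)) ^ (-b))‖ ≤
        C * (u ^ (a.re - 1) * Real.exp (-(w.re / 4) * u)) := by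
  obtain ⟨C, hC, hCs⟩ := rpow_one_add_le_exp (-b.re) (ε := w.re / 4) (by positivity)
  refine ⟨C, fun z hz u hu => ?_⟩
  have hu0 : (0 : ℝ) < u := hu
  have hz' : w.re / 2 ≤ z.re := by
    rw [mem_ball_iff_norm] at hz
    have := (abs_re_le_norm (z - w)).trans hz.le
    rw [sub_re, abs_le] at this
    linarith
  have h1u : (0 : ℝ) < 1 + u := by positivity
  rw [norm_mul, norm_mul, norm_cpow_eq_rpow_re_of_pos hu0, norm_exp,
    show (1 : ℂ) + u = ((1 + u : ℝ) : ℂ) by push_cast; rfl, norm_cpow_eq_rpow_re_of_pos h1u]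
  have e : (-z * u).re = -z.re * u := by simp
  have h3 : Real.exp (-z.re * u) ≤ Real.exp (-(w.re / 2) * u) :=
    Real.exp_le_exp.2 (by nlinarith)
  have hpow : 0 ≤ u ^ (a.re - 1) := Real.rpow_nonneg hu0.le _
  simp only [e, sub_re, one_re, neg_re]
  calc Real.exp (-z.re * u) * (u ^ (a.re - 1) * (1 + u) ^ (-b.re))
      ≤ Real.exp (-(w.re / 2) * u) * (u ^ (a.re - 1) * (C * Real.exp (w.re / 4 * u))) := by
        gcongr; exact hCs u hu0.le
    _ = C * (u ^ (a.re - 1) * (Real.exp (-(w.re / 2) * u) * Real.exp (w.re / 4 * u))) := by ring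
    _ = _ := by rw [← Real.exp_add]; ring_nf

/-- Both sides are holomorphic for Re w > 0 and agree on the positive half-line, so the identity
theorem replaces a rotation of the ray. -/
theorem hasIntegralOn_laplace {a b w : ℂ} (ha : 0 < a.re) (hw : 0 < w.re) :
    HasIntegralOn (fun u : ℝ => exp (-w * u) * ((u : ℂ) ^ (a - 1) * (1 + (u : ℂ)) ^ (-b))) (Ioi 0)
      (Gamma a * kummerU a b w) := by
  set F : ℂ → ℝ → ℂ := fun z u => exp (-z * u) * ((u : ℂ) ^ (a - 1) * (1 + (u : ℂ)) ^ (-b)) with hF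
  have hmeas : ∀ z, AEStronglyMeasurable (F z) (volume.restrict (Ioi 0)) := fun z =>
    (by simp only [hF]; fun_prop : Measurable (F z)).aestronglyMeasurable
  have hbi : ∀ {w : ℂ}, 0 < w.re → ∀ C : ℝ, IntegrableOn
      (fun u => C * (u ^ (a.re - 1) * Real.exp (-(w.re / 4) * u))) (Ioi 0) := fun hw C =>
    (integrableOn_rpow_mul_exp_neg_mul ha (by positivity)).const_mul C
  have hint : IntegrableOn (F w) (Ioi 0) := by
    obtain ⟨C, hC⟩ := exists_norm_laplace_le hw a b
    refine (hbi hw C).mono' (hmeas w) ?_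
    rw [ae_restrict_iff' measurableSet_Ioi]
    exact Eventually.of_forall (hC w (Metric.mem_ball_self (by positivity)))
  refine ⟨hint, ?_⟩
  have han : AnalyticOnNhd ℂ (fun z => ∫ u in Ioi (0 : ℝ), F z u) {z | 0 < z.re} := by
    intro z hz
    have hz0 : 0 < z.re := hz
    obtain ⟨C, hC⟩ := exists_norm_laplace_le hz0 a b
    refine analyticAt_integral_of_dominated_holomorphic (r := z.re / 2) (by positivity)
      (fun v _ => hmeas v) (Eventually.of_forall fun u => ?_) ?_ (hbi hz0 C)
    · simp only [hF]; fun_prop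
    · rw [ae_restrict_iff' measurableSet_Ioi]
      exact Eventually.of_forall fun u hu v hv => hC v hv u hu
  have han2 : AnalyticOnNhd ℂ (fun z => Gamma a * kummerU a b z) {z | 0 < z.re} := fun z hz =>
    analyticAt_const.mul (solvesKummerAt_kummerU a b (Or.inl hz)).1
  have hconv : IsPreconnected {z : ℂ | 0 < z.re} := (convex_halfSpace_re_gt 0).isPreconnected
  refine han.eqOn_of_preconnected_of_frequently_eq han2 hconv (z₀ := 1) (by simp) ?_ hw
  have htend : Tendsto (fun x : ℝ => (x : ℂ)) (𝓝[≠] 1) (𝓝[≠] 1) := by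
    refine tendsto_nhdsWithin_iff.2 ⟨?_, ?_⟩
    · have := (continuous_ofReal.tendsto 1).mono_left (nhdsWithin_le_nhds (s := {1}ᶜ))
      simpa using this
    · filter_upwards [self_mem_nhdsWithin] with x hx
      simpa using hx
  refine htend.frequently (Eventually.frequently ?_)
  filter_upwards [nhdsWithin_le_nhds (Ioi_mem_nhds one_pos)] with x hx
  exact (hasIntegralOn_laplace_ofReal b ha hx).2

theorem hasIntegralOn_Iio_zero_typeB {θ α w : ℂ} (h : 0 < (1 + θ + α).re) (hw : 0 < w.re) :
    HasIntegralOn (fun t : ℝ => exp (w / t) * (-(t : ℂ)) ^ (-1 - α) *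
      (1 - (t : ℂ)) ^ ((-1 - θ + α) / 2)) (Iio 0)
      (w ^ ((-1 - θ - α) / 2) * FTildeI θ (-α) (-w⁻¹)) := by
  have ha : 0 < ((1 + α + θ) / 2).re := by
    simp only [add_re, one_re, div_ofNat_re] at h ⊢; linarith
  have key := hasIntegralOn_laplace (b := (1 - α + θ) / 2) ha hw
  rw [hasIntegralOn_neg_iff]
  have himg : (Inv.inv '' Ioi (0 : ℝ)) = Ioi 0 := by
    rw [image_inv_eq_inv]; ext x; simp
  rw [← himg, hasIntegralOn_inv_iff measurableSet_Ioi subset_rfl]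
  have e : w ^ ((-1 - θ - α) / 2) * FTildeI θ (-α) (-w⁻¹) =
      Gamma ((1 + α + θ) / 2) * kummerU ((1 + α + θ) / 2) ((1 - α + θ) / 2) w := by
    rw [kummerU, FTildeI, FTilde, twoFZero_symm]; ring_nf
  rw [e]
  refine key.congr measurableSet_Ioi fun u hu => ?_
  have hu0 : (0 : ℝ) < u := hu
  have huc : (u : ℂ) ≠ 0 := ofReal_ne_zero.2 hu0.ne'
  have e1 : (1 : ℂ) - (-u⁻¹ : ℝ) = (1 + u : ℝ) * (u : ℂ)⁻¹ := by push_cast; field_simp; ring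
  have e2 : (u : ℂ) ^ ((1 + α + θ) / 2 - 1) =
      ((u : ℂ) ^ 2)⁻¹ * (u : ℂ) ^ (1 + α) * (u : ℂ) ^ (-((-1 - θ + α) / 2)) := by
    rw [← cpow_natCast, ← cpow_neg, ← cpow_add _ _ huc, ← cpow_add _ _ huc]
    push_cast
    ring_nf
  rw [e1, ofReal_mul_cpow (by positivity) (inv_ne_zero huc), ofReal_inv_cpow hu0, e2]
  push_cast
  rw [neg_neg, ofReal_inv_cpow hu0, div_neg, div_inv_eq_mul,
    show -(-1 - α) = 1 + α by ring, show -((1 - α + θ) / 2) = (-1 - θ + α) / 2 by ring, neg_mul]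
  ring

/-- The substitution t = 1/(1+u): then e^(w/t) = e^w e^(w u), and a Laplace integral at -w is left.
-/
theorem hasIntegralOn_Ioo_zero_one_typeB {θ α w : ℂ} (h : 0 < (1 - θ + α).re) (hw : w.re < 0) :
    HasIntegralOn (fun t : ℝ => exp (w / t) * (t : ℂ) ^ (-1 - α) *
      (1 - (t : ℂ)) ^ ((-1 - θ + α) / 2)) (Ioo 0 1)
      (exp w * (-w) ^ ((-1 + θ - α) / 2) * FTildeI (-θ) (-α) w⁻¹) := by
  have ha : 0 < ((1 + α - θ) / 2).re := by
    simp only [add_re, one_re, sub_re, div_ofNat_re] at h ⊢; linarith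
  have key := (hasIntegralOn_laplace (b := (1 - α - θ) / 2) (w := -w) ha
    (by simpa using hw)).const_mul (exp w)
  have himg : ((fun u : ℝ => (1 + u)⁻¹) '' Ioi 0) = Ioo 0 1 := by
    ext x
    constructor
    · rintro ⟨u, hu, rfl⟩
      have hu0 : (0 : ℝ) < u := hu
      exact ⟨by positivity, inv_lt_one_of_one_lt₀ (by linarith)⟩
    · intro hx
      exact ⟨x⁻¹ - 1, sub_pos.2 ((one_lt_inv₀ hx.1).2 hx.2), by simp⟩
  have hd : ∀ u ∈ Ioi (0 : ℝ), HasDerivAt (fun u : ℝ => (1 + u)⁻¹) (-1 / (1 + u) ^ 2) u :=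
    fun u hu => ((hasDerivAt_id u).const_add 1).inv (by simp only [id]; linarith [mem_Ioi.1 hu])
  rw [← himg, hasIntegralOn_image_iff measurableSet_Ioi hd
    (fun x _ y _ hxy => add_left_cancel (inv_injective hxy))]
  have e : exp w * (-w) ^ ((-1 + θ - α) / 2) * FTildeI (-θ) (-α) w⁻¹ = exp w *
      (Gamma ((1 + α - θ) / 2) * kummerU ((1 + α - θ) / 2) ((1 - α - θ) / 2) (-w)) := by
    rw [kummerU, FTildeI, FTilde, twoFZero_symm, inv_neg, neg_neg]; ring_nf
  rw [e]
  refine key.congr measurableSet_Ioi fun u hu => ?_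
  have hu0 : (0 : ℝ) < u := hu
  have h1u : (0 : ℝ) < 1 + u := by positivity
  have huc : (u : ℂ) ≠ 0 := ofReal_ne_zero.2 hu0.ne'
  have h1c : ((1 + u : ℝ) : ℂ) ≠ 0 := ofReal_ne_zero.2 h1u.ne'
  have e0 : ((|(-1 / (1 + u) ^ 2)| : ℝ) : ℂ) = (((1 + u : ℝ) : ℂ) ^ 2)⁻¹ := by
    rw [neg_div, abs_neg, abs_of_pos (by positivity)]; push_cast; rw [one_div]
  have e1 : (1 : ℂ) - ((1 + u : ℝ) : ℂ)⁻¹ = u * ((1 + u : ℝ) : ℂ)⁻¹ := by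
    field_simp; push_cast; ring
  have e2 : ((1 + u : ℝ) : ℂ) ^ (-((1 - α - θ) / 2)) =
      (((1 + u : ℝ) : ℂ) ^ 2)⁻¹ * ((1 + u : ℝ) : ℂ) ^ (1 + α) *
        ((1 + u : ℝ) : ℂ) ^ (-((-1 - θ + α) / 2)) := by
    rw [← cpow_natCast, ← cpow_neg, ← cpow_add _ _ h1c, ← cpow_add _ _ h1c]
    push_cast
    ring_nf
  have e3 : exp (w * ((1 + u : ℝ) : ℂ)) = exp w * exp (w * u) := by
    rw [← exp_add]; push_cast; ring_nf
  rw [e0, ofReal_inv, e1, ofReal_mul_cpow hu0 (inv_ne_zero h1c), ofReal_inv_cpow h1u,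
    ofReal_inv_cpow h1u, div_inv_eq_mul, e3, neg_neg,
    show (1 : ℂ) + u = ((1 + u : ℝ) : ℂ) by push_cast; rfl, e2,
    show (1 + α - θ) / 2 - 1 = (-1 - θ + α) / 2 by ring, show -(-1 - α) = 1 + α by ring]
  ring

end LaplaceTricomi

/-! ### Connection formulas -/

section Connection

theorem Gamma_inv_mul_Gamma_one_sub_inv (z : ℂ) :
    (Gamma z)⁻¹ * (Gamma (1 - z))⁻¹ = sin (Real.pi * z) / Real.pi := by
  rw [← mul_inv, Gamma_mul_Gamma_one_sub, inv_div]

/-- The Wronskian of the two solutions of Kummer's equation at the origin. -/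
theorem kummerBold_wronskian (a b w : ℂ) :
    kummerBold b (b - a) w * kummerBold a (a - b + 1) w -
        kummerBold a (a - b) w * kummerBold b (b - a + 1) w -
        (b - a) * (kummerBold a (a - b + 1) w * kummerBold b (b - a + 1) w) =
      exp w * (sin (Real.pi * (b - a)) / Real.pi) := by
  set D : ℂ → ℂ := fun z => exp (-z) * (kummerBold b (b - a) z * kummerBold a (a - b + 1) z -
    z * (kummerBold b (b - a + 1) z * (a * kummerBold (a + 1) (a - b + 2) z))) with hD
  -- Two forms of the same function. The first gives the value at 0 at once, since its second term
  -- carries the factor z; the second form is the one differentiated.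
  have hE : ∀ z, kummerBold b (b - a) z * kummerBold a (a - b + 1) z -
      z * (kummerBold b (b - a + 1) z * (a * kummerBold (a + 1) (a - b + 2) z)) =
      kummerBold b (b - a) z * kummerBold a (a - b + 1) z -
        kummerBold a (a - b) z * kummerBold b (b - a + 1) z -
        (b - a) * (kummerBold a (a - b + 1) z * kummerBold b (b - a + 1) z) := fun z => by
    have h := kummerBold_eq_add a (a - b) z
    linear_combination (-kummerBold b (b - a + 1) z) * h
  have hderiv : ∀ z, HasDerivAt D 0 z := fun z => by
    have h1 : D = fun z => exp (-z) * (kummerBold b (b - a) z * kummerBold a (a - b + 1) z -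
        kummerBold a (a - b) z * kummerBold b (b - a + 1) z -
        (b - a) * (kummerBold a (a - b + 1) z * kummerBold b (b - a + 1) z)) := by
      funext z; rw [hD]; simp only [hE]
    rw [h1]
    have dM0 := hasDerivAt_kummerBold b (b - a) z
    have dM1 := hasDerivAt_kummerBold b (b - a + 1) z
    have dN0 := hasDerivAt_kummerBold a (a - b) z
    have dN1 := hasDerivAt_kummerBold a (a - b + 1) z
    have h := ((hasDerivAt_neg z).cexp).fun_mul
      (((dM0.fun_mul dN1).fun_sub (dN0.fun_mul dM1)).fun_sub ((dN1.fun_mul dM1).const_mul (b - a)))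
    refine h.congr_deriv ?_
    have r1 := kummerBold_add_one_sub b (b - a) z
    have r2 := kummerBold_add_one_sub a (a - b) z
    have r3 := kummerBold_eq_add b (b - a) z
    have r4 := kummerBold_eq_add a (a - b) z
    rw [show b - a + 1 + 1 = b - a + 2 by ring, show a - b + 1 + 1 = a - b + 2 by ring]
    linear_combination exp (-z) * (kummerBold a (a - b + 1) z * r1 -
      kummerBold b (b - a + 1) z * r2 - a * kummerBold (a + 1) (a - b + 2) z * r3 +
      b * kummerBold (b + 1) (b - a + 2) z * r4)
  have hconst := is_const_of_deriv_eq_zero (fun z => (hderiv z).differentiableAt)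
    (fun z => (hderiv z).deriv) w 0
  have h0 : D 0 = sin (Real.pi * (b - a)) / Real.pi := by
    rw [← Gamma_inv_mul_Gamma_one_sub_inv, show 1 - (b - a) = a - b + 1 by ring]
    simp [hD, kummerBold_zero]
  rw [← hE, ← h0, ← hconst, hD]
  simp only
  rw [← mul_assoc (exp w), ← exp_add, add_neg_cancel, exp_zero, one_mul]

/-- A Wronskian of Tricomi's function and the second solution at the origin. -/
noncomputable def wronskianU (a b w : ℂ) : ℂ :=
  kummerU a b w * kummerBold b (b - a) w +
    a * (w * kummerU (a + 1) b w) * kummerBold b (b - a + 1) w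

/-- `wronskianU` is w^c times the Wronskian of U and w^(1-c) M(b, b-a+1; w), where c = a - b + 1 and
M stands for `kummerBold`. By the Wronskian equation it is a constant multiple of e^w on the
connected slit plane. -/
theorem wronskianU_eq_const (a b : ℂ) {w v : ℂ} (hw : w ∈ slitPlane) (hv : v ∈ slitPlane) :
    exp (-w) * wronskianU a b w = exp (-v) * wronskianU a b v := by
  have hderiv : ∀ z ∈ slitPlane, HasDerivAt (fun z => exp (-z) * wronskianU a b z) 0 z := by
    intro z hz
    have dU0 := hasDerivAt_kummerU a b hz
    have dU1 := hasDerivAt_kummerU (a + 1) b hz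
    have dM0 := hasDerivAt_kummerBold b (b - a) z
    have dM1 := hasDerivAt_kummerBold b (b - a + 1) z
    have h := ((hasDerivAt_neg z).cexp).fun_mul ((dU0.fun_mul dM0).fun_add
      ((((hasDerivAt_id z).fun_mul dU1).const_mul a).fun_mul dM1))
    refine h.congr_deriv ?_
    have r0 := kummerU_contiguous a b hz
    have r1 := kummerBold_add_one_sub b (b - a) z
    have r2 := kummerBold_eq_add b (b - a) z
    rw [show b - a + 1 + 1 = b - a + 2 by ring, show a + 1 + 1 = a + 2 by ring]
    simp only [id]
    linear_combination (-exp (-z) * a * kummerBold b (b - a + 1) z) * r0 +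
      exp (-z) * kummerU a b z * r1 + exp (-z) * a * kummerU (a + 1) b z * r2
  exact isOpen_slitPlane.is_const_of_deriv_eq_zero
    (starConvex_one_slitPlane.isPathConnected one_mem_slitPlane).isConnected.isPreconnected
    (fun z hz => (hderiv z hz).differentiableAt.differentiableWithinAt)
    (fun z hz => (hderiv z hz).deriv) hw hv

/-- Invariance under a ↦ a + 1. It frees the value found near w = 0 from the condition Re a < Re b.
-/
theorem wronskianU_add_one {a b w : ℂ} (hw : w ∈ slitPlane) :
    wronskianU (a + 1) b w = wronskianU a b w := by
  have r0 := kummerU_contiguous a b hw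
  have r1 := kummerBold_add_one_sub b (b - a) w
  have r2 := kummerBold_eq_add b (b - a - 1) w
  rw [show b - a - 1 + 1 = b - a by ring, show b - a - 1 + 2 = b - a + 1 by ring] at r2
  rw [wronskianU, wronskianU, show a + 1 + 1 = a + 2 by ring,
    show b - (a + 1) = b - a - 1 by ring, show b - a - 1 + 1 = b - a by ring]
  linear_combination kummerBold b (b - a) w * r0 - kummerU (a + 1) b w * r2 +
    w * kummerU (a + 1) b w * r1

theorem norm_laplace_bound {a b : ℂ} (ha : 0 ≤ a.re) {x s : ℝ} (hx : 0 < x) (hs : 0 < s) :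
    ‖(s : ℂ) ^ (b - 1) * exp (-s) * ((x : ℂ) + s) ^ (-a)‖ ≤
      s ^ ((b - a).re - 1) * Real.exp (-1 * s) := by
  have e : (x : ℂ) + s = ((x + s : ℝ) : ℂ) := by push_cast; rfl
  rw [e, norm_mul, norm_mul, norm_cpow_eq_rpow_re_of_pos hs, norm_exp,
    norm_cpow_eq_rpow_re_of_pos (by positivity)]
  simp only [sub_re, one_re, neg_re, ofReal_re, neg_mul, one_mul]
  have h1 : (x + s) ^ (-a.re) ≤ s ^ (-a.re) :=
    Real.rpow_le_rpow_of_nonpos hs (by linarith) (by linarith)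
  have h2 : s ^ (b.re - a.re - 1) = s ^ (b.re - 1) * s ^ (-a.re) := by
    rw [← Real.rpow_add hs]; ring_nf
  have h3 : 0 ≤ s ^ (b.re - 1) := Real.rpow_nonneg hs.le _
  rw [h2]
  calc s ^ (b.re - 1) * Real.exp (-s) * (x + s) ^ (-a.re)
      ≤ s ^ (b.re - 1) * Real.exp (-s) * s ^ (-a.re) := by gcongr
    _ = _ := by ring

/-- Letting x → 0+ in the Laplace integral leaves ∫ s^(b-a-1) e^(-s) ds. The condition Re a ≥ 0
gives |(x+s)^(-a)| ≤ s^(-Re a), and Re (b - a) > 0 makes the bound integrable. -/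
theorem tendsto_kummerU_zero {a b : ℂ} (ha : 0 ≤ a.re) (hab : 0 < (b - a).re) :
    Tendsto (fun x : ℝ => kummerU a b x) (𝓝[>] 0) (𝓝 (Gamma (b - a) / Gamma b)) := by
  have hb : 0 < b.re := by rw [sub_re] at hab; linarith
  have hlim : Tendsto (fun x : ℝ => ∫ s in Ioi (0 : ℝ),
      (s : ℂ) ^ (b - 1) * exp (-s) * ((x : ℂ) + s) ^ (-a)) (𝓝[>] 0) (𝓝 (Gamma (b - a))) := by
    rw [Gamma_eq_integral hab, GammaIntegral]
    refine tendsto_integral_filter_of_dominated_convergence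
      (fun s => s ^ ((b - a).re - 1) * Real.exp (-1 * s))
      (Eventually.of_forall fun x => (by fun_prop : Measurable fun s : ℝ =>
        (s : ℂ) ^ (b - 1) * exp (-s) * ((x : ℂ) + s) ^ (-a)).aestronglyMeasurable) ?_
      (integrableOn_rpow_mul_exp_neg_mul hab one_pos) ?_
    · filter_upwards [self_mem_nhdsWithin] with x hx
      rw [ae_restrict_iff' measurableSet_Ioi]
      exact Eventually.of_forall fun s hs => norm_laplace_bound ha hx hs
    · rw [ae_restrict_iff' measurableSet_Ioi]
      refine Eventually.of_forall fun s hs => ?_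
      have hs0 : (0 : ℝ) < s := hs
      have hsc : (s : ℂ) ≠ 0 := ofReal_ne_zero.2 hs0.ne'
      have h1 : Tendsto (fun x : ℝ => ((x : ℂ) + s) ^ (-a)) (𝓝[>] 0) (𝓝 ((s : ℂ) ^ (-a))) := by
        have hc : ContinuousAt (fun x : ℝ => ((x : ℂ) + s) ^ (-a)) 0 :=
          ContinuousAt.cpow (by fun_prop) continuousAt_const (by simpa using hs0)
        have := hc.tendsto.mono_left (nhdsWithin_le_nhds (s := Ioi 0))
        simpa using this
      have e : ((-s : ℝ).exp : ℂ) * (s : ℂ) ^ (b - a - 1) =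
          (s : ℂ) ^ (b - 1) * exp (-s) * (s : ℂ) ^ (-a) := by
        rw [show b - a - 1 = b - 1 + -a by ring, cpow_add _ _ hsc]; push_cast; ring
      rw [e]
      exact h1.const_mul _
  refine (hlim.div_const (Gamma b)).congr' ?_
  filter_upwards [self_mem_nhdsWithin] with x hx
  rw [(hasIntegralOn_laplace_kummerU a hb (ofReal_mem_slitPlane.2 hx)).2,
    mul_div_cancel_left₀ _ (Gamma_ne_zero_of_re_pos hb)]

/-- The prefactor x is absorbed as x/(x+s), which is at most 1 and tends to 0 for fixed s. The bound
used for `tendsto_kummerU_zero` serves again. -/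
theorem tendsto_mul_kummerU_add_one_zero {a b : ℂ} (ha : 0 ≤ a.re) (hab : 0 < (b - a).re) :
    Tendsto (fun x : ℝ => (x : ℂ) * kummerU (a + 1) b x) (𝓝[>] 0) (𝓝 0) := by
  have hb : 0 < b.re := by rw [sub_re] at hab; linarith
  have hlim : Tendsto (fun x : ℝ => ∫ s in Ioi (0 : ℝ),
      (x : ℂ) * ((s : ℂ) ^ (b - 1) * exp (-s) * ((x : ℂ) + s) ^ (-(a + 1)))) (𝓝[>] 0) (𝓝 0) := by
    rw [← integral_zero ℝ ℂ (μ := volume.restrict (Ioi 0))]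
    refine tendsto_integral_filter_of_dominated_convergence
      (fun s => s ^ ((b - a).re - 1) * Real.exp (-1 * s))
      (Eventually.of_forall fun x => (by fun_prop : Measurable fun s : ℝ => (x : ℂ) *
        ((s : ℂ) ^ (b - 1) * exp (-s) * ((x : ℂ) + s) ^ (-(a + 1)))).aestronglyMeasurable) ?_
      (integrableOn_rpow_mul_exp_neg_mul hab one_pos) ?_
    · filter_upwards [self_mem_nhdsWithin] with x hx
      rw [ae_restrict_iff' measurableSet_Ioi]
      refine Eventually.of_forall fun s hs => ?_
      have hx0 : (0 : ℝ) < x := hx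
      have hs0 : (0 : ℝ) < s := hs
      have hxs : (x : ℂ) + s ≠ 0 := by
        rw [← ofReal_add]; exact ofReal_ne_zero.2 (by positivity)
      have e : (x : ℂ) * ((s : ℂ) ^ (b - 1) * exp (-s) * ((x : ℂ) + s) ^ (-(a + 1))) =
          (x / (x + s)) * ((s : ℂ) ^ (b - 1) * exp (-s) * ((x : ℂ) + s) ^ (-a)) := by
        rw [show -(a + 1) = -a - 1 by ring, cpow_sub _ _ hxs, cpow_one]; ring
      have h1 : ‖(x : ℂ) / (x + s)‖ ≤ 1 := by
        rw [← ofReal_add, ← ofReal_div, norm_real, Real.norm_of_nonneg (by positivity)]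
        exact (div_le_one (by positivity)).2 (by linarith)
      rw [e, norm_mul]
      exact (mul_le_of_le_one_left (norm_nonneg _) h1).trans (norm_laplace_bound ha hx hs)
    · rw [ae_restrict_iff' measurableSet_Ioi]
      refine Eventually.of_forall fun s hs => ?_
      have hs0 : (0 : ℝ) < s := hs
      have hc : ContinuousAt (fun x : ℝ => (x : ℂ) *
          ((s : ℂ) ^ (b - 1) * exp (-s) * ((x : ℂ) + s) ^ (-(a + 1)))) 0 :=
        continuous_ofReal.continuousAt.mul (continuousAt_const.mul
          (ContinuousAt.cpow (by fun_prop) continuousAt_const (by simpa using hs0)))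
      have := hc.tendsto.mono_left (nhdsWithin_le_nhds (s := Ioi 0))
      simpa using this
  have h2 := hlim.div_const (Gamma b)
  rw [zero_div] at h2
  refine h2.congr' ?_
  filter_upwards [self_mem_nhdsWithin] with x hx
  rw [integral_const_mul, (hasIntegralOn_laplace_kummerU (a + 1) hb (ofReal_mem_slitPlane.2 hx)).2,
    mul_left_comm, mul_div_cancel_left₀ _ (Gamma_ne_zero_of_re_pos hb)]

theorem wronskianU_of_re_pos {a b w : ℂ} (ha : 0 ≤ a.re) (hab : 0 < (b - a).re)
    (hw : w ∈ slitPlane) : wronskianU a b w = exp w * (Gamma b)⁻¹ := by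
  have hM : ∀ c : ℂ, Tendsto (fun x : ℝ => kummerBold b c x) (𝓝[>] 0) (𝓝 (Gamma c)⁻¹) := fun c => by
    have := ((differentiable_kummerBold b c).continuous.comp continuous_ofReal).tendsto (0 : ℝ)
    simpa [Function.comp_def, kummerBold_zero] using this.mono_left (nhdsWithin_le_nhds (s := Ioi 0))
  have hexp : Tendsto (fun x : ℝ => exp (-(x : ℂ))) (𝓝[>] 0) (𝓝 1) := by
    have hc : Continuous fun x : ℝ => exp (-(x : ℂ)) := by fun_prop
    simpa using (hc.tendsto 0).mono_left (nhdsWithin_le_nhds (s := Ioi 0))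
  have hlim := hexp.mul (((tendsto_kummerU_zero ha hab).mul (hM (b - a))).add
    (((tendsto_mul_kummerU_add_one_zero ha hab).const_mul a).mul (hM (b - a + 1))))
  have hconst : Tendsto (fun _ : ℝ => exp (-w) * wronskianU a b w) (𝓝[>] 0)
      (𝓝 (exp (-w) * wronskianU a b w)) := tendsto_const_nhds
  have heq := tendsto_nhds_unique (hconst.congr' (by
    filter_upwards [self_mem_nhdsWithin] with x hx
    exact wronskianU_eq_const a b hw (ofReal_mem_slitPlane.2 hx))) hlim
  have hG := Gamma_ne_zero_of_re_pos hab
  have hGb : (Gamma (b - a) / Gamma b) * (Gamma (b - a))⁻¹ = (Gamma b)⁻¹ := by field_simp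
  rw [hGb, mul_zero, zero_mul, add_zero, one_mul] at heq
  rw [← heq, ← mul_assoc, ← exp_add, add_neg_cancel, exp_zero, one_mul]

theorem wronskianU_add_natCast (n : ℕ) {a b w : ℂ} (hw : w ∈ slitPlane) :
    wronskianU (a + n) b w = wronskianU a b w := by
  induction n with
  | zero => simp
  | succ n ih => rw [← ih, Nat.cast_succ, ← add_assoc, wronskianU_add_one hw]

/-- Subtracting the integer part of Re a brings it into [0,1[, below Re b, without changing the
Wronskian. -/
theorem wronskianU_of_one_le_re {a b w : ℂ} (ha : 0 ≤ a.re) (hb : 1 ≤ b.re)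
    (hw : w ∈ slitPlane) : wronskianU a b w = exp w * (Gamma b)⁻¹ := by
  have h1 := Nat.floor_le ha
  have h2 := Nat.lt_floor_add_one a.re
  have h := wronskianU_of_re_pos (a := a - ⌊a.re⌋₊) (b := b) (w := w)
    (by simp only [sub_re, natCast_re]; linarith) (by simp only [sub_re, natCast_re]; linarith) hw
  rw [← h, ← wronskianU_add_natCast ⌊a.re⌋₊ (a := a - ⌊a.re⌋₊) hw, sub_add_cancel]

/-- Serves to rewrite the Wronskian of the pair (b, a) in terms of U(a, b) and U(a+1, b). -/
theorem kummerU_contiguous_add_one {a b w : ℂ} (hw : w ∈ slitPlane) :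
    b * kummerU a (b + 1) w = (b - a) * kummerU a b w + a * (w * kummerU (a + 1) b w) := by
  have hw0 := slitPlane_ne_zero hw
  have hz := neg_neg_inv_mem_slitPlane hw
  have h₁ := twoFZero_add_one_left hz a b
  have h₂ := twoFZero_add_one_left hz b a
  rw [twoFZero_symm (b + 1) a, twoFZero_symm b, twoFZero_symm (b + 1)] at h₂
  have e : w * w ^ (-(a + 1)) = w ^ (-a) := by
    nth_rewrite 1 [← cpow_one w]
    rw [← cpow_add _ _ hw0]; ring_nf
  simp only [kummerU]
  linear_combination w ^ (-a) * (b * h₂ - a * h₁) - a * twoFZero (a + 1) b (-w⁻¹) * e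

/-- The Wronskians for (a, b) and (b, a) are two linear equations in U(a, b) and a w U(a+1, b), and
their determinant is `kummerBold_wronskian`. Eliminating the second unknown is Cramer's rule. The
sine stays as a factor on the left, so b - a may be an integer. -/
theorem kummerU_connection_of_one_le_re {a b w : ℂ} (ha : 1 ≤ a.re) (hb : 1 ≤ b.re)
    (hw : w ∈ slitPlane) :
    sin (Real.pi * (b - a)) * kummerU a b w = Real.pi * ((Gamma b)⁻¹ * kummerBold a (a - b + 1) w -
      (Gamma a)⁻¹ * (w ^ (b - a) * kummerBold b (b - a + 1) w)) := by
  have hw0 := slitPlane_ne_zero hw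
  have q1 := wronskianU_of_one_le_re (a := a) (b := b) (by linarith) hb hw
  have q2 := wronskianU_of_one_le_re (a := b) (b := a) (by linarith) ha hw
  have q3 := kummerBold_wronskian a b w
  have hpi : (Real.pi : ℂ) ≠ 0 := ofReal_ne_zero.2 Real.pi_ne_zero
  rw [wronskianU] at q1 q2
  have hpow : w ^ (b - a) * w ^ (a - b) = 1 := by
    rw [← cpow_add _ _ hw0]; simp
  have s1 : w ^ (b - a) * kummerU b a w = kummerU a b w := (kummerU_swap hw0 a b).symm
  have s2 : w ^ (b - a) * (b * (w * kummerU (b + 1) a w)) =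
      (b - a) * kummerU a b w + a * (w * kummerU (a + 1) b w) := by
    rw [kummerU_swap hw0 (b + 1) a, ← kummerU_contiguous_add_one hw,
      show a - (b + 1) = a - b - 1 by ring, cpow_sub _ 1 hw0, cpow_one]
    have hv : w * w⁻¹ = 1 := mul_inv_cancel₀ hw0
    rw [div_eq_mul_inv]
    linear_combination b * kummerU a (b + 1) w * hpow +
      w ^ (b - a) * w ^ (a - b) * b * kummerU a (b + 1) w * hv
  have q4 : (Real.pi : ℂ) * (exp w * (sin (Real.pi * (b - a)) / Real.pi)) =
      exp w * sin (Real.pi * (b - a)) := by field_simp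
  apply mul_left_cancel₀ (exp_ne_zero w)
  linear_combination Real.pi * kummerBold a (a - b + 1) w * q1 -
    Real.pi * kummerBold b (b - a + 1) w * w ^ (b - a) * q2 - Real.pi * kummerU a b w * q3 -
    kummerU a b w * q4 + Real.pi * kummerBold b (b - a + 1) w * kummerBold a (a - b) w * s1 +
    Real.pi * kummerBold b (b - a + 1) w * kummerBold a (a - b + 1) w * s2

/-- Both sides satisfy the same recursion along (a, b), (a+1, b+1), (a+2, b+2), with b - a, and
hence the sine and the power of w, unchanged. This carries the formula down from large real parts.
-/
theorem kummerU_connection (a b : ℂ) {w : ℂ} (hw : w ∈ slitPlane) :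
    sin (Real.pi * (b - a)) * kummerU a b w = Real.pi * ((Gamma b)⁻¹ * kummerBold a (a - b + 1) w -
      (Gamma a)⁻¹ * (w ^ (b - a) * kummerBold b (b - a + 1) w)) := by
  obtain ⟨n, hn⟩ := exists_nat_gt (max (1 - a.re) (1 - b.re))
  have hna : 1 ≤ a.re + n := by have := (le_max_left _ _).trans hn.le; linarith
  have hnb : 1 ≤ b.re + n := by have := (le_max_right _ _).trans hn.le; linarith
  clear hn
  induction n generalizing a b with
  | zero => exact kummerU_connection_of_one_le_re (by simpa using hna) (by simpa using hnb) hw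
  | succ n ih =>
    push_cast at hna hnb
    have h₁ := ih (a + 1) (b + 1) (by simp only [add_re, one_re]; linarith)
      (by simp only [add_re, one_re]; linarith)
    have h₂ := ih (a + 2) (b + 2) (by simp only [add_re, re_ofNat]; linarith)
      (by simp only [add_re, re_ofNat]; linarith)
    have r := kummerU_recursion a b hw
    have ca := kummerBold_contiguous a (a - b + 1) w
    have cb := kummerBold_contiguous b (b - a + 1) w
    have gb := inv_Gamma_eq b
    have ga := inv_Gamma_eq a
    have gb1 := inv_Gamma_eq (b + 1)
    have ga1 := inv_Gamma_eq (a + 1)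
    rw [show b + 1 + 1 = b + 2 by ring] at gb1
    rw [show a + 1 + 1 = a + 2 by ring] at ga1
    rw [show b + 1 - (a + 1) = b - a by ring, show a + 1 - (b + 1) = a - b by ring, gb1, ga1] at h₁
    rw [show b + 2 - (a + 2) = b - a by ring, show a + 2 - (b + 2) = a - b by ring] at h₂
    rw [gb, ga, gb1, ga1]
    linear_combination sin (Real.pi * (b - a)) * r - (a + 1) * (b + 1) * h₂ +
      (w + a + b + 1) * h₁ - Real.pi * (b + 1) * (Gamma (b + 2))⁻¹ * ca +
      Real.pi * (a + 1) * (Gamma (a + 2))⁻¹ * w ^ (b - a) * cb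

/-- `kummerU_connection` divided by the sine, which is nonzero for α outside ℤ. At poles `Gamma` is
0 and so is the quotient, in agreement with 1/Γ = 0. -/
theorem cpow_mul_FTilde_connection {θ α w : ℂ} (hα : ∀ n : ℤ, α ≠ n) (hw : w ∈ slitPlane) :
    w ^ ((-1 - θ - α) / 2) * FTilde θ α (-w⁻¹) =
      Real.pi * FBold θ α w / (sin (Real.pi * (-α)) * Gamma ((1 + θ - α) / 2)) +
        Real.pi * (w ^ (-α) * FBold θ (-α) w) /
          (sin (Real.pi * α) * Gamma ((1 + θ + α) / 2)) := by
  have hpi : (Real.pi : ℂ) ≠ 0 := ofReal_ne_zero.2 Real.pi_ne_zero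
  have hs : sin (Real.pi * α) ≠ 0 := by
    rw [sin_ne_zero_iff]
    intro k hk
    exact hα k (mul_left_cancel₀ hpi (by rw [hk]; ring))
  have key := kummerU_connection ((1 + α + θ) / 2) ((1 - α + θ) / 2) hw
  rw [show (1 - α + θ) / 2 - (1 + α + θ) / 2 = -α by ring,
    show (1 + α + θ) / 2 - (1 - α + θ) / 2 + 1 = 1 + α by ring] at key
  rw [FTilde, FBold, FBold, show (-1 - θ - α) / 2 = -((1 + α + θ) / 2) by ring, ← kummerU,
    show (1 + θ - α) / 2 = (1 - α + θ) / 2 by ring, show (1 + θ + α) / 2 = (1 + α + θ) / 2 by ring,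
    show 1 + -α + θ = 1 - α + θ by ring, add_comm 1 (-α)]
  rw [mul_neg, sin_neg] at key ⊢
  simp only [div_eq_mul_inv, mul_inv, neg_mul, inv_neg] at key ⊢
  apply mul_left_cancel₀ (neg_ne_zero.2 hs)
  have hsi := mul_inv_cancel₀ hs
  rw [neg_mul, key]
  linear_combination (-Real.pi * (kummerBold ((1 + α + θ) * 2⁻¹) (1 + α) w *
    (Gamma ((1 - α + θ) * 2⁻¹))⁻¹) + Real.pi * (w ^ (-α) *
    kummerBold ((1 - α + θ) * 2⁻¹) (-α + 1) w * (Gamma ((1 + α + θ) * 2⁻¹))⁻¹)) * hsi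

theorem FTilde_mul_sign {ε : ℂ} (hε : ε = 1 ∨ ε = -1) (θ α w : ℂ) :
    FTilde θ (ε * α) w = FTilde θ α w := by
  rcases hε with rfl | rfl
  · rw [one_mul]
  · rw [FTilde, FTilde, twoFZero_symm]; ring_nf

/-- The first formula at (-θ, -w), with Kummer's transformation applied to both functions on the
right. -/
theorem exp_mul_cpow_mul_FTilde_connection {θ α w : ℂ} (hα : ∀ n : ℤ, α ≠ n)
    (hw : -w ∈ slitPlane) :
    exp w * (-w) ^ ((-1 + θ - α) / 2) * FTilde (-θ) α w⁻¹ =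
      Real.pi * FBold θ α w / (sin (Real.pi * (-α)) * Gamma ((1 - θ - α) / 2)) +
        Real.pi * ((-w) ^ (-α) * FBold θ (-α) w) /
          (sin (Real.pi * α) * Gamma ((1 - θ + α) / 2)) := by
  have hF : ∀ β : ℂ, FBold θ β w = exp w * FBold (-θ) β (-w) := fun β => by
    rw [FBold, FBold, ← exp_mul_kummerBold_neg]; ring_nf
  have key := cpow_mul_FTilde_connection (θ := -θ) hα hw
  rw [inv_neg, neg_neg, sub_neg_eq_add, ← sub_eq_add_neg] at key
  rw [mul_assoc, key, hF, hF]
  ring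

end Connection

/-! ### Loop integrals -/

section Loops

theorem exp_log_sub_pi_mul_I {x : ℝ} (hx : 0 < x) :
    exp ((Real.log x : ℂ) - Real.pi * I) = -x := by
  rw [exp_sub, ← ofReal_exp, Real.exp_log hx, exp_pi_mul_I, div_neg, div_one]

theorem exp_log_add_pi_mul_I {x : ℝ} (hx : 0 < x) :
    exp ((Real.log x : ℂ) + Real.pi * I) = -x := by
  rw [exp_add, ← ofReal_exp, Real.exp_log hx, exp_pi_mul_I, mul_neg_one]

theorem HasIntegralOn.sub {f g : ℝ → ℂ} {s : Set ℝ} {u v : ℂ} (hf : HasIntegralOn f s u)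
    (hg : HasIntegralOn g s v) : HasIntegralOn (fun x => f x - g x) s (u - v) :=
  ⟨hf.1.sub hg.1, by rw [integral_sub hf.1 hg.1, hf.2, hg.2]⟩

theorem HasLoopIntegralFromInfinity.const_mul {g : ℂ → ℂ} {R : ℝ} {v : ℂ} (k : ℂ)
    (h : HasLoopIntegralFromInfinity g R v) :
    HasLoopIntegralFromInfinity (fun ℓ => k * g ℓ) R (k * v) := by
  obtain ⟨v₁, v₂, v₃, h₁, h₂, h₃, rfl⟩ := h
  refine ⟨k * v₁, k * v₂, k * v₃, h₁.const_mul k, ?_, h₃.const_mul k, by ring⟩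
  simpa only [mul_assoc] using h₂.const_mul k

theorem HasLoopIntegralFromInfinity.sub {f g : ℂ → ℂ} {R : ℝ} {u v : ℂ}
    (hf : HasLoopIntegralFromInfinity f R u) (hg : HasLoopIntegralFromInfinity g R v) :
    HasLoopIntegralFromInfinity (fun ℓ => f ℓ - g ℓ) R (u - v) := by
  obtain ⟨u₁, u₂, u₃, hu₁, hu₂, hu₃, rfl⟩ := hf
  obtain ⟨v₁, v₂, v₃, hv₁, hv₂, hv₃, rfl⟩ := hg
  refine ⟨u₁ - v₁, u₂ - v₂, u₃ - v₃, hu₁.sub hv₁, ?_, hu₃.sub hv₃, by ring⟩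
  simpa only [sub_mul] using hu₂.sub hv₂

theorem integrableOn_Ioc_of_continuous {g : ℂ → ℂ} (hg : Continuous g) (R : ℝ) :
    IntegrableOn (fun φ : ℝ => g (Real.log R + φ * I) * (I * R * exp (φ * I)))
      (Ioc (-Real.pi) Real.pi) :=
  (by fun_prop : Continuous fun φ : ℝ => g (Real.log R + φ * I) * (I * R * exp (φ * I))).integrableOn_Ioc

/-- The integral of `G'` over the circular arc, in the logarithmic coordinate. -/
theorem hasIntegralOn_arc_of_hasDerivAt {G g : ℂ → ℂ} (hg : Continuous g)
    (hG : ∀ ℓ, HasDerivAt G (g ℓ * exp ℓ) ℓ) {R : ℝ} (hR : 0 < R) :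
    HasIntegralOn (fun φ : ℝ => g (Real.log R + φ * I) * (I * R * exp (φ * I)))
      (Ioc (-Real.pi) Real.pi)
      (G (Real.log R + Real.pi * I) - G (Real.log R - Real.pi * I)) := by
  have hint := integrableOn_Ioc_of_continuous hg R
  have hpi : -Real.pi ≤ Real.pi := by linarith [Real.pi_pos]
  refine ⟨hint, ?_⟩
  rw [← intervalIntegral.integral_of_le hpi]
  have hd : ∀ φ : ℝ, HasDerivAt (fun φ : ℝ => G (Real.log R + φ * I))
      (g (Real.log R + φ * I) * (I * R * exp (φ * I))) φ := fun φ => by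
    have h1 : HasDerivAt (fun φ : ℝ => (Real.log R : ℂ) + φ * I) I φ := by
      simpa using ((hasDerivAt_id φ).ofReal_comp.mul_const I).const_add (Real.log R : ℂ)
    refine ((hG _).comp_of_eq φ h1 rfl).congr_deriv ?_
    rw [exp_add, ← ofReal_exp, Real.exp_log hR]
    ring
  rw [intervalIntegral.integral_eq_sub_of_hasDerivAt (fun φ _ => hd φ)
    ((intervalIntegrable_iff_integrableOn_Ioc_of_le hpi).2 hint)]
  push_cast
  rw [neg_mul, ← sub_eq_add_neg]

/-- In the coordinate ℓ = log t one has dt = e^ℓ dℓ, and the primitive G lives on the ℓ-plane, where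
the loop is an ordinary path. The values of G at the ends of the arc cancel and the limits at
infinity are 0. -/
theorem hasLoopIntegralFromInfinity_of_hasDerivAt {G g : ℂ → ℂ} (hg : Continuous g)
    (hG : ∀ ℓ, HasDerivAt G (g ℓ * exp ℓ) ℓ) {R : ℝ} (hR : 0 < R)
    (h₁ : IntegrableOn (fun x : ℝ => g (Real.log x - Real.pi * I)) (Ioi R))
    (h₃ : IntegrableOn (fun x : ℝ => g (Real.log x + Real.pi * I)) (Ioi R))
    (l₁ : Tendsto (fun x : ℝ => G (Real.log x - Real.pi * I)) atTop (𝓝 0))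
    (l₃ : Tendsto (fun x : ℝ => G (Real.log x + Real.pi * I)) atTop (𝓝 0)) :
    HasLoopIntegralFromInfinity g R 0 := by
  have hlog : ∀ x ∈ Ici R, ∀ d : ℂ, HasDerivAt (fun x : ℝ => (Real.log x : ℂ) + d) (x : ℂ)⁻¹ x :=
    fun x hx d => by
      have := (Real.hasDerivAt_log (ne_of_gt (hR.trans_le hx))).ofReal_comp.add_const d
      simpa using this
  refine ⟨G (Real.log R - Real.pi * I), _, G (Real.log R + Real.pi * I), ⟨h₁, ?_⟩,
    hasIntegralOn_arc_of_hasDerivAt hg hG hR, ⟨h₃, ?_⟩, by ring⟩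
  · rw [integral_Ioi_of_hasDerivAt_of_tendsto' (f := fun x => -G (Real.log x - Real.pi * I))
      (fun x hx => ?_) h₁ (by simpa using l₁.neg)]
    · simp
    · have hx0 : (0 : ℝ) < x := hR.trans_le hx
      have hxc : (x : ℂ) ≠ 0 := ofReal_ne_zero.2 hx0.ne'
      have h := hlog x hx (-(Real.pi * I))
      simp only [← sub_eq_add_neg] at h
      refine ((hG _).comp_of_eq x h rfl).fun_neg.congr_deriv ?_
      rw [exp_log_sub_pi_mul_I hx0]
      field_simp
  · rw [integral_Ioi_of_hasDerivAt_of_tendsto' (f := fun x => -G (Real.log x + Real.pi * I))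
      (fun x hx => ?_) h₃ (by simpa using l₃.neg)]
    · simp
    · have hx0 : (0 : ℝ) < x := hR.trans_le hx
      have hxc : (x : ℂ) ≠ 0 := ofReal_ne_zero.2 hx0.ne'
      refine ((hG _).comp_of_eq x (hlog x hx (Real.pi * I)) rfl).fun_neg.congr_deriv ?_
      rw [exp_log_add_pi_mul_I hx0]
      field_simp

/-- Termwise loop integration. -/
theorem hasSum_loopIntegralFromInfinity {g H : ℂ → ℂ} {h : ℕ → ℂ → ℂ} {u : ℕ → ℝ} {V : ℕ → ℂ}
    {R : ℝ} (hR : 0 < R) (hh : ∀ n, Continuous (h n)) (hu : Summable u)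
    (hb : ∀ n ℓ, Real.log R ≤ ℓ.re → ‖h n ℓ‖ ≤ u n)
    (hH : ∀ ℓ, Real.log R ≤ ℓ.re → HasSum (fun n => h n ℓ) (H ℓ))
    (hg : ∃ v, HasLoopIntegralFromInfinity g R v)
    (hV : ∀ n, HasLoopIntegralFromInfinity (fun ℓ => g ℓ * h n ℓ) R (V n)) :
    ∃ v, HasLoopIntegralFromInfinity (fun ℓ => g ℓ * H ℓ) R v ∧ HasSum V v := by
  obtain ⟨v, v₁, v₂, v₃, h₁, h₂, h₃, -⟩ := hg
  choose V₁ V₂ V₃ H₁ H₂ H₃ hsum using hV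
  have hre : ∀ x ∈ Ioi R, ∀ y : ℝ, Real.log R ≤ ((Real.log x : ℂ) + y * I).re := fun x hx y => by
    simpa using Real.log_le_log hR (le_of_lt hx)
  have hre' : ∀ x ∈ Ioi R, Real.log R ≤ ((Real.log x : ℂ) - Real.pi * I).re := fun x hx => by
    simpa using Real.log_le_log hR (le_of_lt hx)
  have hre2 : ∀ φ : ℝ, Real.log R ≤ ((Real.log R : ℂ) + φ * I).re := fun φ => by simp
  have m : Measurable fun x : ℝ => (Real.log x : ℂ) := by fun_prop
  have k₁ := hasSum_integral_mul (μ := volume.restrict (Ioi R)) h₁.1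
    (h := fun n x => h n (Real.log x - Real.pi * I)) (H := fun x => H (Real.log x - Real.pi * I))
    (u := u)
    (fun n => ((hh n).measurable.comp (m.sub_const _)).aestronglyMeasurable)
    (fun n => (ae_restrict_iff' measurableSet_Ioi).2 (Eventually.of_forall fun x hx =>
      hb n _ (hre' x hx))) hu
    ((ae_restrict_iff' measurableSet_Ioi).2 (Eventually.of_forall fun x hx => hH _ (hre' x hx)))
  have k₃ := hasSum_integral_mul (μ := volume.restrict (Ioi R)) h₃.1
    (h := fun n x => h n (Real.log x + Real.pi * I)) (H := fun x => H (Real.log x + Real.pi * I))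
    (u := u)
    (fun n => ((hh n).measurable.comp (m.add_const _)).aestronglyMeasurable)
    (fun n => (ae_restrict_iff' measurableSet_Ioi).2 (Eventually.of_forall fun x hx =>
      hb n _ (hre x hx _))) hu
    ((ae_restrict_iff' measurableSet_Ioi).2 (Eventually.of_forall fun x hx => hH _ (hre x hx _)))
  have k₂ := hasSum_integral_mul (μ := volume.restrict (Ioc (-Real.pi) Real.pi)) h₂.1
    (h := fun n φ => h n (Real.log R + φ * I)) (H := fun φ => H (Real.log R + φ * I))
    (u := u)
    (fun n => ((hh n).comp (by fun_prop)).aestronglyMeasurable)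
    (fun n => Eventually.of_forall fun φ => hb n _ (hre2 φ)) hu
    (Eventually.of_forall fun φ => hH _ (hre2 φ))
  have e₂ : ∀ f : ℂ → ℂ, (fun φ : ℝ => g (Real.log R + φ * I) * (I * R * exp (φ * I)) *
      f (Real.log R + φ * I)) = fun φ : ℝ => g (Real.log R + φ * I) * f (Real.log R + φ * I) *
        (I * R * exp (φ * I)) := fun f => by funext φ; ring
  simp only [e₂] at k₂
  have r₁ : (fun n => ∫ x in Ioi R, g (Real.log x - Real.pi * I) *
    h n (Real.log x - Real.pi * I)) = V₁ := funext fun n => (H₁ n).2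
  have r₃ : (fun n => ∫ x in Ioi R, g (Real.log x + Real.pi * I) *
    h n (Real.log x + Real.pi * I)) = V₃ := funext fun n => (H₃ n).2
  have r₂ : (fun n => ∫ φ in Ioc (-Real.pi) Real.pi, g (Real.log R + φ * I) *
    h n (Real.log R + φ * I) * (I * R * exp (φ * I))) = V₂ := funext fun n => (H₂ n).2
  rw [r₁] at k₁
  rw [r₂] at k₂
  rw [r₃] at k₃
  exact ⟨_, ⟨_, _, _, ⟨k₁.1, rfl⟩, ⟨k₂.1, rfl⟩, ⟨k₃.1, rfl⟩, rfl⟩,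
    ((k₁.2.add k₂.2).sub k₃.2).congr_fun hsum⟩

/-- The substitution `t ↦ 1/t` in loop integrals. -/
theorem hasLoopIntegralFromZero_of_fromInfinity {g : ℂ → ℂ} {r : ℝ} (hr : 0 < r) {v : ℂ}
    (h : HasLoopIntegralFromInfinity (fun ℓ => g (-ℓ) * exp (-2 * ℓ)) r⁻¹ v) :
    HasLoopIntegralFromZero g r v := by
  obtain ⟨v₁, v₂, v₃, h₁, h₂, h₃, rfl⟩ := h
  have himg : Inv.inv '' Ioi r⁻¹ = Ioo 0 r := by
    rw [image_inv_eq_inv, inv_Ioi₀ (inv_pos.2 hr), inv_inv]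
  have hsub : Ioi r⁻¹ ⊆ Ioi (0 : ℝ) := Ioi_subset_Ioi (inv_pos.2 hr).le
  -- Inversion is ℓ ↦ -ℓ, so it exchanges the two sides of the cut.
  refine ⟨v₃, v₂, v₁, ?_, ?_, ?_, by ring⟩
  · rw [← himg, hasIntegralOn_inv_iff measurableSet_Ioi hsub]
    refine h₃.congr measurableSet_Ioi fun x hx => ?_
    have hx0 : (0 : ℝ) < x := hsub hx
    simp only [Real.log_inv, neg_mul, exp_neg, two_mul, exp_add (_ + _),
      exp_log_add_pi_mul_I hx0]
    push_cast
    ring_nf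
  -- On the circle inversion is φ ↦ -φ, which preserves the open interval but not the half-open one.
  · have hI := integrableOn_Ioc_iff_integrableOn_Ioo (μ := volume) (a := -Real.pi) (b := Real.pi)
      (f := fun φ : ℝ => g (Real.log r + φ * I) * (I * r * exp (φ * I)))
    have himg2 : (fun φ : ℝ => -φ) '' Ioo (-Real.pi) Real.pi = Ioo (-Real.pi) Real.pi := by
      simp
    have h₂' : HasIntegralOn (fun φ : ℝ => g (Real.log r + φ * I) * (I * r * exp (φ * I)))
        (Ioo (-Real.pi) Real.pi) v₂ := by
      rw [← himg2, hasIntegralOn_image_iff (φ' := fun _ => -1) measurableSet_Ioo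
        (fun x _ => hasDerivAt_neg x) neg_injective.injOn]
      refine HasIntegralOn.congr (f := fun φ : ℝ => g (-(Real.log r⁻¹ + φ * I)) *
        exp (-2 * (Real.log r⁻¹ + φ * I)) * (I * (r⁻¹ : ℝ) * exp (φ * I))) measurableSet_Ioo
        ⟨h₂.1.mono_set Ioo_subset_Ioc_self, by
          rw [← integral_Ioc_eq_integral_Ioo]; exact h₂.2⟩ fun φ _ => ?_
      have e : exp (-2 * ((Real.log r⁻¹ : ℝ) + φ * I)) = r ^ 2 * exp (-(φ * I)) * exp (-(φ * I)) := by
        rw [Real.log_inv, show (-2 : ℂ) * ((-Real.log r : ℝ) + φ * I) =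
          Real.log r + Real.log r + -(φ * I) + -(φ * I) by push_cast; ring, exp_add, exp_add,
          exp_add, ← ofReal_exp, Real.exp_log hr]
        ring
      have hrc : (r : ℂ) ≠ 0 := ofReal_ne_zero.2 hr.ne'
      have e3 : exp (-(φ * I)) * exp (φ * I) = 1 := by rw [← exp_add]; simp
      rw [e, Real.log_inv, show -((-Real.log r : ℝ) + (φ : ℂ) * I) = Real.log r + (-φ : ℝ) * I by
        push_cast; ring]
      simp only [abs_neg, abs_one, ofReal_one, one_mul]
      push_cast
      rw [neg_mul]
      field_simp
      linear_combination (-(g (Real.log r - φ * I))) * e3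
    exact ⟨hI.2 h₂'.1, by rw [integral_Ioc_eq_integral_Ioo]; exact h₂'.2⟩
  · rw [← himg, hasIntegralOn_inv_iff measurableSet_Ioi hsub]
    refine h₁.congr measurableSet_Ioi fun x hx => ?_
    have hx0 : (0 : ℝ) < x := hsub hx
    simp only [Real.log_inv, neg_mul, exp_neg, two_mul, exp_add (_ - _),
      exp_log_sub_pi_mul_I hx0]
    push_cast
    ring_nf

end Loops

/-! ### Hankel's integral -/

section Hankel

theorem kummerBold_zero_left (c w : ℂ) : kummerBold 0 c w = (Gamma c)⁻¹ := by
  rw [← kummerBold_zero 0 c]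
  exact is_const_of_deriv_eq_zero (differentiable_kummerBold 0 c)
    (fun z => by rw [(hasDerivAt_kummerBold 0 c z).deriv, zero_mul]) w 0

theorem kummerBold_self (c w : ℂ) : kummerBold c c w = exp w * (Gamma c)⁻¹ := by
  rw [← exp_mul_kummerBold_neg, sub_self, kummerBold_zero_left]

theorem twoFZero_zero_right_of_re_pos {z : ℂ} (hz : -z ∈ slitPlane) {a : ℂ} (ha : 0 < a.re) :
    twoFZero a 0 z = 1 := by
  have h := integral_laplaceIntegrand hz 0 ha
  have h0 : ∫ s in Ioi (0 : ℝ), laplaceIntegrand 0 a z s = Gamma a := by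
    rw [Gamma_eq_integral ha, GammaIntegral]
    refine integral_congr_ae (Eventually.of_forall fun s => ?_)
    simp only [laplaceIntegrand, neg_zero, cpow_zero, mul_one]
    push_cast
    ring
  rw [twoFZero_symm]
  exact mul_left_cancel₀ (Gamma_ne_zero_of_re_pos ha) (by rw [← h, h0, mul_one])

theorem hasIntegralOn_cpow_mul_exp_neg {s w : ℂ} (hs : s.re < 1) (hw : 0 < w.re) :
    HasIntegralOn (fun x : ℝ => (x : ℂ) ^ (-s) * exp (-w * x)) (Ioi 0)
      (Gamma (1 - s) * w ^ (s - 1)) := by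
  have ha : 0 < (1 - s).re := by simpa using hs
  have key := hasIntegralOn_laplace (b := 0) ha hw
  rw [kummerU, twoFZero_zero_right_of_re_pos (neg_neg_inv_mem_slitPlane (Or.inl hw)) ha,
    mul_one, neg_sub] at key
  refine key.congr measurableSet_Ioi fun x _ => ?_
  rw [neg_zero, cpow_zero, mul_one, sub_sub_cancel_left, mul_comm]

theorem hasIntegralOn_cpow_mul_exp_neg_Ioo {s : ℂ} (hs : s.re < 1) (w : ℂ) {R : ℝ} (hR : 0 < R) :
    HasIntegralOn (fun x : ℝ => (x : ℂ) ^ (-s) * exp (-w * x)) (Ioo 0 R)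
      (Gamma (1 - s) * ((R : ℂ) ^ (1 - s) * kummerBold (1 - s) (2 - s) (-(w * R)))) := by
  have ha : 0 < (1 - s).re := by simpa using hs
  have key := (hasIntegralOn_euler_kummer ha (b := 1) (by simp) (-(w * R))).const_mul
    ((R : ℂ) ^ (1 - s))
  rw [Gamma_one, mul_one, show 1 - s + 1 = 2 - s by ring, mul_left_comm] at key
  have himg : (fun x => R * x) '' Ioo 0 1 = Ioo 0 R := by
    rw [image_mul_left_Ioo hR, mul_zero, mul_one]
  rw [← himg, hasIntegralOn_image_iff (φ' := fun _ => R) measurableSet_Ioo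
    (fun x _ => by simpa using (hasDerivAt_id x).const_mul R)
    (fun x _ y _ hxy => mul_left_cancel₀ hR.ne' hxy)]
  refine key.congr measurableSet_Ioo fun x hx => ?_
  have hRc : (R : ℂ) ≠ 0 := ofReal_ne_zero.2 hR.ne'
  rw [abs_of_pos hR, ofReal_mul, ofReal_mul_cpow hR (ofReal_ne_zero.2 hx.1.ne'), sub_self,
    cpow_zero, mul_one, sub_sub_cancel_left, sub_eq_add_neg 1 s, cpow_add _ _ hRc, cpow_one,
    show (x : ℂ) * -(w * R) = -w * (R * x) by ring]
  ring

theorem hasIntegralOn_cpow_mul_exp_neg_Ioi {s w : ℂ} (hs : s.re < 1) (hw : 0 < w.re) {R : ℝ}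
    (hR : 0 < R) :
    HasIntegralOn (fun x : ℝ => (x : ℂ) ^ (-s) * exp (-w * x)) (Ioi R)
      (Gamma (1 - s) * w ^ (s - 1) -
        Gamma (1 - s) * ((R : ℂ) ^ (1 - s) * kummerBold (1 - s) (2 - s) (-(w * R)))) := by
  have h1 := hasIntegralOn_cpow_mul_exp_neg hs hw
  have h2 := hasIntegralOn_cpow_mul_exp_neg_Ioo hs w hR
  have i1 := h1.1.mono_set (show Ioc 0 R ⊆ Ioi 0 from fun x hx => hx.1)
  have i2 := h1.1.mono_set (Ioi_subset_Ioi hR.le)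
  refine ⟨i2, ?_⟩
  rw [← h1.2, ← h2.2, ← Ioc_union_Ioi_eq_Ioi hR.le,
    setIntegral_union (Ioc_disjoint_Ioi le_rfl) measurableSet_Ioi i1 i2,
    integral_Ioc_eq_integral_Ioo]
  ring

theorem integrableOn_cpow_mul_exp_neg_Ioi (s : ℂ) {w : ℂ} (hw : 0 < w.re) {R : ℝ}
    (hR : 0 < R) : IntegrableOn (fun x : ℝ => (x : ℂ) ^ (-s) * exp (-w * x)) (Ioi R) := by
  have hp : 0 < |s.re| + 1 := by positivity
  have hg := ((integrableOn_rpow_mul_exp_neg_mul hp hw).mono_set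
    (Ioi_subset_Ioi hR.le)).const_mul (R ^ (-s.re - |s.re|))
  refine hg.mono' (by fun_prop : Measurable fun x : ℝ =>
    (x : ℂ) ^ (-s) * exp (-w * x)).aestronglyMeasurable ?_
  rw [ae_restrict_iff' measurableSet_Ioi]
  refine Eventually.of_forall fun x hx => ?_
  have hx0 : 0 < x := hR.trans hx
  rw [norm_mul, norm_cpow_eq_rpow_re_of_pos hx0, norm_exp, add_sub_cancel_right]
  have e : x ^ (-s.re) = x ^ (-s.re - |s.re|) * x ^ |s.re| := by
    rw [← Real.rpow_add hx0, sub_add_cancel]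
  have h1 : x ^ (-s.re - |s.re|) ≤ R ^ (-s.re - |s.re|) :=
    Real.rpow_le_rpow_of_nonpos hR (le_of_lt hx) (by linarith [neg_abs_le s.re])
  have e2 : (-w * x).re = -w.re * x := by simp
  have h3 : 0 ≤ x ^ |s.re| := Real.rpow_nonneg hx0.le _
  rw [neg_re, e, e2, mul_assoc]
  gcongr

/-- The integrand `t ^ (-s) e ^ (w t)` of Hankel's integral as a function of `ℓ = log t`. -/
noncomputable def hankelIntegrand (s w ℓ : ℂ) : ℂ := exp (-s * ℓ) * exp (w * exp ℓ)

theorem continuous_hankelIntegrand (s w : ℂ) : Continuous (hankelIntegrand s w) := by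
  unfold hankelIntegrand
  fun_prop

theorem exp_mul_log {x : ℝ} (hx : 0 < x) (s : ℂ) : exp (s * Real.log x) = (x : ℂ) ^ s := by
  rw [cpow_def_of_ne_zero (ofReal_ne_zero.2 hx.ne'), ofReal_log hx.le, mul_comm]

theorem hankelIntegrand_lower (s w : ℂ) {x : ℝ} (hx : 0 < x) :
    hankelIntegrand s w (Real.log x - Real.pi * I) =
      exp (s * Real.pi * I) * ((x : ℂ) ^ (-s) * exp (-w * x)) := by
  rw [hankelIntegrand, exp_log_sub_pi_mul_I hx, mul_sub, sub_eq_add_neg, exp_add, exp_mul_log hx,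
    mul_neg, neg_mul w, neg_mul s, neg_neg, ← mul_assoc s]
  ring

theorem hankelIntegrand_upper (s w : ℂ) {x : ℝ} (hx : 0 < x) :
    hankelIntegrand s w (Real.log x + Real.pi * I) =
      exp (-(s * Real.pi * I)) * ((x : ℂ) ^ (-s) * exp (-w * x)) := by
  rw [hankelIntegrand, exp_log_add_pi_mul_I hx, mul_add, exp_add, exp_mul_log hx,
    mul_neg, neg_mul w, neg_mul s, ← mul_assoc s]
  ring

theorem HasIntegralOn.hankel_lower {s w : ℂ} {R : ℝ} (hR : 0 < R) {v : ℂ}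
    (h : HasIntegralOn (fun x : ℝ => (x : ℂ) ^ (-s) * exp (-w * x)) (Ioi R) v) :
    HasIntegralOn (fun x : ℝ => hankelIntegrand s w (Real.log x - Real.pi * I)) (Ioi R)
      (exp (s * Real.pi * I) * v) :=
  (h.const_mul _).congr measurableSet_Ioi fun _ hx => hankelIntegrand_lower s w (hR.trans hx)

theorem HasIntegralOn.hankel_upper {s w : ℂ} {R : ℝ} (hR : 0 < R) {v : ℂ}
    (h : HasIntegralOn (fun x : ℝ => (x : ℂ) ^ (-s) * exp (-w * x)) (Ioi R) v) :
    HasIntegralOn (fun x : ℝ => hankelIntegrand s w (Real.log x + Real.pi * I)) (Ioi R)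
      (exp (-(s * Real.pi * I)) * v) :=
  (h.const_mul _).congr measurableSet_Ioi fun _ hx => hankelIntegrand_upper s w (hR.trans hx)

/-- The integrand has the primitive Γ(1-s) t^(1-s) M(1-s, 2-s; w t), an incomplete Gamma function,
with M = `kummerBold`. Its values at the ends of the arc cancel the parts of the half-line integrals
that depend on R. What is left is Γ(1-s) w^(s-1) (e^(iπs) - e^(-iπs)), and the reflection formula
applies. -/
theorem hasLoopIntegral_hankel_of_re_lt_one {s w : ℂ} (hs : s.re < 1) (hw : 0 < w.re) {R : ℝ}
    (hR : 0 < R) : HasLoopIntegralFromInfinity (hankelIntegrand s w) R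
      (2 * Real.pi * I * (w ^ (s - 1) * (Gamma s)⁻¹)) := by
  have hT := hasIntegralOn_cpow_mul_exp_neg_Ioi hs hw hR
  have ha : 0 < (1 - s).re := by simpa using hs
  have hG0 := Gamma_ne_zero_of_re_pos ha
  set G : ℂ → ℂ := fun ℓ =>
    Gamma (1 - s) * (exp ((1 - s) * ℓ) * kummerBold (1 - s) (2 - s) (w * exp ℓ)) with hGdef
  have hG : ∀ ℓ, HasDerivAt G (hankelIntegrand s w ℓ * exp ℓ) ℓ := fun ℓ => by
    have d1 := ((hasDerivAt_id ℓ).const_mul (1 - s)).cexp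
    have d2 := (hasDerivAt_kummerBold (1 - s) (2 - s) (w * exp ℓ)).comp ℓ
      ((hasDerivAt_exp ℓ).const_mul w)
    refine ((d1.mul d2).const_mul (Gamma (1 - s))).congr_deriv ?_
    have r := kummerBold_eq_add (1 - s) (1 - s) (w * exp ℓ)
    rw [kummerBold_self, show 1 - s + 1 = 2 - s by ring, show 1 - s + 2 = 3 - s by ring] at r
    have e : exp ((1 - s) * ℓ) = exp (-s * ℓ) * exp ℓ := by rw [← exp_add]; ring_nf
    have hi := mul_inv_cancel₀ hG0
    rw [show 1 - s + 1 = 2 - s by ring, show 2 - s + 1 = 3 - s by ring]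
    simp only [id, Function.comp_apply, hankelIntegrand, e]
    linear_combination Gamma (1 - s) * exp (-s * ℓ) * exp ℓ * r +
      exp (-s * ℓ) * exp ℓ * exp (w * exp ℓ) * hi
  have h2 := hasIntegralOn_arc_of_hasDerivAt (continuous_hankelIntegrand s w) hG hR
  refine ⟨_, _, _, hT.hankel_lower hR, h2, hT.hankel_upper hR, ?_⟩
  have e1 : exp ((1 - s) * (Real.log R + Real.pi * I)) =
      -((R : ℂ) ^ (1 - s) * exp (-(s * Real.pi * I))) := by
    rw [mul_add, exp_add, exp_mul_log hR, show (1 - s) * (Real.pi * I) =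
      Real.pi * I + -(s * Real.pi * I) by ring, exp_add, exp_pi_mul_I]
    ring
  have e2 : exp ((1 - s) * (Real.log R - Real.pi * I)) =
      -((R : ℂ) ^ (1 - s) * exp (s * Real.pi * I)) := by
    rw [mul_sub, sub_eq_add_neg, exp_add, exp_mul_log hR, show -((1 - s) * (Real.pi * I)) =
      -(Real.pi * I) + s * Real.pi * I by ring, exp_add, exp_neg, exp_pi_mul_I]
    ring
  have hsin := Gamma_inv_mul_Gamma_one_sub_inv s
  have hpi : (Real.pi : ℂ) ≠ 0 := ofReal_ne_zero.2 Real.pi_ne_zero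
  have e3 : Real.pi * (Gamma s)⁻¹ = Gamma (1 - s) * sin (Real.pi * s) := by
    field_simp at hsin ⊢
    linear_combination hsin
  have e4 : exp (s * Real.pi * I) - exp (-(s * Real.pi * I)) = 2 * I * sin (Real.pi * s) := by
    rw [sin, show -(Real.pi * s) * I = -(s * Real.pi * I) by ring,
      show Real.pi * s * I = s * Real.pi * I by ring]
    linear_combination (exp (s * Real.pi * I) - exp (-(s * Real.pi * I))) * I_sq
  simp only [hGdef, exp_log_add_pi_mul_I hR, exp_log_sub_pi_mul_I hR, e1, e2, mul_neg]
  linear_combination 2 * I * w ^ (s - 1) * e3 - Gamma (1 - s) * w ^ (s - 1) * e4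

theorem integral_exp_circle (w : ℂ) (R : ℝ) :
    ∫ φ in (-Real.pi)..Real.pi, exp (w * (R * exp (φ * I))) = 2 * Real.pi := by
  have hd : DiffContOnCl ℂ (fun z => exp (w * z)) (Metric.ball 0 |R|) :=
    (by fun_prop : Differentiable ℂ fun z => exp (w * z)).diffContOnCl
  have h := hd.circleAverage
  have hper : Function.Periodic (fun φ : ℝ => exp (w * circleMap 0 R φ)) (2 * Real.pi) :=
    (periodic_circleMap 0 R).comp fun z => exp (w * z)
  have hshift := hper.intervalIntegral_add_eq (-Real.pi) 0
  rw [show -Real.pi + 2 * Real.pi = Real.pi by ring, zero_add] at hshift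
  rw [Real.circleAverage_def, ← hshift, mul_zero, exp_zero, inv_smul_eq_iff₀ (by positivity)] at h
  simpa [circleMap] using h

/-- The recursion in s divides by s - 1, so this value is treated directly: the half-lines cancel,
and the circle gives 2πi by the mean value property. -/
theorem hasLoopIntegral_hankel_one {w : ℂ} (hw : 0 < w.re) {R : ℝ} (hR : 0 < R) :
    HasLoopIntegralFromInfinity (hankelIntegrand 1 w) R
      (2 * Real.pi * I * (w ^ ((1 : ℂ) - 1) * (Gamma 1)⁻¹)) := by
  have hT : HasIntegralOn (fun x : ℝ => (x : ℂ) ^ (-1 : ℂ) * exp (-w * x)) (Ioi R) _ :=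
    ⟨integrableOn_cpow_mul_exp_neg_Ioi 1 hw hR, rfl⟩
  have hpi : -Real.pi ≤ Real.pi := by linarith [Real.pi_pos]
  refine ⟨_, _, _, hT.hankel_lower hR,
    ⟨integrableOn_Ioc_of_continuous (continuous_hankelIntegrand 1 w) R, rfl⟩,
    hT.hankel_upper hR, ?_⟩
  have e : ∀ φ : ℝ, hankelIntegrand 1 w (Real.log R + φ * I) * (I * R * exp (φ * I)) =
      I * exp (w * (R * exp (φ * I))) := fun φ => by
    have h1 : exp ((Real.log R : ℂ) + φ * I) = R * exp (φ * I) := by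
      rw [exp_add, ← ofReal_exp, Real.exp_log hR]
    have hR0 : (R : ℂ) * exp (φ * I) ≠ 0 := mul_ne_zero (ofReal_ne_zero.2 hR.ne') (exp_ne_zero _)
    rw [hankelIntegrand, neg_one_mul, exp_neg, h1]
    linear_combination I * exp (w * (R * exp (φ * I))) * inv_mul_cancel₀ hR0
  simp only [e]
  rw [← intervalIntegral.integral_of_le hpi, intervalIntegral.integral_const_mul,
    integral_exp_circle, one_mul, exp_neg, exp_pi_mul_I, sub_self, cpow_zero, Gamma_one]
  ring

theorem tendsto_cpow_mul_exp_neg (s : ℂ) {w : ℂ} (hw : 0 < w.re) :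
    Tendsto (fun x : ℝ => (x : ℂ) ^ (-s) * exp (-w * x)) atTop (𝓝 0) := by
  rw [tendsto_zero_iff_norm_tendsto_zero]
  refine (tendsto_rpow_mul_exp_neg_mul_atTop_nhds_zero (-s.re) w.re hw).congr' ?_
  filter_upwards [eventually_gt_atTop 0] with x hx
  rw [norm_mul, norm_cpow_eq_rpow_re_of_pos hx, norm_exp]
  simp

/-- The integrand is the derivative of t^(1-s) e^(w t), which vanishes at both ends of the loop
because Re w > 0. -/
theorem hasLoopIntegral_hankel_recursion (s : ℂ) {w : ℂ} (hw : 0 < w.re) {R : ℝ} (hR : 0 < R) :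
    HasLoopIntegralFromInfinity
      (fun ℓ => w * hankelIntegrand (s - 1) w ℓ - (s - 1) * hankelIntegrand s w ℓ) R 0 := by
  have i₁ : ∀ s : ℂ, HasIntegralOn _ (Ioi R) _ := fun s =>
    HasIntegralOn.hankel_lower hR ⟨integrableOn_cpow_mul_exp_neg_Ioi s hw hR, rfl⟩
  have i₃ : ∀ s : ℂ, HasIntegralOn _ (Ioi R) _ := fun s =>
    HasIntegralOn.hankel_upper hR ⟨integrableOn_cpow_mul_exp_neg_Ioi s hw hR, rfl⟩
  have hc := continuous_hankelIntegrand
  refine hasLoopIntegralFromInfinity_of_hasDerivAt (G := hankelIntegrand (s - 1) w)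
    (g := fun ℓ => w * hankelIntegrand (s - 1) w ℓ - (s - 1) * hankelIntegrand s w ℓ)
    (((hc _ w).const_mul _).sub ((hc _ w).const_mul _)) (fun ℓ => ?_) hR
    (((i₁ _).const_mul _).sub ((i₁ _).const_mul _)).1
    (((i₃ _).const_mul _).sub ((i₃ _).const_mul _)).1 ?_ ?_
  · have d := (((hasDerivAt_id ℓ).const_mul (-(s - 1))).cexp).mul
      (((hasDerivAt_exp ℓ).const_mul w).cexp)
    refine d.congr_deriv ?_
    have e : exp (-(s - 1) * ℓ) = exp (-s * ℓ) * exp ℓ := by rw [← exp_add]; ring_nf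
    simp only [id, hankelIntegrand, e]
    ring
  · have := (tendsto_cpow_mul_exp_neg (s - 1) hw).const_mul (exp ((s - 1) * Real.pi * I))
    rw [mul_zero] at this
    refine this.congr' ?_
    filter_upwards [eventually_gt_atTop 0] with x hx
    rw [hankelIntegrand_lower _ _ hx]
  · have := (tendsto_cpow_mul_exp_neg (s - 1) hw).const_mul (exp (-((s - 1) * Real.pi * I)))
    rw [mul_zero] at this
    refine this.congr' ?_
    filter_upwards [eventually_gt_atTop 0] with x hx
    rw [hankelIntegrand_upper _ _ hx]

/-- Hankel's integral for the reciprocal of the Gamma function. -/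
theorem hasLoopIntegral_hankel (s : ℂ) {w : ℂ} (hw : 0 < w.re) {R : ℝ} (hR : 0 < R) :
    HasLoopIntegralFromInfinity (hankelIntegrand s w) R
      (2 * Real.pi * I * (w ^ (s - 1) * (Gamma s)⁻¹)) := by
  obtain ⟨n, hn⟩ := exists_nat_gt (s.re - 1)
  replace hn : s.re < n + 1 := by linarith
  -- Each step integrates by parts, from s - 1 to s, and uses 1/Γ(s-1) = (s-1)/Γ(s).
  induction n generalizing s with
  | zero => exact hasLoopIntegral_hankel_of_re_lt_one (by simpa using hn) hw hR
  | succ n ih =>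
    by_cases hs : s = 1
    · rw [hs]; exact hasLoopIntegral_hankel_one hw hR
    push_cast at hn
    have hs1 : s - 1 ≠ 0 := sub_ne_zero.2 hs
    have h := ((ih (s - 1) (by simp only [sub_re, one_re]; linarith)).const_mul w).sub
      (hasLoopIntegral_hankel_recursion s hw hR)
    have h' := h.const_mul (s - 1)⁻¹
    have hw0 : w ≠ 0 := by rintro rfl; simp at hw
    have hG := inv_Gamma_eq (s - 1)
    rw [sub_add_cancel] at hG
    have e : w ^ (s - 1) = w ^ (s - 1 - 1) * w := by
      rw [cpow_sub (s - 1) 1 hw0, cpow_one, div_mul_cancel₀ _ hw0]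
    convert h' using 1
    · funext ℓ
      field_simp
      ring
    · rw [hG, e]
      field_simp
      ring

theorem norm_mul_exp_neg_le {z ℓ : ℂ} {R : ℝ} (hR : 0 < R) (hℓ : Real.log R ≤ ℓ.re) :
    ‖z * exp (-ℓ)‖ ≤ ‖z‖ / R := by
  rw [norm_mul, norm_exp, neg_re, Real.exp_neg, div_eq_mul_inv]
  have : R ≤ Real.exp ℓ.re := (Real.log_le_iff_le_exp hR).1 hℓ
  gcongr

/-- The loop integral of the confluent function. -/
theorem hasLoopIntegral_kummerBold (a c : ℂ) {w z : ℂ} (hw : 0 < w.re) {R : ℝ} (hz : ‖z‖ < R) :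
    HasLoopIntegralFromInfinity
      (fun ℓ => hankelIntegrand c w ℓ * (1 - z * exp (-ℓ)) ^ (-a)) R
      (2 * Real.pi * I * (w ^ (c - 1) * kummerBold a c (z * w))) := by
  have hR : 0 < R := (norm_nonneg z).trans_lt hz
  have hw0 : w ≠ 0 := by rintro rfl; simp at hw
  have hlt : ‖z‖ / R < 1 := (div_lt_one hR).2 hz
  have hu : Summable fun n : ℕ =>
      ‖(ascPochhammer ℂ n).eval a / n.factorial * ((‖z‖ / R : ℝ) : ℂ) ^ n‖ :=
    (hasSum_one_sub_cpow_neg a (x := ((‖z‖ / R : ℝ) : ℂ)) (by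
      rwa [norm_real, Real.norm_of_nonneg (by positivity)])).summable.norm
  -- On the loop |z/t| ≤ |z|/R < 1, so (1 - z/t)^(-a) is expanded uniformly. The term with t^(-n) is
  -- Hankel's integral with c + n in place of c, and this puts 1/Γ(c+n) into the series.
  obtain ⟨v, hv, hsum⟩ := hasSum_loopIntegralFromInfinity
    (g := hankelIntegrand c w) (H := fun ℓ => (1 - z * exp (-ℓ)) ^ (-a))
    (h := fun n ℓ => (ascPochhammer ℂ n).eval a / n.factorial * (z * exp (-ℓ)) ^ n)
    (V := fun n => (ascPochhammer ℂ n).eval a / n.factorial * z ^ n *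
      (2 * Real.pi * I * (w ^ (c + n - 1) * (Gamma (c + n))⁻¹))) hR
    (fun n => by fun_prop) hu
    (fun n ℓ hℓ => by
      rw [norm_mul, norm_mul, norm_pow, norm_pow, norm_real,
        Real.norm_of_nonneg (by positivity : (0 : ℝ) ≤ ‖z‖ / R)]
      have := norm_mul_exp_neg_le (z := z) hR hℓ
      gcongr)
    (fun ℓ hℓ => hasSum_one_sub_cpow_neg a ((norm_mul_exp_neg_le hR hℓ).trans_lt hlt))
    ⟨_, hasLoopIntegral_hankel c hw hR⟩
    (fun n => by
      convert (hasLoopIntegral_hankel (c + n) hw hR).const_mul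
        ((ascPochhammer ℂ n).eval a / n.factorial * z ^ n) using 2 with ℓ
      rw [hankelIntegrand, hankelIntegrand, mul_pow, ← exp_nat_mul,
        show -(c + n) * ℓ = -c * ℓ + n * -ℓ by ring, exp_add]
      ring)
  have hM := (hasSum_kummerBold a c (z * w)).mul_left (2 * Real.pi * I * w ^ (c - 1))
  have hM' := hM.congr_fun (g := fun n : ℕ => (ascPochhammer ℂ n).eval a / n.factorial * z ^ n *
      (2 * Real.pi * I * (w ^ (c + n - 1) * (Gamma (c + n))⁻¹))) fun n => by
    rw [kummerTerm, show c + n - 1 = c - 1 + n by ring, cpow_add _ _ hw0, cpow_natCast, mul_pow]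
    ring
  rw [hsum.unique hM', mul_assoc] at hv
  exact hv

/-- In `hasLoopIntegral_kummerBold` the product z w is what enters the confluent function. Here the
exponential rate is 1 and z = w; for the loop at 0 the rate is w and z = 1, after inversion with R =
1/r. -/
theorem hasLoopIntegralFromInfinity_FBold (θ α : ℂ) {w : ℂ} {R : ℝ} (hw : ‖w‖ < R) :
    HasLoopIntegralFromInfinity
      (fun ℓ => exp ((-1 + θ - α) / 2 * ℓ) * exp (exp ℓ) *
        (exp ((-1 - θ - α) / 2 * ℓ) * (1 - w * exp (-ℓ)) ^ ((-1 - θ - α) / 2)))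
      R (2 * Real.pi * I * FBold θ α w) := by
  have h := hasLoopIntegral_kummerBold ((1 + α + θ) / 2) (1 + α) (w := 1) (by simp) hw
  rw [one_cpow, one_mul, mul_one] at h
  rw [FBold]
  convert h using 2 with ℓ
  rw [hankelIntegrand, one_mul, show -((1 + α + θ) / 2) = (-1 - θ - α) / 2 by ring,
    show -(1 + α) * ℓ = (-1 + θ - α) / 2 * ℓ + (-1 - θ - α) / 2 * ℓ by ring, exp_add]
  ring

theorem hasLoopIntegralFromZero_FBold (θ α : ℂ) {w : ℂ} {r : ℝ} (hw : 0 < w.re) (hr : 0 < r)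
    (hr1 : r < 1) :
    HasLoopIntegralFromZero
      (fun ℓ => exp (w * exp (-ℓ)) * exp ((-1 - α) * ℓ) * (1 - exp ℓ) ^ ((-1 - θ + α) / 2))
      r (2 * Real.pi * I * (w ^ (-α) * FBold θ (-α) w)) := by
  apply hasLoopIntegralFromZero_of_fromInfinity hr
  have h := hasLoopIntegral_kummerBold ((1 - α + θ) / 2) (1 - α) (z := 1) hw (R := r⁻¹)
    (by rw [norm_one]; exact (one_lt_inv₀ hr).2 hr1)
  rw [one_mul, sub_sub_cancel_left] at h
  rw [FBold, ← sub_eq_add_neg]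
  convert h using 2 with ℓ
  rw [hankelIntegrand, one_mul, neg_neg, show -((1 - α + θ) / 2) = (-1 - θ + α) / 2 by ring,
    show -(1 - α) * ℓ = (-1 - α) * -ℓ + -2 * ℓ by ring, exp_add]
  ring

end Hankel

/-! ### The main theorem, assembled from the parts above. -/

theorem mainTheorem10 :
    -- solutions from contour integrals of type a)
    (∀ (a c : ℂ) (p q : ℝ → ℂ) (U : Set ℂ) (L₀ L₁ : ℝ × ℂ → ℂ),
      IsPiecewiseC1 p → IsPiecewiseC1 q → IsOpen U →
      IsLogBranchOn L₀ (fun x => p x.1 + x.2 * q x.1) (Ioo 0 1 ×ˢ U) →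
      IsLogBranchOn L₁ (fun x => p x.1 + x.2 * q x.1 - x.2) (Ioo 0 1 ×ˢ U) →
      (∀ w ∈ U, IntegrableOn (integrandA a c p q L₀ L₁ w) (Ioo 0 1)) →
      ∀ w ∈ U,
        AdmissibleEnd p q (boundaryA a c p q L₀ L₁ w) (𝓝[>] 0) →
        AdmissibleEnd p q (boundaryA a c p q L₀ L₁ w) (𝓝[<] 1) →
        EndpointVariationZero (boundaryA a c p q L₀ L₁ w) →
        SolvesKummerAt a c (fun z => ∫ τ in Ioo (0 : ℝ) 1, integrandA a c p q L₀ L₁ z τ) w) ∧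
    -- solutions from contour integrals of type b)
    (∀ (a c : ℂ) (t : ℝ → ℂ) (U : Set ℂ) (L₀ L₁ : ℝ → ℂ),
      IsPiecewiseC1 t → IsOpen U →
      IsLogBranchOn L₀ t (Ioo 0 1) →
      IsLogBranchOn L₁ (fun τ => 1 - t τ) (Ioo 0 1) →
      (∀ w ∈ U, IntegrableOn (integrandB a c t L₀ L₁ w) (Ioo 0 1)) →
      ∀ w ∈ U, EndpointVariationZero (boundaryB a c t L₀ L₁ w) →
        SolvesKummerAt a c (fun z => ∫ τ in Ioo (0 : ℝ) 1, integrandB a c t L₀ L₁ z τ) w) ∧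
    -- the limit that defines the function `₂F₀` exists
    (∀ a b w : ℂ, -w ∈ slitPlane →
      Tendsto (fun c : ℝ => gaussF a b (c : ℂ) ((c : ℂ) * w)) atTop (𝓝 (twoFZero a b w))) ∧
    (∀ θ α : ℂ,
      -- the four standard solutions solve Kummer's equation
      (∀ w : ℂ, SolvesKummerAt ((1 + α + θ) / 2) (1 + α) (FBold θ α) w) ∧
      (∀ w ∈ slitPlane, SolvesKummerAt ((1 + α + θ) / 2) (1 + α)
        (fun z => z ^ (-α) * FBold θ (-α) z) w) ∧
      (∀ w ∈ slitPlane, SolvesKummerAt ((1 + α + θ) / 2) (1 + α)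
        (fun z => z ^ ((-1 - θ - α) / 2) * FTilde θ α (-z⁻¹)) w) ∧
      (∀ w : ℂ, -w ∈ slitPlane → SolvesKummerAt ((1 + α + θ) / 2) (1 + α)
        (fun z => exp z * (-z) ^ ((-1 + θ - α) / 2) * FTilde (-θ) α z⁻¹) w) ∧
      -- type a), contour `]-∞, (0,w)⁺, -∞[`
      (∀ (w : ℂ) (R : ℝ), ‖w‖ < R →
        HasLoopIntegralFromInfinity
          (fun ℓ => exp ((-1 + θ - α) / 2 * ℓ) * exp (exp ℓ) *
            (exp ((-1 - θ - α) / 2 * ℓ) * (1 - w * exp (-ℓ)) ^ ((-1 - θ - α) / 2)))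
          R (2 * Real.pi * I * FBold θ α w)) ∧
      -- type a), contours `[0,w]` and `[w,0]`
      (|θ.re| < (1 - α).re →
        (∀ w ∈ slitPlane, HasIntegralOn
          (fun s : ℝ => (s * w) ^ ((-1 + θ - α) / 2) * exp (s * w) *
            (w - s * w) ^ ((-1 - θ - α) / 2) * w)
          (Ioo 0 1) (w ^ (-α) * FTypeI θ (-α) w)) ∧
        (∀ w : ℂ, -w ∈ slitPlane → HasIntegralOn
          (fun s : ℝ => (-(s * w)) ^ ((-1 + θ - α) / 2) * exp (s * w) *
            (s * w - w) ^ ((-1 - θ - α) / 2) * (-w))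
          (Ioo 0 1) ((-w) ^ (-α) * FTypeI θ (-α) w))) ∧
      -- type a), contour `]-∞,0]`
      (0 < (1 + θ - α).re → ∀ w ∈ slitPlane, HasIntegralOn
        (fun t : ℝ => (-(t : ℂ)) ^ ((-1 + θ - α) / 2) * exp t *
          (w - t) ^ ((-1 - θ - α) / 2))
        (Iio 0) (w ^ ((-1 - θ - α) / 2) * FTildeI θ α (-w⁻¹))) ∧
      -- type a), contour `]-∞,w]`, parametrized by `t = w + x` with `x < 0`
      (0 < (1 - θ - α).re → ∀ w : ℂ, -w ∈ slitPlane → HasIntegralOn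
        (fun x : ℝ => (-(w + x)) ^ ((-1 + θ - α) / 2) * exp (w + x) *
          (w - (w + x)) ^ ((-1 - θ - α) / 2))
        (Iio 0) (exp w * (-w) ^ ((-1 + θ - α) / 2) * FTildeI (-θ) α w⁻¹)) ∧
      -- type b), contour `[1,∞[`
      (|θ.re| < (1 + α).re → ∀ w : ℂ, HasIntegralOn
        (fun t : ℝ => exp (w / t) * (t : ℂ) ^ (-1 - α) *
          ((t : ℂ) - 1) ^ ((-1 - θ + α) / 2))
        (Ioi 1) (FTypeI θ α w)) ∧
      -- type b), contour `(0-0)⁺`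
      (∀ (w : ℂ) (r : ℝ), 0 < w.re → 0 < r → r < 1 →
        HasLoopIntegralFromZero
          (fun ℓ => exp (w * exp (-ℓ)) * exp ((-1 - α) * ℓ) *
            (1 - exp ℓ) ^ ((-1 - θ + α) / 2))
          r (2 * Real.pi * I * (w ^ (-α) * FBold θ (-α) w))) ∧
      -- type b), contour `]-∞,0]`
      (0 < (1 + θ + α).re → ∀ w : ℂ, 0 < w.re → HasIntegralOn
        (fun t : ℝ => exp (w / t) * (-(t : ℂ)) ^ (-1 - α) *
          (1 - (t : ℂ)) ^ ((-1 - θ + α) / 2))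
        (Iio 0) (w ^ ((-1 - θ - α) / 2) * FTildeI θ (-α) (-w⁻¹))) ∧
      -- type b), contour `[0,1]`
      (0 < (1 - θ + α).re → ∀ w : ℂ, w.re < 0 → HasIntegralOn
        (fun t : ℝ => exp (w / t) * (t : ℂ) ^ (-1 - α) *
          (1 - (t : ℂ)) ^ ((-1 - θ + α) / 2))
        (Ioo 0 1) (exp w * (-w) ^ ((-1 + θ - α) / 2) * FTildeI (-θ) (-α) w⁻¹)) ∧
      -- connection formulas, for both signs `ε = 1` and `ε = -1`
      ((∀ n : ℤ, α ≠ n) → ∀ ε : ℂ, (ε = 1 ∨ ε = -1) →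
        (∀ w ∈ slitPlane,
          w ^ ((-1 - θ - α) / 2) * FTilde θ (ε * α) (-w⁻¹) =
            Real.pi * FBold θ α w / (sin (Real.pi * (-α)) * Gamma ((1 + θ - α) / 2)) +
            Real.pi * (w ^ (-α) * FBold θ (-α) w) /
              (sin (Real.pi * α) * Gamma ((1 + θ + α) / 2))) ∧
        (∀ w : ℂ, -w ∈ slitPlane →
          exp w * (-w) ^ ((-1 + θ - α) / 2) * FTilde (-θ) (ε * α) w⁻¹ =
            Real.pi * FBold θ α w / (sin (Real.pi * (-α)) * Gamma ((1 - θ - α) / 2)) +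
            Real.pi * ((-w) ^ (-α) * FBold θ (-α) w) /
              (sin (Real.pi * α) * Gamma ((1 - θ + α) / 2))))) := by
  refine ⟨solvesKummerAt_integral_integrandA, solvesKummerAt_integral_integrandB,
    fun a b w hw => tendsto_gaussF_twoFZero hw a b, fun θ α =>
    ⟨fun w => solvesKummerAt_kummerBold _ _ w, fun w hw => ?_,
    fun w hw => solvesKummerAt_cpow_mul_FTilde θ α hw,
    fun w hw => solvesKummerAt_exp_mul_cpow_mul_FTilde θ α hw,
    fun w R hR => hasLoopIntegralFromInfinity_FBold θ α hR,
    fun h => ⟨fun w hw => hasIntegralOn_segment h (slitPlane_ne_zero hw),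
      fun w hw => hasIntegralOn_segment_neg h (neg_ne_zero.1 (slitPlane_ne_zero hw))⟩,
    fun h w hw => hasIntegralOn_Iio_zero_typeA h hw,
    fun h w hw => hasIntegralOn_Iio_zero_translate h hw,
    fun h w => hasIntegralOn_Ioi_one h w,
    fun w r hw hr hr1 => hasLoopIntegralFromZero_FBold θ α hw hr hr1,
    fun h w hw => hasIntegralOn_Iio_zero_typeB h hw,
    fun h w hw => hasIntegralOn_Ioo_zero_one_typeB h hw,
    fun hα ε hε => ⟨fun w hw => ?_, fun w hw => ?_⟩⟩⟩
  · have h := solvesKummerAt_cpow_mul_kummerBold ((1 + α + θ) / 2) (1 + α) hw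
    have e : (fun z => z ^ (-α) * FBold θ (-α) z) = fun z => z ^ (1 - (1 + α)) *
        kummerBold ((1 + α + θ) / 2 - (1 + α) + 1) (2 - (1 + α)) z := by
      funext z
      rw [FBold]
      ring_nf
    rwa [e]
  · rw [FTilde_mul_sign hε]
    exact cpow_mul_FTilde_connection hα hw
  · rw [FTilde_mul_sign hε]
    exact exp_mul_cpow_mul_FTilde_connection hα hw
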